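/- **Setting.** Let $\mathbf T^4=(\mathbf R/2\pi\mathbf Z)^4$ with Lebesgue measure, and let $G\ge 0$ be the Green's function of $1-\Delta$ on $\mathbf T^4$, i.e. $(1-\Delta)G=\delta_0$, $G=\int_0^\infty e^{-t}p_t\,dt$ with $p_t$ the heat kernel of $\Delta$. Let $\mathcal S((\mathbf T^4)^k)=C^\infty((\mathbf T^4)^k;\mathbf R)$ and let $\mathcal S'((\mathbf T^4)^k)$ be its dual. Fix $\rho\in C_c^\infty(\mathbf R^4)$, nonnegative, radial, $\int\rho=1$, put $\rho_\varepsilon=\varepsilon^{-4}\rho(\cdot/\varepsilon)$ and $G_\varepsilon=\rho_\varepsilon\star G$. *The field $\mathrm I$.* $\mathrm I$ is the centred Gaussian random field in $\mathcal S'((\mathbf T^4)^2)$ with $\mathbf E[\mathrm I(\varphi)\mathrm I(\psi)]=C(\varphi,\psi)$, where $$C(\varphi,\psi)=\int \varphi(x,y)\,\psi(x',y')\int_{\mathbf T^4}G(x-z)G(y-z)G(x'-z)G(y'-z)\,dz\;dx\,dy\,dx'\,dy'.$$ *Feynman diagrams.* A diagram $\Gamma$ is a finite directed multigraph whose vertices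 are leaves or internal vertices $V_\star$. Subdiagrams consist of internal vertices and of edges between them; a subdiagram is full if with an edge it contains all parallel copies of it (same source, same target). The valuation $\Pi_\varepsilon\Gamma$ is the product of $G_\varepsilon(x_{e_+}-x_{e_-})$ over all edges $e$, integrated over all internal variables; for a connected diagram without leaves, over all variables but one. A connected subdiagram with $v$ vertices and $e$ edges has degree $4(v-1)-2e$; it is divergent if it is full and its degree is $<0$. A forest is a set $\mathfrak F$ of divergent subdiagrams any two of which are nested or vertex-disjoint. $\mathcal C_{\mathfrak F}\Gamma$ is the product of the following diagrams: $\Gamma$ with all members of $\mathfrak F$ contracted to points, and each member of $\mathfrak F$ with all strictly smaller members of $\mathfrak F$ contracted. The BPHZ-renormalised valuation is $\hat\Pi_\varepsilon\Gamma=\sum_{\mathfrak F}(-1)^{|\mathfrak F|}\,\Pi_\varepsilon\,\mathcal C_{\mathfrak F}\Gamma$, where $\Pi_\varepsilon$ of a product is the product of the valuations. *Pairings.* $\mathcal I_n$ is the linear tree (path) with two leaves as endpoints and $n$ inner vertices. For a complete pairing $\kappa$ (perfect matching) of the $n+m$ inner vertices of $\mathcal I_n$ and $\mathcal I_m$, let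 $(\mathcal I_n,\mathcal I_m)_\kappa$ be the diagram with four leaves obtained by identifying paired vertices. The pairing $\kappa$ is contributing if for some $\varphi\in\mathcal S((\mathbf T^4)^4)$ $$\limsup_{\varepsilon\to0}\ (\log\tfrac1\varepsilon)^{-\frac{n+m-2}{2}}\,\bigl|\hat\Pi_\varepsilon(\mathcal I_n,\mathcal I_m)_\kappa(\varphi)\bigr|>0 .$$ *Variance constants.* A bubble is a pair of distinct vertices joined by two edges. A bubble extraction sequence of a diagram $\Gamma$ with $N=|V_\star|$ is an increasing sequence $\tilde\Gamma_1\subseteq\dots\subseteq\tilde\Gamma_{N-1}$ of subdiagrams such that, with $\tilde\Gamma_0=\emptyset$, each $\tilde\Gamma_i/\tilde\Gamma_{i-1}\subseteq\Gamma/\tilde\Gamma_{i-1}$ (every connected component of $\tilde\Gamma_{i-1}$ contracted to a point) consists of a bubble together with the vertices to which $\tilde\Gamma_{i-1}$ is contracted. Let $\mathbb S(\Gamma)$ be the set of these sequences (it has one element if $N=1$) and $$\sigma_\Gamma^2=\Bigl(\frac1{\sqrt8\,\pi}\Bigr)^{2(N-1)}\frac{|\mathbb S(\Gamma)|}{(N-1)!},\qquad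 \sigma_{n,m}^2=\sum_{\kappa\text{ contributing}}\sigma^2_{(\mathcal I_n,\mathcal I_m)_\kappa},\qquad \sigma_n=\sqrt{\sigma_{n,n}^2}\qquad(n,m\ge1).$$ *The fields $\mathrm I^{(n)}$.* Let $(\mathrm I^{(n)})_{n\ge1}$ be jointly Gaussian centred random fields in $\mathcal S'((\mathbf T^4)^2)$, on a common probability space, with $$\mathbf E[\mathrm I^{(n)}(\varphi)\,\mathrm I^{(m)}(\psi)]=\frac{\sigma_{n,m}^2}{\sigma_n\sigma_m}\,C(\varphi,\psi)\qquad(n,m\ge1).$$ In particular each $\mathrm I^{(n)}$ has the law of $\mathrm I$; the $\mathrm I^{(n)}$ are not independent. **Theorem.** For all $\hat\lambda\in\mathbf R$ with $|\hat\lambda|<\sqrt2\,\pi$ the series $\mathcal U=\sum_{n=1}^\infty\sigma_n\hat\lambda^{n-1}\mathrm I^{(n)}$ converges almost surely in $\mathcal S'((\mathbf T^4)^2)$, and in law $$\mathcal U\overset d=\sigma_{\mathrm{eff}}(\hat\lambda)\,\mathrm I,\qquad \sigma_{\mathrm{eff}}(\hat\lambda)\geq 0,\qquad \sigma_{\mathrm{eff}}^2(\hat\lambda)=\frac{2\pi^2}{2\pi^2-\hat\lambda^2}=\sum_{n=0}^\infty\Bigl(\frac{\hat\lambda^2}{2\pi^2}\Bigr)^n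 .$$ -/

import Mathlib

open MeasureTheory ProbabilityTheory Filter Topology

noncomputable section

namespace Anderson

/-! ### The torus, its test functions and its distributions -/

instance fact_two_pi_pos : Fact (0 < 2 * Real.pi) := ⟨Real.two_pi_pos⟩

/-- The four-dimensional torus `(ℝ / 2πℤ)⁴`. Its `volume` is Lebesgue measure, of total mass
`(2π)⁴`. -/
abbrev T4 : Type := Fin 4 → AddCircle (2 * Real.pi)

/-- The projection `ℝ⁴ → 𝕋⁴`. -/
def toT4 (v : Fin 4 → ℝ) : T4 := fun i => (v i : AddCircle (2 * Real.pi))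

/-- The periodic lift to `(ℝ⁴)^ι` of a function on `(𝕋⁴)^ι`. -/
def lift {ι : Type} (f : (ι → T4) → ℝ) : (ι → Fin 4 → ℝ) → ℝ := fun x => f fun i => toT4 (x i)

/-- The real vector space of smooth functions on `(𝕋⁴)^ι`. -/
def smoothSubmodule (ι : Type) [Fintype ι] : Submodule ℝ ((ι → T4) → ℝ) where
  carrier := {f | ContDiff ℝ (⊤ : ℕ∞) (lift f)}
  add_mem' := fun {f g} (hf : ContDiff ℝ (⊤ : ℕ∞) (lift f))
    (hg : ContDiff ℝ (⊤ : ℕ∞) (lift g)) => hf.add hg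
  zero_mem' := (contDiff_const : ContDiff ℝ (⊤ : ℕ∞) fun _ : ι → Fin 4 → ℝ => (0 : ℝ))
  smul_mem' := fun c f (hf : ContDiff ℝ (⊤ : ℕ∞) (lift f)) => (contDiff_const (c := c)).mul hf

/-- The space `𝒮((𝕋⁴)^ι; ℝ) = C^∞((𝕋⁴)^ι; ℝ)` of test functions. -/
def TestFun (ι : Type) [Fintype ι] : Type := smoothSubmodule ι

namespace TestFun

variable {ι : Type} [Fintype ι]

instance : AddCommGroup (TestFun ι) := inferInstanceAs (AddCommGroup (smoothSubmodule ι))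

instance : Module ℝ (TestFun ι) := inferInstanceAs (Module ℝ (smoothSubmodule ι))

instance : CoeFun (TestFun ι) fun _ => (ι → T4) → ℝ := ⟨fun φ => φ.1⟩

theorem contDiff_lift (φ : TestFun ι) : ContDiff ℝ (⊤ : ℕ∞) (lift φ) := φ.2

/-- The `k`-th derivative of (the periodic lift of) a test function, as a continuous map. -/
def derivMap (k : ℕ) (φ : TestFun ι) :
    C(ι → Fin 4 → ℝ, (ι → Fin 4 → ℝ) [×k]→L[ℝ] ℝ) :=
  ⟨iteratedFDeriv ℝ k (lift φ),
    φ.contDiff_lift.continuous_iteratedFDeriv (by exact_mod_cast le_top)⟩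

/-- The usual Fréchet topology of `C^∞`: uniform convergence of all derivatives. (As lifts are
periodic, locally uniform convergence is the same as uniform convergence.) -/
instance : TopologicalSpace (TestFun ι) :=
  ⨅ k : ℕ, TopologicalSpace.induced (derivMap k) inferInstance

end TestFun

/-- The space `𝒮'((𝕋⁴)^ι; ℝ)` of distributions, with the strong dual topology (the topology that
Mathlib puts on spaces of continuous linear maps). -/
abbrev Distr (ι : Type) [Fintype ι] : Type := TestFun ι →L[ℝ] ℝ

/-- The cylindrical σ-algebra on distributions, generated by the evaluations at test functions. -/
instance Distr.measurableSpace (ι : Type) [Fintype ι] : MeasurableSpace (Distr ι) :=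
  ⨆ φ : TestFun ι, MeasurableSpace.comap (fun u : Distr ι => u φ) inferInstance

/-! ### The Green's function and its mollification -/

/-- The heat kernel at time `t` (the fundamental solution of `∂ₜ - Δ`) on `𝕋⁴`: the Gaussian kernel
of `ℝ⁴`, summed over all `v ∈ ℝ⁴` that represent the point `x` of the torus. -/
def heatKernel (t : ℝ) (x : T4) : ℝ :=
  ∑' v : {v : Fin 4 → ℝ // toT4 v = x},
    ((4 * Real.pi * t) ^ 2)⁻¹ * Real.exp (-(∑ i, v.1 i ^ 2) / (4 * t))

/-- The Green's function `G = (1 - Δ)⁻¹ δ₀ = ∫₀^∞ e^{-t} e^{tΔ} δ₀ dt` of `1 - Δ` on `𝕋⁴`. -/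
def green (x : T4) : ℝ := ∫ t in Set.Ioi (0 : ℝ), Real.exp (-t) * heatKernel t x

/-- A mollifier: nonnegative, radial, smooth, compactly supported on `ℝ⁴`, of integral one. -/
structure IsMollifier (ρ : EuclideanSpace ℝ (Fin 4) → ℝ) : Prop where
  nonneg : ∀ x, 0 ≤ ρ x
  radial : ∀ x y, ‖x‖ = ‖y‖ → ρ x = ρ y
  smooth : ContDiff ℝ (⊤ : ℕ∞) ρ
  compact_support : HasCompactSupport ρ
  integral_eq_one : ∫ x, ρ x = 1

/-- The mollified Green's function `G_ε = ρ_ε ⋆ G`, where `ρ_ε(y) = ε⁻⁴ ρ(y/ε)`. -/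
def greenMoll (ρ : EuclideanSpace ℝ (Fin 4) → ℝ) (ε : ℝ) (x : T4) : ℝ :=
  ∫ y : EuclideanSpace ℝ (Fin 4), (ε ^ 4)⁻¹ * ρ (ε⁻¹ • y) * green (x - toT4 fun i => y i)

/-! ### Feynman diagrams -/

/-- A Feynman diagram with set of leaves `L`: a finite directed multigraph with vertex set `L ⊔ V`,
where `V` is the set of internal vertices. Edges carry names, so that parallel edges are allowed. -/
structure FeynmanDiagram (L : Type) where
  V : Type
  E : Type
  finV : Finite V
  finE : Finite E
  src : E → L ⊕ V
  tgt : E → L ⊕ V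

namespace FeynmanDiagram

variable {L : Type}

instance (Γ : FeynmanDiagram L) : Finite Γ.V := Γ.finV

instance (Γ : FeynmanDiagram L) : Finite Γ.E := Γ.finE

instance (Γ : FeynmanDiagram L) : Fintype Γ.V := Fintype.ofFinite _

instance (Γ : FeynmanDiagram L) : Fintype Γ.E := Fintype.ofFinite _

/-- The valuation of a diagram with leaves, for the kernel `K`, as a function of the leaf variables:
the product of `K(x_{e₊} - x_{e₋})` over all edges, integrated over all internal variables.
It is used only for diagrams each of whose connected components has a leaf; the integral is then
the product of those of the components. -/
def val (K : T4 → ℝ) (Γ : FeynmanDiagram L) (x : L → T4) : ℝ :=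
  ∫ z : Γ.V → T4, ∏ e : Γ.E, K (Sum.elim x z (Γ.tgt e) - Sum.elim x z (Γ.src e))

open Classical in
/-- The valuation of a connected diagram without leaves: one (arbitrary) vertex is put at the origin
and all other variables are integrated. -/
def vacVal (K : T4 → ℝ) (Γ : FeynmanDiagram Empty) : ℝ :=
  if h : Nonempty Γ.V then
    ∫ z : {v : Γ.V // v ≠ Classical.choice h} → T4,
      let pos : Empty ⊕ Γ.V → T4 :=
        Sum.elim Empty.elim fun v => if hv : v ≠ Classical.choice h then z ⟨v, hv⟩ else 0
      ∏ e : Γ.E, K (pos (Γ.tgt e) - pos (Γ.src e))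
  else 1

/-- A subdiagram: a set of internal vertices and a set of internal edges between them. -/
@[ext]
structure Sub (Γ : FeynmanDiagram L) where
  verts : Set Γ.V
  edges : Set Γ.E
  src_mem : ∀ e ∈ edges, ∃ v ∈ verts, Γ.src e = Sum.inr v
  tgt_mem : ∀ e ∈ edges, ∃ v ∈ verts, Γ.tgt e = Sum.inr v

namespace Sub

variable {Γ : FeynmanDiagram L}

instance : Finite (Sub Γ) :=
  Finite.of_injective (fun γ : Sub Γ => (γ.verts, γ.edges)) fun γ δ h => by
    have h' := Prod.mk.inj h
    exact Sub.ext h'.1 h'.2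

/-- Inclusion of subdiagrams. -/
instance : LE (Sub Γ) := ⟨fun γ δ => γ.verts ⊆ δ.verts ∧ γ.edges ⊆ δ.edges⟩

/-- The union of a family of subdiagrams. -/
def sUnion (S : Set (Sub Γ)) : Sub Γ where
  verts := ⋃ γ ∈ S, γ.verts
  edges := ⋃ γ ∈ S, γ.edges
  src_mem := by
    intro e he
    simp only [Set.mem_iUnion] at he ⊢
    obtain ⟨γ, hγ, he⟩ := he
    obtain ⟨v, hv, h⟩ := γ.src_mem e he
    exact ⟨v, ⟨γ, hγ, hv⟩, h⟩
  tgt_mem := by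
    intro e he
    simp only [Set.mem_iUnion] at he ⊢
    obtain ⟨γ, hγ, he⟩ := he
    obtain ⟨v, hv, h⟩ := γ.tgt_mem e he
    exact ⟨v, ⟨γ, hγ, hv⟩, h⟩

/-- The edge relation of a subdiagram on internal vertices. -/
def Adj (γ : Sub Γ) (v w : Γ.V) : Prop :=
  ∃ e ∈ γ.edges, Γ.src e = Sum.inr v ∧ Γ.tgt e = Sum.inr w

/-- The subdiagram is connected (and nonempty). -/
def Connected (γ : Sub Γ) : Prop :=
  γ.verts.Nonempty ∧ ∀ v ∈ γ.verts, ∀ w ∈ γ.verts, Relation.EqvGen γ.Adj v w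

/-- The subdiagram is full: with an edge it contains all copies of it. -/
def Full (γ : Sub Γ) : Prop :=
  ∀ e ∈ γ.edges, ∀ f, Γ.src f = Γ.src e → Γ.tgt f = Γ.tgt e → f ∈ γ.edges

/-- The degree of a connected subdiagram in four dimensions. -/
def deg (γ : Sub Γ) : ℤ := 4 * ((γ.verts.ncard : ℤ) - 1) - 2 * (γ.edges.ncard : ℤ)

/-- The strictly divergent subdiagrams, which are the ones that are renormalised. -/
def Divergent (γ : Sub Γ) : Prop := γ.Connected ∧ γ.Full ∧ γ.deg < 0

/-- A subdiagram as a diagram without leaves. -/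
def toDiagram (γ : Sub Γ) : FeynmanDiagram Empty where
  V := γ.verts
  E := γ.edges
  finV := inferInstance
  finE := inferInstance
  src e := Sum.inr ⟨(γ.src_mem e.1 e.2).choose, (γ.src_mem e.1 e.2).choose_spec.1⟩
  tgt e := Sum.inr ⟨(γ.tgt_mem e.1 e.2).choose, (γ.tgt_mem e.1 e.2).choose_spec.1⟩

/-- The part of a subdiagram `δ` that lies in the subdiagram `γ`, as a subdiagram of the diagram
`γ`. -/
def within (δ γ : Sub Γ) : Sub γ.toDiagram where
  verts := {v | v.1 ∈ δ.verts}
  edges := {e | e.1 ∈ δ.edges}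
  src_mem := by
    intro e he
    obtain ⟨v, hv, h⟩ := δ.src_mem e.1 he
    refine ⟨⟨(γ.src_mem e.1 e.2).choose, (γ.src_mem e.1 e.2).choose_spec.1⟩, ?_, rfl⟩
    have h2 := (γ.src_mem e.1 e.2).choose_spec.2
    have h3 : v = (γ.src_mem e.1 e.2).choose := Sum.inr.inj (h.symm.trans h2)
    change (γ.src_mem e.1 e.2).choose ∈ δ.verts
    exact h3 ▸ hv
  tgt_mem := by
    intro e he
    obtain ⟨v, hv, h⟩ := δ.tgt_mem e.1 he
    refine ⟨⟨(γ.tgt_mem e.1 e.2).choose, (γ.tgt_mem e.1 e.2).choose_spec.1⟩, ?_, rfl⟩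
    have h2 := (γ.tgt_mem e.1 e.2).choose_spec.2
    have h3 : v = (γ.tgt_mem e.1 e.2).choose := Sum.inr.inj (h.symm.trans h2)
    change (γ.tgt_mem e.1 e.2).choose ∈ δ.verts
    exact h3 ▸ hv

/-- The bubble: two distinct vertices joined by two edges (of the same or of opposite direction). -/
def IsBubble (γ : Sub Γ) : Prop :=
  ∃ v w : Γ.V, ∃ e f : Γ.E, v ≠ w ∧ e ≠ f ∧ γ.verts = {v, w} ∧ γ.edges = {e, f} ∧
    Γ.src e ≠ Γ.tgt e ∧ Γ.src f ≠ Γ.tgt f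

end Sub

/-- The projection of the internal vertices when every connected component of the subdiagram `γ` is
contracted to a point (`Quot` divides by the equivalence relation generated by the edges of `γ`). -/
def proj (Γ : FeynmanDiagram L) (γ : Sub Γ) (v : Γ.V) : Quot γ.Adj := Quot.mk _ v

/-- The contracted diagram `Γ / γ`: every connected component of `γ` becomes a single vertex, the
edges of `γ` are deleted and all others are kept. -/
def contract (Γ : FeynmanDiagram L) (γ : Sub Γ) : FeynmanDiagram L where
  V := Quot γ.Adj
  E := {e : Γ.E // e ∉ γ.edges}
  finV := Finite.of_surjective (Quot.mk γ.Adj) Quot.mk_surjective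
  finE := inferInstance
  src e := Sum.map id (Γ.proj γ) (Γ.src e.1)
  tgt e := Sum.map id (Γ.proj γ) (Γ.tgt e.1)

/-! ### BPHZ renormalisation -/

/-- A forest of divergences: any two members are nested or vertex-disjoint. -/
def IsForest {Γ : FeynmanDiagram L} (F : Set (Sub Γ)) : Prop :=
  (∀ γ ∈ F, γ.Divergent) ∧
    ∀ γ ∈ F, ∀ δ ∈ F, γ ≤ δ ∨ δ ≤ γ ∨ Disjoint γ.verts δ.verts

/-- The valuation of the diagram obtained by extracting a forest `F` from `Γ`: the product of the
valuations of `Γ` with all members of `F` contracted, and of each member of `F` with all strictly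
smaller members of `F` contracted. -/
def forestVal (K : T4 → ℝ) (Γ : FeynmanDiagram L) (F : Set (Sub Γ)) (x : L → T4) : ℝ :=
  (Γ.contract (Sub.sUnion F)).val K x *
    ∏ᶠ γ ∈ F,
      (γ.toDiagram.contract ((Sub.sUnion {δ ∈ F | δ ≤ γ ∧ δ ≠ γ}).within γ)).vacVal K

/-- The renormalised valuation, by the forest formula. -/
def renVal (K : T4 → ℝ) (Γ : FeynmanDiagram L) (x : L → T4) : ℝ :=
  ∑ᶠ F ∈ {F : Set (Sub Γ) | IsForest F}, (-1) ^ F.ncard * Γ.forestVal K F x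

/-! ### Bubble extraction sequences -/

/-- One step `γ ⊆ δ` of a bubble extraction sequence: in `Γ / γ`, the image of `δ` consists of a
bubble together with the vertices to which `γ` is contracted. -/
def ExtractionStep (Γ : FeynmanDiagram L) (γ δ : Sub Γ) : Prop :=
  γ ≤ δ ∧ ∃ B : Sub (Γ.contract γ), B.IsBubble ∧
    Γ.proj γ '' δ.verts = B.verts ∪ Γ.proj γ '' γ.verts ∧
    ∀ e : (Γ.contract γ).E, e ∈ B.edges ↔ e.1 ∈ δ.edges

/-- The bubble extraction sequences `Γ̃₁ ⊆ ⋯ ⊆ Γ̃_{N-1}` of a diagram with `N` internal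
vertices, with the empty subdiagram `Γ̃₀` put in front. -/
def extractionSequences (Γ : FeynmanDiagram L) : Set (Fin (Nat.card Γ.V - 1 + 1) → Sub Γ) :=
  {s | s 0 = Sub.sUnion ∅ ∧ ∀ i : Fin (Nat.card Γ.V - 1), Γ.ExtractionStep (s i.castSucc) (s i.succ)}

/-- The variance constant `σ_Γ² = (√8 π)^{-2(N-1)} |𝕊(Γ)| / (N-1)!` of a diagram with `N` internal
vertices, where `𝕊(Γ)` is its set of bubble extraction sequences. -/
def variance (Γ : FeynmanDiagram L) : ℝ :=
  (1 / (Real.sqrt 8 * Real.pi)) ^ (2 * (Nat.card Γ.V - 1)) *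
    (Γ.extractionSequences.ncard : ℝ) / ((Nat.card Γ.V - 1).factorial : ℝ)

end FeynmanDiagram

/-! ### Pairings of two trees -/

/-- The complete pairings of the inner vertices of the two linear trees with `n` and `m` inner
vertices: involutions without fixed points. -/
def Pairing (n m : ℕ) : Type :=
  {κ : Equiv.Perm (Fin n ⊕ Fin m) // ∀ v, κ (κ v) = v ∧ κ v ≠ v}

instance (n m : ℕ) : Finite (Pairing n m) :=
  inferInstanceAs (Finite {κ : Equiv.Perm (Fin n ⊕ Fin m) // ∀ v, κ (κ v) = v ∧ κ v ≠ v})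

/-- The vertex at height `j = 0, …, n + 1` of a linear tree, with `bot` at height `0`, `n` inner
vertices above it, and `top` at height `n + 1`. -/
def treeVertex {α : Type} {n : ℕ} (bot top : α) (inner : Fin n → α) (j : ℕ) : α :=
  if j = 0 then bot else if h : j - 1 < n then inner ⟨j - 1, h⟩ else top

/-- The leaves of a pair of trees: `(i, 0)` is the bottom leaf `x` and `(i, 1)` the top leaf `y` of
the `i`-th tree. -/
abbrev Leaf : Type := Fin 2 × Fin 2

/-- The Feynman diagram obtained from the linear trees with `n` and `m` inner vertices by
identifying the paired vertices. Edges are directed from the bottom to the top. -/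
def pairedDiagram {n m : ℕ} (κ : Pairing n m) : FeynmanDiagram Leaf :=
  let V := Quot fun v w : Fin n ⊕ Fin m => κ.1 v = w
  let vertex₁ : ℕ → Leaf ⊕ V :=
    treeVertex (Sum.inl (0, 0)) (Sum.inl (0, 1)) fun i : Fin n => Sum.inr (Quot.mk _ (Sum.inl i))
  let vertex₂ : ℕ → Leaf ⊕ V :=
    treeVertex (Sum.inl (1, 0)) (Sum.inl (1, 1)) fun i : Fin m => Sum.inr (Quot.mk _ (Sum.inr i))
  { V := V
    E := Fin (n + 1) ⊕ Fin (m + 1)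
    finV := Finite.of_surjective (Quot.mk _) Quot.mk_surjective
    finE := inferInstance
    src := Sum.elim (fun j => vertex₁ j) fun j => vertex₂ j
    tgt := Sum.elim (fun j => vertex₁ (j + 1)) fun j => vertex₂ (j + 1) }

/-- A pairing contributes if, for some test function, its renormalised valuation does not vanish as
`ε → 0` in the weak coupling `λ_ε = (log (1/ε))^{-1/2}`. -/
def Contributes (ρ : EuclideanSpace ℝ (Fin 4) → ℝ) {n m : ℕ} (κ : Pairing n m) : Prop :=
  ∃ φ : TestFun Leaf,
    0 < limsup
      (fun ε : ℝ => ENNReal.ofReal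
        (((Real.sqrt (Real.log (1 / ε)))⁻¹) ^ ((n - 1) + (m - 1)) *
          |∫ x : Leaf → T4, (pairedDiagram κ).renVal (greenMoll ρ ε) x * φ x|))
      (𝓝[>] (0 : ℝ))

/-- `σ_{n,m}²`, the sum of the variance constants of the contributing pairings. -/
def covCoeff (ρ : EuclideanSpace ℝ (Fin 4) → ℝ) (n m : ℕ) : ℝ :=
  ∑ᶠ κ ∈ {κ : Pairing n m | Contributes ρ κ}, (pairedDiagram κ).variance

/-- `σ_n = (σ_{n,n}²)^{1/2}`. -/
def sigma (ρ : EuclideanSpace ℝ (Fin 4) → ℝ) (n : ℕ) : ℝ := Real.sqrt (covCoeff ρ n n)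

/-! ### The Gaussian fields -/

/-- The covariance form
`∫ φ(x,y) ψ(x',y') (∫ G(x-z) G(y-z) G(x'-z) G(y'-z) dz) dx dy dx' dy'`. -/
def covForm (φ ψ : TestFun (Fin 2)) : ℝ :=
  ∫ x : Leaf → T4, φ (fun a => x (0, a)) * ψ (fun a => x (1, a)) *
    ∫ z : T4, ∏ v : Leaf, green (x v - z)

/-- `J` is a random distribution on `(𝕋⁴)²` with the law of the centred Gaussian field `I`. -/
structure IsFieldI {Ω : Type*} [MeasurableSpace Ω] (P : Measure Ω) (J : Ω → Distr (Fin 2)) :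
    Prop where
  measurable : Measurable J
  gaussian : IsGaussianProcess (fun (φ : TestFun (Fin 2)) ω => J ω φ) P
  centred : ∀ φ, ∫ ω, J ω φ ∂P = 0
  covariance : ∀ φ ψ, ∫ ω, J ω φ * J ω ψ ∂P = covForm φ ψ

/-- `J 1, J 2, …` are random distributions on `(𝕋⁴)²` with the joint law of the sequence of jointly
Gaussian centred fields `I^{(1)}, I^{(2)}, …`. (`J 0` is not used.) -/
structure IsFieldSequence {Ω : Type*} [MeasurableSpace Ω] (P : Measure Ω)
    (ρ : EuclideanSpace ℝ (Fin 4) → ℝ) (J : ℕ → Ω → Distr (Fin 2)) : Prop where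
  measurable : ∀ n, 1 ≤ n → Measurable (J n)
  gaussian : IsGaussianProcess (fun (p : {n : ℕ // 1 ≤ n} × TestFun (Fin 2)) ω => J p.1 ω p.2) P
  centred : ∀ n, 1 ≤ n → ∀ φ, ∫ ω, J n ω φ ∂P = 0
  covariance : ∀ n m, 1 ≤ n → 1 ≤ m → ∀ φ ψ,
    ∫ ω, J n ω φ * J m ω ψ ∂P = covCoeff ρ n m / (sigma ρ n * sigma ρ m) * covForm φ ψ

/-- The effective standard deviation `σ_eff(λ̂)`. -/
def sigmaEff (lam : ℝ) : ℝ :=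
  Real.sqrt (2 * Real.pi ^ 2 / (2 * Real.pi ^ 2 - lam ^ 2))

end Anderson

end

noncomputable section

namespace Anderson

section

/-! ### Bubble labellings of a matched line -/

/-! The covariance of the partial sums of `𝒰` is a constant times `C`, the constant being the sum of
`λ̂^(n+m-2) σ²_{n,m}` over `n` and `m`. Everything therefore rests on one identity: over all `n, m ≥
1` with `n + m = 2 K + 2`, the `σ²_{n,m}` add up to `(2 π²)^(-K)`. The constants then add up to the
geometric series of ratio `λ̂² / (2 π²)`.

The identity comes from a count (`ncard_lineConfigs`). Put the two trees one after the other: a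
pairing becomes a perfect matching of a line of `2 K + 2` points, with `2 K + 1` edges, one of which
is the gap between the trees. A bubble extraction sequence becomes a labelling of the other `2 K`
edges, each of the labels `1, …, K` being used twice. Contracting the bubble that is extracted first
leaves a labelled line with `K - 1` bubbles. Conversely, a bubble is inserted into a line of `2 K`
points by choosing a point and either tripling it or doubling it together with its partner, where
the choice between the two partners encodes the choice between parallel and crossed edges. That
makes `2 · 2 K = 4 K` insertions, hence `4 ^ K * K!` labelled lines. As exactly one edge of a
labelled line is unlabelled, summing over all positions of the gap counts each labelled line once.
Since `(√8 π)^(-2K) 4^K = (2 π²)^(-K)`, the identity follows, but for the sum over all pairings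
instead of the contributing ones.

The two sums agree because a pairing that has an extraction sequence contributes
(`contributes_of_mem`); the others have variance zero. A diagram built from bubbles has no divergent
subdiagram, so its renormalised valuation is the bare one. The mollified Green's function is at
least a multiple of `|x|⁻²` down to scale `ε`. If the bubbles are placed on well separated dyadic
scales, the earlier ones on the smaller scales, each gives a factor of order `∫ |w|⁻⁴ dw`, which is
of order `log (1/ε)` in dimension four. This is `exists_le_val`, and it matches the normalisation
`(log (1/ε))^(-K)`.

For the convergence, the decay of Fourier coefficients bounds a distribution on a test function by a
seminorm of the latter times one number, `fourierSize`. The identity gives `σ_{n+1} ≤ (√2 π)^(-n)`,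
so for `|λ̂| < √2 π` the expected sizes of the terms are dominated by a geometric series, and the
series converges almost surely, uniformly on bounded sets of test functions. The law is identified
by characteristic functionals: those of the partial sums are Gaussian, and their variances converge
by the identity. -/

theorem eqvGen_comap_iff {α β : Type*} {R : α → α → Prop} {S : β → β → Prop} (f : α → β)
    (hf : Function.Surjective f)
    (h₁ : ∀ x y, R x y → Relation.EqvGen S (f x) (f y))
    (h₂ : ∀ x y, f x = f y → Relation.EqvGen R x y)
    (h₃ : ∀ a b, S a b → ∃ x y, f x = a ∧ f y = b ∧ Relation.EqvGen R x y) (x y : α) :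
    Relation.EqvGen R x y ↔ Relation.EqvGen S (f x) (f y) := by
  constructor
  · intro h
    induction h with
    | rel x y h => exact h₁ x y h
    | refl x => exact .refl _
    | symm x y _ ih => exact .symm _ _ ih
    | trans x y z _ _ ih₁ ih₂ => exact .trans _ _ _ ih₁ ih₂
  -- A chain of `S` is lifted link by link: `h₃` lifts a link to some pair, and `h₂` moves its ends
  -- to the prescribed points of the fibres.
  · have key : ∀ a b, Relation.EqvGen S a b → ∀ x y, f x = a → f y = b →
        Relation.EqvGen R x y := by
      intro a b h
      induction h with
      | rel a b h =>
        intro x y hx hy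
        obtain ⟨x', y', hx', hy', h'⟩ := h₃ a b h
        exact .trans _ _ _ (h₂ x x' (hx.trans hx'.symm))
          (.trans _ _ _ h' (h₂ y' y (hy'.trans hy.symm)))
      | refl a => intro x y hx hy; exact h₂ x y (hx.trans hy.symm)
      | symm a b _ ih => intro x y hx hy; exact .symm _ _ (ih y x hy hx)
      | trans a b c _ _ ih₁ ih₂ =>
        intro x y hx hy
        obtain ⟨z, hz⟩ := hf b
        exact .trans _ _ _ (ih₁ x z hx hz) (ih₂ z y hz hy)
    exact fun h => key _ _ h x y rfl rfl

/-- The points of a line that are identified by a matching `k` and by the edges (the edge `x` joins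
`x` and `x + 1`) with a label above `j`. -/
def LineRel (k l : ℕ → ℕ) (j : ℕ) : ℕ → ℕ → Prop :=
  Relation.EqvGen fun x y => y = k x ∨ (y = x + 1 ∧ j < l x)

/-- Modulo `r`, the edges `e` and `f` of the line form a bubble. -/
def EdgesMatch (r : ℕ → ℕ → Prop) (e f : ℕ) : Prop :=
  ¬ r e (e + 1) ∧ ((r e f ∧ r (e + 1) (f + 1)) ∨ (r e (f + 1) ∧ r (e + 1) f))

/-- A perfect matching of `0, …, 2 K + 1`. -/
structure IsMatching (K : ℕ) (k : ℕ → ℕ) : Prop where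
  invol : ∀ x, k (k x) = x
  ne : ∀ x < 2 * K + 2, k x ≠ x
  fix : ∀ x, 2 * K + 2 ≤ x → k x = x

/-- A labelling of the edges of the line by the times (counted backwards) at which bubbles are
extracted. One edge has the label `0`: there the line is cut into two trees. -/
structure IsLabelling (K : ℕ) (k l : ℕ → ℕ) : Prop where
  le : ∀ x, l x ≤ K
  out : ∀ x, 2 * K + 1 ≤ x → l x = 0
  cut : ∃ c < 2 * K + 1, ∀ x < 2 * K + 1, l x = 0 ↔ x = c
  bubble : ∀ j, 1 ≤ j → j ≤ K → ∃ e f, e < f ∧ (∀ x, l x = j ↔ x = e ∨ x = f) ∧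
    EdgesMatch (LineRel k l j) e f

/-- The map of a line that contracts the edges `e < f`. -/
def lineContract (e f x : ℕ) : ℕ := if x ≤ e then x else if x ≤ f then x - 1 else x - 2

/-- The edges of a line after the edges `e < f` have been contracted. -/
def edgeSkip (e f x : ℕ) : ℕ := if x < e then x else if x + 1 < f then x + 1 else x + 2

/-- `k'` becomes `k` when the edges `e < f` are contracted. -/
structure Contracts (k' k : ℕ → ℕ) (e f : ℕ) : Prop where
  lt : e < f
  -- The second alternative occurs when three consecutive points merge: the outer two are partners
  -- of each other and land on the same point, whose partner comes from the middle one.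
  map : ∀ x, lineContract e f (k' x) = k (lineContract e f x) ∨
    lineContract e f (k' x) = lineContract e f x
  lift : ∀ y, ∃ x, lineContract e f x = y ∧ lineContract e f (k' x) = k y

/-- The bubble contracted here is the one extracted first. As times are counted backwards it gets
the largest label, and all other edges keep theirs. -/
def relabel (K : ℕ) (l : ℕ → ℕ) (e f x : ℕ) : ℕ :=
  if x = e ∨ x = f then K + 1 else l (lineContract e f x)

theorem lineContract_edgeSkip {e f : ℕ} (h : e < f) (x : ℕ) :
    lineContract e f (edgeSkip e f x) = x ∧ lineContract e f (edgeSkip e f x + 1) = x + 1 ∧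
      edgeSkip e f x ≠ e ∧ edgeSkip e f x ≠ f := by
  unfold lineContract edgeSkip
  grind

theorem edgeSkip_lineContract {e f x : ℕ} (h : e < f) (he : x ≠ e) (hf : x ≠ f) :
    edgeSkip e f (lineContract e f x) = x := by
  unfold lineContract edgeSkip
  grind

theorem relabel_edgeSkip {K : ℕ} {l : ℕ → ℕ} {e f : ℕ} (h : e < f) (x : ℕ) :
    relabel K l e f (edgeSkip e f x) = l x := by
  obtain ⟨h1, -, h3, h4⟩ := lineContract_edgeSkip h x
  simp [relabel, h1, h3, h4]

/-- The edges `e` and `f` carry the label `K + 1 > j`, so the points merged by `lineContract` are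
already identified upstairs, and contraction does not change the quotient. -/
theorem lineRel_relabel_iff {K : ℕ} {k' k l : ℕ → ℕ} {e f : ℕ} (h : Contracts k' k e f)
    {j : ℕ} (hj : j ≤ K) (x y : ℕ) :
    LineRel k' (relabel K l e f) j x y ↔
      LineRel k l j (lineContract e f x) (lineContract e f y) := by
  have hef := h.lt
  have hedge : ∀ x, x = e ∨ x = f → LineRel k' (relabel K l e f) j x (x + 1) := fun x hx =>
    .rel _ _ (Or.inr ⟨rfl, by simp [relabel, hx]; omega⟩)
  apply eqvGen_comap_iff (lineContract e f)
  · exact fun y => ⟨_, (lineContract_edgeSkip hef y).1⟩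
  · rintro x y (rfl | ⟨rfl, hx⟩)
    · rcases h.map x with h' | h'
      · exact .rel _ _ (Or.inl h')
      · rw [h']; exact .refl _
    · by_cases hxe : x = e ∨ x = f
      · have : lineContract e f x = lineContract e f (x + 1) := by
          unfold lineContract; grind
        rw [this]; exact .refl _
      · have : lineContract e f (x + 1) = lineContract e f x + 1 := by
          unfold lineContract; grind
        refine .rel _ _ (Or.inr ⟨this, ?_⟩)
        simpa [relabel, hxe] using hx
  · have key : ∀ x y, x ≤ y → lineContract e f x = lineContract e f y →
        LineRel k' (relabel K l e f) j x y := by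
      intro x y hxy hh
      -- The fibres of `lineContract`: single points, the ends of `e` or of `f`, and three
      -- consecutive points when the two edges are adjacent.
      have hcases : y = x ∨ (y = x + 1 ∧ (x = e ∨ x = f)) ∨
          (y = x + 2 ∧ x = e ∧ x + 1 = f) := by
        unfold lineContract at hh; grind
      rcases hcases with rfl | ⟨rfl, hx⟩ | ⟨rfl, hx, hx'⟩
      · exact .refl _
      · exact hedge x hx
      · exact .trans _ _ _ (hedge x (Or.inl hx)) (hedge (x + 1) (Or.inr hx'))
    intro x y hh
    rcases le_total x y with hxy | hxy
    · exact key x y hxy hh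
    · exact .symm _ _ (key y x hxy hh.symm)
  · rintro a b (rfl | ⟨rfl, ha⟩)
    · obtain ⟨x, hx, hx'⟩ := h.lift a
      exact ⟨x, k' x, hx, hx', .rel _ _ (Or.inl rfl)⟩
    · obtain ⟨h1, h2, h3, h4⟩ := lineContract_edgeSkip hef a
      refine ⟨_, _, h1, h2, .rel _ _ (Or.inr ⟨rfl, ?_⟩)⟩
      rwa [relabel_edgeSkip hef]

theorem edgesMatch_edgeSkip_iff {K : ℕ} {k' k l : ℕ → ℕ} {e f : ℕ} (h : Contracts k' k e f)
    {j : ℕ} (hj : j ≤ K) (x y : ℕ) :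
    EdgesMatch (LineRel k' (relabel K l e f) j) (edgeSkip e f x) (edgeSkip e f y) ↔
      EdgesMatch (LineRel k l j) x y := by
  obtain ⟨h1, h2, -, -⟩ := lineContract_edgeSkip h.lt x
  obtain ⟨h3, h4, -, -⟩ := lineContract_edgeSkip h.lt y
  simp only [EdgesMatch, lineRel_relabel_iff h hj, h1, h2, h3, h4]

/-- No edge has a label above `K`, so only the matching is left, and an involution has orbits of at
most two points. -/
theorem lineRel_top_iff {K : ℕ} {k l : ℕ → ℕ} (hk : ∀ x, k (k x) = x) (hl : ∀ x, l x ≤ K)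
    (x y : ℕ) : LineRel k l K x y ↔ y = x ∨ y = k x := by
  constructor
  · intro h
    induction h with
    | rel x y h => have := hl x; grind
    | refl x => exact Or.inl rfl
    | symm x y _ ih => grind
    | trans x y z _ _ ih₁ ih₂ => grind
  · rintro (rfl | rfl)
    · exact .refl _
    · exact .rel _ _ (Or.inl rfl)

/-- The conditions for labels up to `K` are read in quotients that agree on both lines. The
condition for the label `K + 1` is read modulo the matching alone, where it is the hypothesis `hm`.
-/
theorem isLabelling_relabel_iff {K : ℕ} {k' k l : ℕ → ℕ} {e f : ℕ} (h : Contracts k' k e f)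
    (hk' : ∀ x, k' (k' x) = x) (hf : f < 2 * K + 3)
    (hm : EdgesMatch (fun x y => y = x ∨ y = k' x) e f) (hlK : ∀ x, l x ≤ K) :
    IsLabelling (K + 1) k' (relabel K l e f) ↔ IsLabelling K k l := by
  have hef := h.lt
  have hle : ∀ x, relabel K l e f x ≤ K + 1 := by
    intro x
    have := hlK (lineContract e f x)
    unfold relabel
    split_ifs <;> omega
  constructor
  · intro hL
    refine ⟨hlK, ?_, ?_, ?_⟩
    · intro x hx
      rw [← relabel_edgeSkip (K := K) (l := l) hef]
      apply hL.out
      unfold edgeSkip; grind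
    · obtain ⟨c, hc, hc'⟩ := hL.cut
      have hc0 := (hc' c hc).2 rfl
      have hce : ¬ (c = e ∨ c = f) := by
        intro hce
        simp [relabel, hce] at hc0
      refine ⟨lineContract e f c, by unfold lineContract; grind, fun x hx => ?_⟩
      rw [← relabel_edgeSkip (K := K) (l := l) hef, hc' _ (by unfold edgeSkip; grind)]
      constructor
      · rintro rfl
        exact (lineContract_edgeSkip hef x).1.symm
      · rintro rfl
        exact edgeSkip_lineContract hef (by tauto) (by tauto)
    · intro j hj hjK
      obtain ⟨a, b, hab, hl, hE⟩ := hL.bubble j hj (by omega)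
      have hae : ∀ x, relabel K l e f x = j → x ≠ e ∧ x ≠ f := by
        intro x hx
        by_contra hcon
        have : x = e ∨ x = f := by tauto
        simp [relabel, this] at hx
        omega
      have ha := hae a ((hl a).2 (Or.inl rfl))
      have hb := hae b ((hl b).2 (Or.inr rfl))
      have ha' := edgeSkip_lineContract hef ha.1 ha.2
      have hb' := edgeSkip_lineContract hef hb.1 hb.2
      refine ⟨lineContract e f a, lineContract e f b, ?_, fun x => ?_, ?_⟩
      · unfold lineContract; grind
      · rw [← relabel_edgeSkip (K := K) (l := l) hef, hl]
        have hx := (lineContract_edgeSkip hef x).1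
        constructor
        · rintro (h | h) <;> [left; right] <;> rw [← h, hx]
        · rintro (rfl | rfl) <;> [left; right] <;> assumption
      · rw [← edgesMatch_edgeSkip_iff h hjK, ha', hb']
        exact hE
  · intro hL
    refine ⟨hle, ?_, ?_, ?_⟩
    · intro x hx
      have : ¬ (x = e ∨ x = f) := by omega
      simp only [relabel, this, if_false]
      apply hL.out
      unfold lineContract; grind
    · obtain ⟨c, hc, hc'⟩ := hL.cut
      refine ⟨edgeSkip e f c, by unfold edgeSkip; grind, fun x hx => ?_⟩
      by_cases hxe : x = e ∨ x = f
      · have := lineContract_edgeSkip hef c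
        simp only [relabel, hxe, if_true]
        constructor
        · omega
        · rintro rfl; tauto
      · simp only [relabel, hxe, if_false]
        rw [hc' _ (by unfold lineContract; grind)]
        constructor
        · rintro rfl
          exact (edgeSkip_lineContract hef (by tauto) (by tauto)).symm
        · rintro rfl
          exact (lineContract_edgeSkip hef c).1
    · intro j hj hjK
      rcases Nat.lt_or_ge K j with hK | hK
      · obtain rfl : j = K + 1 := by omega
        refine ⟨e, f, hef, fun x => ?_, ?_⟩
        · by_cases hxe : x = e ∨ x = f
          · simp [relabel, hxe]
          · have := hlK (lineContract e f x)
            simp only [relabel, hxe, if_false, iff_false]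
            omega
        · have : LineRel k' (relabel K l e f) (K + 1) = fun x y => y = x ∨ y = k' x := by
            funext x y
            exact propext (lineRel_top_iff hk' hle x y)
          rw [this]
          exact hm
      · obtain ⟨a, b, hab, hl, hE⟩ := hL.bubble j hj hK
        refine ⟨edgeSkip e f a, edgeSkip e f b, by unfold edgeSkip; grind, fun x => ?_,
          (edgesMatch_edgeSkip_iff h hK a b).2 hE⟩
        have h5 := lineContract_edgeSkip hef a
        have h6 := lineContract_edgeSkip hef b
        by_cases hxe : x = e ∨ x = f
        · simp only [relabel, hxe, if_true]
          constructor
          · omega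
          · rintro (rfl | rfl) <;> tauto
        · simp only [relabel, hxe, if_false]
          rw [hl]
          constructor
          · rintro (h | h) <;> [left; right] <;> rw [← h] <;>
              exact (edgeSkip_lineContract hef (by tauto) (by tauto)).symm
          · rintro (rfl | rfl) <;> [left; right] <;> tauto

end

/-! ### Insertion and contraction of a bubble in a matched line -/

section

/-- The positions left over when a bubble with the edges `e < f` is contracted. -/
def lineSection (e f y : ℕ) : ℕ :=
  -- For adjacent edges the middle point represents the merged triple, since it is the one whose
  -- partner lies elsewhere.
  if f = e + 1 then (if y < e then y else if y = e then e + 1 else y + 2)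
  else (if y ≤ e then y else if y < f then y + 1 else y + 2)

theorem lineContract_lineSection {e f : ℕ} (h : e < f) (y : ℕ) :
    lineContract e f (lineSection e f y) = y := by
  unfold lineContract lineSection
  grind

theorem lineSection_double {e f y : ℕ} (h : e + 1 < f) (h1 : y ≠ e) (h2 : y + 1 ≠ f) :
    lineSection e f y ≠ e ∧ lineSection e f y ≠ e + 1 ∧ lineSection e f y ≠ f ∧
      lineSection e f y ≠ f + 1 := by
  unfold lineSection
  grind

theorem lineSection_lineContract_double {e f x : ℕ} (h : e + 1 < f) (h1 : x ≠ e) (h2 : x ≠ e + 1)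
    (h3 : x ≠ f) (h4 : x ≠ f + 1) : lineSection e f (lineContract e f x) = x ∧
      lineContract e f x ≠ e ∧ lineContract e f x + 1 ≠ f := by
  unfold lineContract lineSection
  grind

theorem lineContract_double {e f : ℕ} (h : e + 1 < f) : lineContract e f e = e ∧
    lineContract e f (e + 1) = e ∧ lineContract e f f = f - 1 ∧
      lineContract e f (f + 1) = f - 1 := by
  unfold lineContract
  grind

theorem lineSection_triple (p y : ℕ) :
    lineSection p (p + 1) y ≠ p ∧ lineSection p (p + 1) y ≠ p + 2 := by
  unfold lineSection
  grind

theorem lineSection_lineContract_triple {p x : ℕ} (h1 : x ≠ p) (h2 : x ≠ p + 2) :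
    lineSection p (p + 1) (lineContract p (p + 1) x) = x := by
  unfold lineContract lineSection
  grind

theorem lineContract_triple (p : ℕ) : lineContract p (p + 1) p = p ∧
    lineContract p (p + 1) (p + 1) = p ∧ lineContract p (p + 1) (p + 2) = p := by
  unfold lineContract
  grind

theorem lineContract_lt {K e f x : ℕ} (hef : e < f) (hf : f < 2 * K + 3) :
    lineContract e f x < 2 * K + 2 ↔ x < 2 * K + 4 := by
  unfold lineContract
  grind

theorem lineSection_ge {K e f y : ℕ} (hef : e < f) (hf : f < 2 * K + 3) (hy : 2 * K + 2 ≤ y) :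
    lineSection e f y = y + 2 := by
  unfold lineSection
  grind

theorem IsMatching.lt {K : ℕ} {k : ℕ → ℕ} (h : IsMatching K k) {x : ℕ} (hx : x < 2 * K + 2) :
    k x < 2 * K + 2 := by
  by_contra hcon
  have h1 := h.fix (k x) (by omega)
  rw [h.invol] at h1
  omega

/-- The three shapes of a bubble in a matched line. -/
theorem edgesMatch_cases {K : ℕ} {k : ℕ → ℕ} {e f : ℕ} (hk : IsMatching K k) (hef : e < f)
    (h : EdgesMatch (fun x y => y = x ∨ y = k x) e f) :
    (f = e + 1 ∧ k e = e + 2) ∨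
      (e + 1 < f ∧ ((k e = f ∧ k (e + 1) = f + 1) ∨ (k e = f + 1 ∧ k (e + 1) = f))) := by
  obtain ⟨h1, h2⟩ := h
  have := hk.invol e
  have := hk.invol (e + 1)
  grind

/-- Two matched positions `e` and `f - 1` are doubled. -/
def doubleBubble (k : ℕ → ℕ) (e f : ℕ) (par : Bool) (x : ℕ) : ℕ :=
  if x = e then bif par then f else f + 1
  else if x = e + 1 then bif par then f + 1 else f
  else if x = f then bif par then e else e + 1
  else if x = f + 1 then bif par then e + 1 else e
  else lineSection e f (k (lineContract e f x))

/-- A position `p` is tripled. -/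
def tripleBubble (k : ℕ → ℕ) (p x : ℕ) : ℕ :=
  if x = p then p + 2 else if x = p + 2 then p
  else lineSection p (p + 1) (k (lineContract p (p + 1) x))

section double

variable {K : ℕ} {k : ℕ → ℕ} {e f : ℕ} {par : Bool}

theorem doubleBubble_special (h : e + 1 < f) :
    doubleBubble k e f par e = (bif par then f else f + 1) ∧
    doubleBubble k e f par (e + 1) = (bif par then f + 1 else f) ∧
    doubleBubble k e f par f = (bif par then e else e + 1) ∧
    doubleBubble k e f par (f + 1) = (bif par then e + 1 else e) := by
  unfold doubleBubble
  grind

theorem doubleBubble_other {x : ℕ} (h1 : x ≠ e) (h2 : x ≠ e + 1)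
    (h3 : x ≠ f) (h4 : x ≠ f + 1) :
    doubleBubble k e f par x = lineSection e f (k (lineContract e f x)) := by
  simp [doubleBubble, h1, h2, h3, h4]

theorem ne_of_matched (hk : IsMatching K k) (hef : e + 1 < f) (hke : k e = f - 1) {a : ℕ} (h1 : a ≠ e)
    (h2 : a + 1 ≠ f) : k a ≠ e ∧ k a + 1 ≠ f := by
  have := hk.invol a
  have := hk.invol e
  grind

theorem isMatching_doubleBubble (hk : IsMatching K k) (hef : e + 1 < f) (hf : f < 2 * K + 3)
    (hke : k e = f - 1) : IsMatching (K + 1) (doubleBubble k e f par) := by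
  obtain ⟨s1, s2, s3, s4⟩ := doubleBubble_special (k := k) (par := par) hef
  have hx : ∀ x, x = e ∨ x = e + 1 ∨ x = f ∨ x = f + 1 ∨
      (x ≠ e ∧ x ≠ e + 1 ∧ x ≠ f ∧ x ≠ f + 1) := by omega
  refine ⟨fun x => ?_, fun x hx' => ?_, fun x hx' => ?_⟩
  · rcases hx x with rfl | rfl | rfl | rfl | ⟨h1, h2, h3, h4⟩
    · rw [s1]; cases par <;> simp [s3, s4]
    · rw [s2]; cases par <;> simp [s3, s4]
    · rw [s3]; cases par <;> simp [s1, s2]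
    · rw [s4]; cases par <;> simp [s1, s2]
    · obtain ⟨h5, h6, h7⟩ := lineSection_lineContract_double hef h1 h2 h3 h4
      obtain ⟨h8, h9⟩ := ne_of_matched hk hef hke h6 h7
      obtain ⟨g1, g2, g3, g4⟩ := lineSection_double hef h8 h9
      rw [doubleBubble_other h1 h2 h3 h4, doubleBubble_other g1 g2 g3 g4,
        lineContract_lineSection (by omega), hk.invol, h5]
  · rcases hx x with rfl | rfl | rfl | rfl | ⟨h1, h2, h3, h4⟩
    · rw [s1]; cases par <;> simp <;> omega
    · rw [s2]; cases par <;> simp <;> omega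
    · rw [s3]; cases par <;> simp <;> omega
    · rw [s4]; cases par <;> simp <;> omega
    · rw [doubleBubble_other h1 h2 h3 h4]
      intro h
      have := hk.ne (lineContract e f x) ((lineContract_lt (by omega) hf).2 (by omega))
      apply this
      rw [← lineContract_lineSection (e := e) (f := f) (by omega) (k _), h]
  · have h5 : lineContract e f x = x - 2 := by unfold lineContract; grind
    rw [doubleBubble_other (by omega) (by omega) (by omega) (by omega), h5,
      hk.fix _ (by omega), lineSection_ge (by omega) hf (by omega)]
    omega

theorem contracts_doubleBubble (hk : IsMatching K k) (hef : e + 1 < f) (hke : k e = f - 1) :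
    Contracts (doubleBubble k e f par) k e f := by
  obtain ⟨s1, s2, s3, s4⟩ := doubleBubble_special (k := k) (par := par) hef
  obtain ⟨c1, c2, c3, c4⟩ := lineContract_double hef
  have hkf : k (f - 1) = e := by rw [← hke, hk.invol]
  have key : ∀ x, lineContract e f (doubleBubble k e f par x) = k (lineContract e f x) := by
    intro x
    have hx : x = e ∨ x = e + 1 ∨ x = f ∨ x = f + 1 ∨
      (x ≠ e ∧ x ≠ e + 1 ∧ x ≠ f ∧ x ≠ f + 1) := by omega
    rcases hx with rfl | rfl | rfl | rfl | ⟨h1, h2, h3, h4⟩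
    · rw [s1, c1, hke]; cases par <;> simp [c3, c4]
    · rw [s2, c2, hke]; cases par <;> simp [c3, c4]
    · rw [s3, c3, hkf]; cases par <;> simp [c1, c2]
    · rw [s4, c4, hkf]; cases par <;> simp [c1, c2]
    · rw [doubleBubble_other h1 h2 h3 h4, lineContract_lineSection (by omega)]
  exact ⟨by omega, fun x => Or.inl (key x), fun y => ⟨lineSection e f y,
    lineContract_lineSection (by omega) y, by rw [key, lineContract_lineSection (by omega)]⟩⟩

theorem edgesMatch_doubleBubble (hef : e + 1 < f) :
    EdgesMatch (fun x y => y = x ∨ y = doubleBubble k e f par x) e f := by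
  obtain ⟨s1, s2, s3, s4⟩ := doubleBubble_special (k := k) (par := par) hef
  simp only [EdgesMatch, s1, s2]
  cases par <;> simp <;> omega

end double

section triple

variable {K : ℕ} {k : ℕ → ℕ} {p : ℕ}

theorem tripleBubble_special : tripleBubble k p p = p + 2 ∧ tripleBubble k p (p + 2) = p := by
  unfold tripleBubble
  grind

theorem tripleBubble_other {x : ℕ} (h1 : x ≠ p) (h2 : x ≠ p + 2) :
    tripleBubble k p x = lineSection p (p + 1) (k (lineContract p (p + 1) x)) := by
  simp [tripleBubble, h1, h2]

theorem isMatching_tripleBubble (hk : IsMatching K k) (hp : p < 2 * K + 2) :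
    IsMatching (K + 1) (tripleBubble k p) := by
  obtain ⟨s1, s2⟩ := tripleBubble_special (k := k) (p := p)
  have hx : ∀ x, x = p ∨ x = p + 2 ∨ (x ≠ p ∧ x ≠ p + 2) := by omega
  refine ⟨fun x => ?_, fun x hx' => ?_, fun x hx' => ?_⟩
  · rcases hx x with rfl | rfl | ⟨h1, h2⟩
    · rw [s1, s2]
    · rw [s2, s1]
    · obtain ⟨g1, g2⟩ := lineSection_triple p (k (lineContract p (p + 1) x))
      rw [tripleBubble_other h1 h2, tripleBubble_other g1 g2,
        lineContract_lineSection (by omega), hk.invol, lineSection_lineContract_triple h1 h2]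
  · rcases hx x with rfl | rfl | ⟨h1, h2⟩
    · omega
    · omega
    · rw [tripleBubble_other h1 h2]
      intro h
      have := hk.ne (lineContract p (p + 1) x) ((lineContract_lt (by omega) (by omega)).2 (by omega))
      apply this
      rw [← lineContract_lineSection (e := p) (f := p + 1) (by omega) (k _), h]
  · have h5 : lineContract p (p + 1) x = x - 2 := by unfold lineContract; grind
    rw [tripleBubble_other (by omega) (by omega), h5,
      hk.fix _ (by omega), lineSection_ge (by omega) (by omega : p + 1 < 2 * K + 3) (by omega)]
    omega

theorem contracts_tripleBubble : Contracts (tripleBubble k p) k p (p + 1) := by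
  obtain ⟨s1, s2⟩ := tripleBubble_special (k := k) (p := p)
  obtain ⟨c1, c2, c3⟩ := lineContract_triple p
  refine ⟨by omega, fun x => ?_, fun y => ⟨lineSection p (p + 1) y,
    lineContract_lineSection (by omega) y, ?_⟩⟩
  · have hx : x = p ∨ x = p + 2 ∨ (x ≠ p ∧ x ≠ p + 2) := by omega
    rcases hx with rfl | rfl | ⟨h1, h2⟩
    · right; rw [s1, c1, c3]
    · right; rw [s2, c1, c3]
    · left; rw [tripleBubble_other h1 h2, lineContract_lineSection (by omega)]
  · obtain ⟨g1, g2⟩ := lineSection_triple p y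
    rw [tripleBubble_other g1 g2, lineContract_lineSection (by omega),
      lineContract_lineSection (by omega)]

theorem edgesMatch_tripleBubble :
    EdgesMatch (fun x y => y = x ∨ y = tripleBubble k p x) p (p + 1) := by
  obtain ⟨s1, s2⟩ := tripleBubble_special (k := k) (p := p)
  refine ⟨?_, Or.inr ⟨Or.inr s1.symm, Or.inl rfl⟩⟩
  dsimp only
  omega

end triple

/-- The matchings with a chosen bubble. -/
def bubbleSet (K : ℕ) : Set ((ℕ → ℕ) × ℕ × ℕ) :=
  {t | IsMatching (K + 1) t.1 ∧ t.2.1 < t.2.2 ∧ t.2.2 < 2 * K + 3 ∧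
    EdgesMatch (fun x y => y = x ∨ y = t.1 x) t.2.1 t.2.2}

/-- The contraction of a bubble. The place and the type of the bubble are remembered. -/
def removeBubble (t : (ℕ → ℕ) × ℕ × ℕ) : (ℕ → ℕ) × ℕ × Bool :=
  (fun y => lineContract t.2.1 t.2.2 (t.1 (lineSection t.2.1 t.2.2 y)),
    if t.2.2 = t.2.1 + 1 ∨ t.1 t.2.1 = t.2.2 then t.2.1 else t.2.2 - 1,
    decide (t.2.2 = t.2.1 + 1))

/-- The insertion of a bubble at a given place. -/
def addBubble (s : (ℕ → ℕ) × ℕ × Bool) : (ℕ → ℕ) × ℕ × ℕ :=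
  if s.2.2 then (tripleBubble s.1 s.2.1, s.2.1, s.2.1 + 1)
  -- Doubling `p` doubles its partner too, so the two points of a pair give the same place. The
  -- smaller one is used for the parallel bubble and the larger one for the crossed bubble, which
  -- makes the encoding bijective.
  else if s.2.1 < s.1 s.2.1 then
    (doubleBubble s.1 s.2.1 (s.1 s.2.1 + 1) true, s.2.1, s.1 s.2.1 + 1)
  else (doubleBubble s.1 (s.1 s.2.1) (s.2.1 + 1) false, s.1 s.2.1, s.2.1 + 1)

theorem addBubble_mem {K : ℕ} {s : (ℕ → ℕ) × ℕ × Bool} (hk : IsMatching K s.1)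
    (hp : s.2.1 < 2 * K + 2) : addBubble s ∈ bubbleSet K ∧
      Contracts (addBubble s).1 s.1 (addBubble s).2.1 (addBubble s).2.2 := by
  obtain ⟨k, p, b⟩ := s
  dsimp only at hk hp
  have h0 := hk.lt hp
  have h1 := hk.invol p
  have h2 := hk.ne p hp
  cases b
  · rcases lt_or_gt_of_ne h2 with h3 | h3
    · have h4 : ¬ p < k p := by omega
      simp only [addBubble, h4, Bool.false_eq_true, if_false]
      exact ⟨⟨isMatching_doubleBubble hk (by omega) (by omega) h1, by dsimp; omega, by dsimp; omega,
        edgesMatch_doubleBubble (by omega)⟩, contracts_doubleBubble hk (by omega) h1⟩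
    · simp only [addBubble, h3, Bool.false_eq_true, if_false, if_true]
      exact ⟨⟨isMatching_doubleBubble hk (by omega) (by omega) rfl, by dsimp; omega, by dsimp; omega,
        edgesMatch_doubleBubble (by omega)⟩, contracts_doubleBubble hk (by omega) rfl⟩
  · simp only [addBubble, if_true]
    exact ⟨⟨isMatching_tripleBubble hk hp, by dsimp; omega, by dsimp; omega,
      edgesMatch_tripleBubble⟩, contracts_tripleBubble⟩

theorem removeBubble_addBubble {K : ℕ} {s : (ℕ → ℕ) × ℕ × Bool} (hk : IsMatching K s.1)
    (hp : s.2.1 < 2 * K + 2) : removeBubble (addBubble s) = s := by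
  obtain ⟨k, p, b⟩ := s
  dsimp only at hk hp
  have h0 := hk.lt hp
  have h1 := hk.invol p
  have h2 := hk.ne p hp
  have key : ∀ e f par, e + 1 < f → k e = f - 1 →
      (fun y => lineContract e f (doubleBubble k e f par (lineSection e f y))) = k := by
    intro e f par hef hke
    have hkf : k (f - 1) = e := by rw [← hke, hk.invol]
    have hc := contracts_doubleBubble (par := par) hk hef hke
    funext y
    obtain ⟨s1, s2, s3, s4⟩ := doubleBubble_special (k := k) (par := par) hef
    obtain ⟨c1, c2, c3, c4⟩ := lineContract_double hef
    by_cases hy : y ≠ e ∧ y + 1 ≠ f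
    · obtain ⟨g1, g2, g3, g4⟩ := lineSection_double hef hy.1 hy.2
      rw [doubleBubble_other g1 g2 g3 g4, lineContract_lineSection (by omega),
        lineContract_lineSection (by omega)]
    · have : y = e ∨ y = f - 1 := by omega
      rcases this with rfl | rfl
      · have : lineSection y f y = y := by unfold lineSection; grind
        rw [this, s1, hke]
        cases par <;> simp [c3, c4]
      · have : lineSection e f (f - 1) = f := by unfold lineSection; grind
        rw [this, s3, hkf]
        cases par <;> simp [c1, c2]
  cases b
  · rcases lt_or_gt_of_ne h2 with h3 | h3
    · have h4 : ¬ p < k p := by omega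
      obtain ⟨s1, -, -, -⟩ := doubleBubble_special (k := k) (e := k p) (f := p + 1) (par := false)
        (by omega)
      have h5 : ¬ (p + 1 = k p + 1 ∨ p + 1 + 1 = p + 1) := by omega
      simp only [addBubble, h4, Bool.false_eq_true, if_false, removeBubble, s1, cond_false, h5]
      rw [key _ _ _ (by omega) h1]
      simp; omega
    · obtain ⟨s1, -, -, -⟩ := doubleBubble_special (k := k) (e := p) (f := k p + 1) (par := true)
        (by omega)
      simp only [addBubble, h3, Bool.false_eq_true, if_false, if_true, removeBubble, s1, cond_true]
      rw [key _ _ _ (by omega) rfl]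
      simp; omega
  · simp only [addBubble, if_true, removeBubble]
    have : (fun y => lineContract p (p + 1) (tripleBubble k p (lineSection p (p + 1) y))) = k := by
      funext y
      obtain ⟨g1, g2⟩ := lineSection_triple p y
      rw [tripleBubble_other g1 g2, lineContract_lineSection (by omega),
        lineContract_lineSection (by omega)]
    rw [this]
    simp

/-- The matching descends because the points of the bubble are matched among themselves: in the
triple case the outer points `e` and `e + 2`, whose complement is the image of `lineSection`; in the
double case all four points, which become one new pair. -/
theorem removeBubble_mem {K : ℕ} {t : (ℕ → ℕ) × ℕ × ℕ} (ht : t ∈ bubbleSet K) :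
    IsMatching K (removeBubble t).1 ∧ (removeBubble t).2.1 < 2 * K + 2 ∧
      addBubble (removeBubble t) = t := by
  obtain ⟨k, e, f⟩ := t
  obtain ⟨hk, hef, hf, hm⟩ := ht
  dsimp only at hk hef hf hm
  have hinj : ∀ x y, k x = y → k y = x := fun x y h => by rw [← h, hk.invol]
  rcases edgesMatch_cases hk hef hm with ⟨rfl, hke⟩ | ⟨hef', hpar⟩
  · obtain ⟨c1, c2, c3⟩ := lineContract_triple e
    have hke' := hinj _ _ hke
    have hne : ∀ y, k (lineSection e (e + 1) y) ≠ e ∧ k (lineSection e (e + 1) y) ≠ e + 2 := by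
      intro y
      obtain ⟨g1, g2⟩ := lineSection_triple e y
      exact ⟨fun h => g2 ((hinj _ _ h).symm.trans hke), fun h => g1 ((hinj _ _ h).symm.trans hke')⟩
    have hsec : ∀ y, lineSection e (e + 1) (lineContract e (e + 1) (k (lineSection e (e + 1) y)))
        = k (lineSection e (e + 1) y) := fun y =>
      lineSection_lineContract_triple (hne y).1 (hne y).2
    have hM : IsMatching K fun y => lineContract e (e + 1) (k (lineSection e (e + 1) y)) := by
      refine ⟨fun y => ?_, fun y hy h => ?_, fun y hy => ?_⟩
      · rw [hsec, hk.invol, lineContract_lineSection (by omega)]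
      · apply hk.ne (lineSection e (e + 1) y)
        · refine (lineContract_lt (K := K) hef hf).1 ?_
          rwa [lineContract_lineSection (by omega)]
        · rw [← hsec, h]
      · rw [lineSection_ge (by omega) hf hy, hk.fix _ (by omega)]
        unfold lineContract; grind
    refine ⟨hM, by simp [removeBubble]; omega, ?_⟩
    simp only [removeBubble, decide_true, true_or, if_true, addBubble, Prod.mk.injEq, and_true]
    funext x
    by_cases hx : x = e
    · rw [hx, tripleBubble_special.1, hke]
    by_cases hx' : x = e + 2
    · rw [hx', tripleBubble_special.2, hke']
    rw [tripleBubble_other hx hx', hsec, lineSection_lineContract_triple hx hx']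
  · set par : Bool := decide (k e = f) with hpardef
    have hv : k e = (bif par then f else f + 1) ∧ k (e + 1) = (bif par then f + 1 else f) := by
      rcases hpar with ⟨h1, h2⟩ | ⟨h1, h2⟩ <;> simp [par, h1, h2]
    have hv' : k f = (bif par then e else e + 1) ∧ k (f + 1) = (bif par then e + 1 else e) := by
      rcases hpar with ⟨h1, h2⟩ | ⟨h1, h2⟩ <;> simp [par, h1, hinj _ _ h1, hinj _ _ h2]
    obtain ⟨c1, c2, c3, c4⟩ := lineContract_double hef'
    set k₀ : ℕ → ℕ := fun y => lineContract e f (k (lineSection e f y)) with hk₀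
    have hke : k₀ e = f - 1 := by
      have : lineSection e f e = e := by unfold lineSection; grind
      simp only [k₀, this, hv.1]
      cases par <;> simp [c3, c4]
    have hkf : k₀ (f - 1) = e := by
      have : lineSection e f (f - 1) = f := by unfold lineSection; grind
      simp only [k₀, this, hv'.1]
      cases par <;> simp [c1, c2]
    have hne : ∀ x, x ≠ e → x ≠ e + 1 → x ≠ f → x ≠ f + 1 →
        k x ≠ e ∧ k x ≠ e + 1 ∧ k x ≠ f ∧ k x ≠ f + 1 := by
      intro x h1 h2 h3 h4
      have h5 := hinj x
      rcases hpar with ⟨g1, g2⟩ | ⟨g1, g2⟩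
      · have := hinj _ _ g1
        have := hinj _ _ g2
        grind
      · have := hinj _ _ g1
        have := hinj _ _ g2
        grind
    have hsec : ∀ y, y ≠ e → y + 1 ≠ f → lineSection e f (k₀ y) = k (lineSection e f y) := by
      intro y h1 h2
      obtain ⟨g1, g2, g3, g4⟩ := lineSection_double hef' h1 h2
      obtain ⟨i1, i2, i3, i4⟩ := hne _ g1 g2 g3 g4
      exact (lineSection_lineContract_double hef' i1 i2 i3 i4).1
    have hM : IsMatching K k₀ := by
      refine ⟨fun y => ?_, fun y hy h => ?_, fun y hy => ?_⟩
      · by_cases h1 : y = e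
        · rw [h1, hke, hkf]
        by_cases h2 : y + 1 = f
        · obtain rfl : y = f - 1 := by omega
          rw [hkf, hke]
        rw [show k₀ (k₀ y) = lineContract e f (k (lineSection e f (k₀ y))) from rfl, hsec y h1 h2,
          hk.invol, lineContract_lineSection (by omega)]
      · by_cases h1 : y = e
        · rw [h1, hke] at h; omega
        by_cases h2 : y + 1 = f
        · obtain rfl : y = f - 1 := by omega
          rw [hkf] at h; omega
        apply hk.ne (lineSection e f y)
        · refine (lineContract_lt (K := K) hef hf).1 ?_
          rwa [lineContract_lineSection (by omega)]
        · rw [← hsec y h1 h2, h]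
      · simp only [k₀]
        rw [lineSection_ge (by omega) hf hy, hk.fix _ (by omega)]
        unfold lineContract; grind
    have hD : doubleBubble k₀ e f par = k := by
      obtain ⟨s1, s2, s3, s4⟩ := doubleBubble_special (k := k₀) (par := par) hef'
      funext x
      have hx : x = e ∨ x = e + 1 ∨ x = f ∨ x = f + 1 ∨
        (x ≠ e ∧ x ≠ e + 1 ∧ x ≠ f ∧ x ≠ f + 1) := by omega
      rcases hx with rfl | rfl | rfl | rfl | ⟨h1, h2, h3, h4⟩
      · rw [s1, hv.1]
      · rw [s2, hv.2]
      · rw [s3, hv'.1]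
      · rw [s4, hv'.2]
      · obtain ⟨h5, h6, h7⟩ := lineSection_lineContract_double hef' h1 h2 h3 h4
        rw [doubleBubble_other h1 h2 h3 h4, hsec _ h6 h7, h5]
    have hfe : ¬ f = e + 1 := by omega
    have hf1 : f - 1 + 1 = f := by omega
    by_cases hkef : k e = f
    · have hp : par = true := by simp [par, hkef]
      have hr : removeBubble (k, e, f) = (k₀, e, false) := by
        simp [removeBubble, hkef, hfe, k₀]
      rw [hr]
      have : e < f - 1 := by omega
      refine ⟨hM, by dsimp; omega, ?_⟩
      simp only [addBubble, hke, this, if_true, Bool.false_eq_true, if_false, hf1]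
      rw [← hp, hD]
    · have hp : par = false := by simp [par, hkef]
      have hr : removeBubble (k, e, f) = (k₀, f - 1, false) := by
        simp [removeBubble, hkef, hfe, k₀]
      rw [hr]
      have : ¬ f - 1 < e := by omega
      refine ⟨hM, by dsimp; omega, ?_⟩
      simp only [addBubble, hkf, this, Bool.false_eq_true, if_false, hf1]
      rw [← hp, hD]

end

/-! ### The number of labelled matched lines -/

section

/-- The matched lines with a bubble labelling. -/
def lineConfigs (K : ℕ) : Set ((ℕ → ℕ) × (ℕ → ℕ)) :=
  {c | IsMatching K c.1 ∧ IsLabelling K c.1 c.2}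

theorem lineConfigs_zero : (lineConfigs 0).ncard = 1 := by
  rw [Set.ncard_eq_one]
  refine ⟨(fun x => if x = 0 then 1 else if x = 1 then 0 else x, fun _ => 0), ?_⟩
  ext ⟨k, l⟩
  simp only [lineConfigs, Set.mem_ofPred_eq, Set.mem_singleton_iff, Prod.mk.injEq]
  constructor
  · rintro ⟨hk, hl⟩
    refine ⟨?_, funext fun x => by simpa using hl.le x⟩
    have h0 := hk.lt (x := 0) (by norm_num)
    have h0' := hk.ne 0 (by norm_num)
    have h1 := hk.lt (x := 1) (by norm_num)
    have h1' := hk.ne 1 (by norm_num)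
    funext x
    have := hk.fix x
    split_ifs with hx hx'
    · subst hx; omega
    · subst hx'; omega
    · exact this (by omega)
  · rintro ⟨rfl, rfl⟩
    refine ⟨⟨fun x => ?_, fun x hx => ?_, fun x hx => ?_⟩, ⟨fun x => le_rfl, fun x _ => rfl,
      ⟨0, by norm_num, fun x hx => by omega⟩, fun j h h' => by omega⟩⟩ <;> grind

/-- Every labelled line arises in exactly one way by inserting a bubble of top label into a shorter
one. The data of the insertion are a point and a type, `2 (2 K + 2) = 4 (K + 1)` choices. -/
theorem lineConfigs_succ (K : ℕ) :
    Set.BijOn (fun c : ((ℕ → ℕ) × (ℕ → ℕ)) × (ℕ × Bool) =>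
      ((addBubble (c.1.1, c.2)).1, relabel K c.1.2 (addBubble (c.1.1, c.2)).2.1
        (addBubble (c.1.1, c.2)).2.2))
      (lineConfigs K ×ˢ (Set.Iio (2 * K + 2) ×ˢ Set.univ)) (lineConfigs (K + 1)) := by
  refine ⟨?_, ?_, ?_⟩
  · rintro ⟨⟨k, l⟩, p, b⟩ ⟨⟨hk, hl⟩, hp, -⟩
    obtain ⟨⟨h1, h2, h3, h4⟩, h5⟩ := addBubble_mem (s := (k, p, b)) hk hp
    exact ⟨h1, (isLabelling_relabel_iff h5 h1.invol h3 h4 hl.le).2 hl⟩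
  · rintro ⟨⟨k, l⟩, p, b⟩ ⟨⟨hk, hl⟩, hp, -⟩ ⟨⟨k', l'⟩, p', b'⟩ ⟨⟨hk', hl'⟩, hp', -⟩ h
    have h1 := (addBubble_mem (s := (k, p, b)) hk hp).1
    have h1' := (addBubble_mem (s := (k', p', b')) hk' hp').1
    have h2 := removeBubble_addBubble (s := (k, p, b)) hk hp
    have h2' := removeBubble_addBubble (s := (k', p', b')) hk' hp'
    simp only [Prod.mk.injEq] at h
    obtain ⟨h3, h4⟩ := h
    have hlt := h1.2.1
    have hlt' := h1'.2.1
    set e := (addBubble (k, p, b)).2.1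
    set f := (addBubble (k, p, b)).2.2
    set e' := (addBubble (k', p', b')).2.1
    set f' := (addBubble (k', p', b')).2.2
    have key : ∀ (l : ℕ → ℕ) (e f : ℕ), (∀ x, l x ≤ K) → ∀ x, relabel K l e f x = K + 1 ↔
        x = e ∨ x = f := by
      intro l e f hl x
      have := hl (lineContract e f x)
      unfold relabel
      split_ifs with h <;> simp [h]
      omega
    -- The edges of top label reveal where the bubble was inserted.
    have h5 : ∀ x, (x = e ∨ x = f) ↔ (x = e' ∨ x = f') := fun x => by
      rw [← key l e f hl.le, ← key l' e' f' hl'.le, h4]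
    have he : e = e' := by
      have := (h5 e).1 (Or.inl rfl); have := (h5 f).1 (Or.inr rfl)
      have := (h5 e').2 (Or.inl rfl); omega
    have hf : f = f' := by
      have := (h5 f).1 (Or.inr rfl); omega
    have h6 : addBubble (k, p, b) = addBubble (k', p', b') :=
      Prod.ext h3 (Prod.ext he hf)
    rw [h6, h2'] at h2
    simp only [Prod.mk.injEq] at h2 ⊢
    refine ⟨⟨h2.1.symm, ?_⟩, h2.2.1.symm, h2.2.2.symm⟩
    funext x
    rw [← relabel_edgeSkip (K := K) (l := l) hlt, h4, ← relabel_edgeSkip (K := K) (l := l') hlt',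
      he, hf]
  · rintro ⟨k', l'⟩ ⟨hk', hl'⟩
    dsimp only at hk' hl'
    obtain ⟨e, f, hef, hlab, hm⟩ := hl'.bubble (K + 1) (by omega) le_rfl
    have hf : f < 2 * K + 3 := by
      by_contra hcon
      have h1 := hl'.out f (by omega)
      have h2 := (hlab f).2 (Or.inr rfl)
      omega
    have hm' : EdgesMatch (fun x y => y = x ∨ y = k' x) e f := by
      have : LineRel k' l' (K + 1) = fun x y => y = x ∨ y = k' x := by
        funext x y
        exact propext (lineRel_top_iff hk'.invol hl'.le x y)
      rwa [this] at hm
    obtain ⟨h1, h2, h3⟩ := removeBubble_mem (t := (k', e, f)) ⟨hk', hef, hf, hm'⟩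
    have hr : relabel K (fun x => l' (edgeSkip e f x)) e f = l' := by
      funext x
      by_cases hx : x = e ∨ x = f
      · simp only [relabel, hx, if_true]
        exact ((hlab x).2 hx).symm
      · simp only [relabel, hx, if_false]
        rw [edgeSkip_lineContract hef (by tauto) (by tauto)]
    have hle : ∀ x, l' (edgeSkip e f x) ≤ K := by
      intro x
      obtain ⟨-, -, h5, h6⟩ := lineContract_edgeSkip hef x
      have := hl'.le (edgeSkip e f x)
      have := (hlab (edgeSkip e f x)).not.2 (by tauto)
      omega
    have hC := (addBubble_mem h1 h2).2
    rw [h3] at hC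
    refine ⟨(((removeBubble (k', e, f)).1, fun x => l' (edgeSkip e f x)),
      (removeBubble (k', e, f)).2), ⟨⟨h1, ?_⟩, h2, trivial⟩, ?_⟩
    · rw [← isLabelling_relabel_iff hC hk'.invol hf hm' hle, hr]
      exact hl'
    · simp only [Prod.mk.eta, h3, hr]

theorem ncard_lineConfigs (K : ℕ) : (lineConfigs K).ncard = 4 ^ K * K.factorial := by
  induction K with
  | zero => simpa using lineConfigs_zero
  | succ K ih =>
    have h := Nat.card_congr (lineConfigs_succ K).equiv
    rw [Nat.card_coe_set_eq, Nat.card_coe_set_eq, Set.ncard_prod, Set.ncard_prod, ih] at h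
    rw [← h]
    simp [Nat.factorial_succ]
    ring

/-- `ncard` is zero on infinite sets, so a positive count already gives finiteness. -/
theorem finite_lineConfigs (K : ℕ) : (lineConfigs K).Finite := by
  apply Set.finite_of_ncard_pos
  rw [ncard_lineConfigs]
  positivity

end

section

namespace FeynmanDiagram
variable {L : Type} {Γ : FeynmanDiagram L}

/-! ### Bubble extraction sequences as labellings of the edges -/

/-- Internal vertices joined by an edge of a set. -/
def edgeRel (Γ : FeynmanDiagram L) (X : Set Γ.E) (v w : Γ.V) : Prop :=
  ∃ e ∈ X, Γ.src e = Sum.inr v ∧ Γ.tgt e = Sum.inr w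

/-- Modulo `r`, the edges `e` and `f` form a bubble. -/
def BubbleMod (Γ : FeynmanDiagram L) (r : Γ.V → Γ.V → Prop) (e f : Γ.E) : Prop :=
  ∃ v w v' w', Γ.src e = Sum.inr v ∧ Γ.tgt e = Sum.inr w ∧ Γ.src f = Sum.inr v' ∧
    Γ.tgt f = Sum.inr w' ∧ ¬ r v w ∧ ((r v v' ∧ r w w') ∨ (r v w' ∧ r w v'))

/-- The end points of the edges of a set. -/
def endpoints (Γ : FeynmanDiagram L) (X : Set Γ.E) : Set Γ.V :=
  {v | ∃ e ∈ X, Γ.src e = Sum.inr v ∨ Γ.tgt e = Sum.inr v}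

theorem Sub.endpoints_subset (γ : Sub Γ) : Γ.endpoints γ.edges ⊆ γ.verts := by
  rintro v ⟨e, he, h | h⟩
  · obtain ⟨w, hw, h'⟩ := γ.src_mem e he
    rw [h] at h'
    exact Sum.inr.inj h' ▸ hw
  · obtain ⟨w, hw, h'⟩ := γ.tgt_mem e he
    rw [h] at h'
    exact Sum.inr.inj h' ▸ hw

theorem proj_eq_iff (γ : Sub Γ) (v w : Γ.V) :
    Γ.proj γ v = Γ.proj γ w ↔ Relation.EqvGen γ.Adj v w :=
  ⟨fun h => Quot.eqvGen_exact h, fun h => Quot.eqvGen_sound h⟩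

theorem Sub.eq_or_mem_of_eqvGen (γ : Sub Γ) {v w : Γ.V} (h : Relation.EqvGen γ.Adj v w) :
    v = w ∨ (v ∈ γ.verts ∧ w ∈ γ.verts) := by
  induction h with
  | rel v w h =>
    obtain ⟨e, he, h1, h2⟩ := h
    exact Or.inr ⟨γ.endpoints_subset ⟨e, he, Or.inl h1⟩, γ.endpoints_subset ⟨e, he, Or.inr h2⟩⟩
  | refl v => exact Or.inl rfl
  | symm v w _ ih => tauto
  | trans u v w _ _ ih₁ ih₂ => grind

theorem sum_map_proj_eq_inr {γ : Sub Γ} {x : L ⊕ Γ.V} {q : Quot γ.Adj}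
    (h : Sum.map id (Γ.proj γ) x = Sum.inr q) : ∃ v, x = Sum.inr v ∧ Γ.proj γ v = q := by
  rcases x with x | v
  · simp at h
  · exact ⟨v, rfl, by simpa using h⟩

/-- The only vertices that the projection identifies are vertices of `γ`. So a vertex of `δ` is an
end point of a bubble edge or belongs to `γ`, and no isolated vertex can appear. Hence the members
of an extraction sequence are determined by their edges. -/
theorem ExtractionStep.exists_bubble {γ δ : Sub Γ} (h : Γ.ExtractionStep γ δ)
    (hγ : γ.verts = Γ.endpoints γ.edges) :
    δ.verts = Γ.endpoints δ.edges ∧ ∃ e f, e ≠ f ∧ e ∉ γ.edges ∧ f ∉ γ.edges ∧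
      δ.edges = γ.edges ∪ {e, f} ∧ Γ.BubbleMod (Relation.EqvGen γ.Adj) e f := by
  obtain ⟨hle, B, ⟨V, W, ⟨e, he⟩, ⟨f, hf⟩, hVW, hef, hBv, hBe, hse, hsf⟩, hverts, hedges⟩ := h
  have heB : ⟨e, he⟩ ∈ B.edges := by rw [hBe]; exact Or.inl rfl
  have hfB : ⟨f, hf⟩ ∈ B.edges := by rw [hBe]; exact Or.inr rfl
  obtain ⟨V1, hV1, h1⟩ := B.src_mem _ heB
  obtain ⟨W1, hW1, h2⟩ := B.tgt_mem _ heB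
  obtain ⟨V2, hV2, h3⟩ := B.src_mem _ hfB
  obtain ⟨W2, hW2, h4⟩ := B.tgt_mem _ hfB
  rw [h1, h2] at hse
  rw [h3, h4] at hsf
  rw [hBv] at hV1 hW1 hV2 hW2
  simp only [Set.mem_insert_iff, Set.mem_singleton_iff] at hV1 hW1 hV2 hW2
  obtain ⟨v, hv, hv'⟩ := sum_map_proj_eq_inr h1
  obtain ⟨w, hw, hw'⟩ := sum_map_proj_eq_inr h2
  obtain ⟨v2, hv2, hv2'⟩ := sum_map_proj_eq_inr h3
  obtain ⟨w2, hw2, hw2'⟩ := sum_map_proj_eq_inr h4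
  have hne1 : V1 ≠ W1 := fun h => hse (by rw [h])
  have hne2 : V2 ≠ W2 := fun h => hsf (by rw [h])
  have heδ : e ∈ δ.edges := (hedges ⟨e, he⟩).1 heB
  have hfδ : f ∈ δ.edges := (hedges ⟨f, hf⟩).1 hfB
  have hδe : δ.edges = γ.edges ∪ {e, f} := by
    ext x
    simp only [Set.mem_union, Set.mem_insert_iff, Set.mem_singleton_iff]
    constructor
    · intro hx
      by_cases hxγ : x ∈ γ.edges
      · exact Or.inl hxγ
      · have := (hedges ⟨x, hxγ⟩).2 hx
        rw [hBe] at this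
        right
        rcases this with h | h
        · left; exact congrArg Subtype.val h
        · right; exact congrArg Subtype.val (Set.mem_singleton_iff.1 h)
    · rintro (hx | rfl | rfl)
      · exact hle.2 hx
      · exact heδ
      · exact hfδ
  refine ⟨?_, e, f, fun h => hef (Subtype.ext h), he, hf, hδe, v, w, v2, w2, hv, hw, hv2, hw2,
    ?_, ?_⟩
  · apply Set.Subset.antisymm _ δ.endpoints_subset
    have hsub : γ.verts ⊆ Γ.endpoints δ.edges := by
      rw [hγ]
      rintro x ⟨y, hy, h⟩
      exact ⟨y, hle.2 hy, h⟩
    have hv3 : v ∈ Γ.endpoints δ.edges := ⟨e, heδ, Or.inl hv⟩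
    have hw3 : w ∈ Γ.endpoints δ.edges := ⟨e, heδ, Or.inr hw⟩
    have key : ∀ x u, u ∈ Γ.endpoints δ.edges → Γ.proj γ x = Γ.proj γ u →
        x ∈ Γ.endpoints δ.edges := by
      intro x u hu hxu
      rcases γ.eq_or_mem_of_eqvGen ((proj_eq_iff γ x u).1 hxu) with rfl | h
      · exact hu
      · exact hsub h.1
    intro x hx
    have hx' : Γ.proj γ x ∈ B.verts ∪ Γ.proj γ '' γ.verts := hverts ▸ Set.mem_image_of_mem _ hx
    rcases hx' with hx' | ⟨u, hu, hxu⟩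
    · rw [hBv] at hx'
      have : Γ.proj γ x = Γ.proj γ v ∨ Γ.proj γ x = Γ.proj γ w := by
        rw [hv', hw']
        rcases hx' with h | h
        · exact (em (V1 = V)).elim (fun h' => Or.inl (h.trans h'.symm))
            (fun h' => Or.inr (h.trans (by grind)))
        · have h := Set.mem_singleton_iff.1 h
          exact (em (V1 = W)).elim (fun h' => Or.inl (h.trans h'.symm))
            (fun h' => Or.inr (h.trans (by grind)))
      rcases this with h | h
      · exact key x v hv3 h
      · exact key x w hw3 h
    · exact key x u (hsub hu) hxu.symm
  · rw [← proj_eq_iff, hv', hw']; exact hne1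
  · simp only [← proj_eq_iff, hv', hw', hv2', hw2']; grind

theorem extractionStep_of_bubble {γ δ : Sub Γ} (hγ : γ.verts = Γ.endpoints γ.edges)
    (hδ : δ.verts = Γ.endpoints δ.edges) {e f : Γ.E} (hef : e ≠ f) (he : e ∉ γ.edges)
    (hf : f ∉ γ.edges) (hedges : δ.edges = γ.edges ∪ {e, f})
    (hB : Γ.BubbleMod (Relation.EqvGen γ.Adj) e f) : Γ.ExtractionStep γ δ := by
  obtain ⟨v, w, v', w', hv, hw, hv', hw', hne, hmatch⟩ := hB
  simp only [← proj_eq_iff] at hne hmatch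
  have hsub : γ.edges ⊆ δ.edges := by rw [hedges]; exact Set.subset_union_left
  have heδ : e ∈ δ.edges := by rw [hedges]; simp
  have hfδ : f ∈ δ.edges := by rw [hedges]; simp
  have hvsub : γ.verts ⊆ δ.verts := by
    rw [hγ, hδ]
    rintro x ⟨y, hy, h⟩
    exact ⟨y, hsub hy, h⟩
  have c1 : (Γ.contract γ).src ⟨e, he⟩ = Sum.inr (Γ.proj γ v) := by simp [contract, hv]
  have c2 : (Γ.contract γ).tgt ⟨e, he⟩ = Sum.inr (Γ.proj γ w) := by simp [contract, hw]
  have c3 : (Γ.contract γ).src ⟨f, hf⟩ = Sum.inr (Γ.proj γ v') := by simp [contract, hv']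
  have c4 : (Γ.contract γ).tgt ⟨f, hf⟩ = Sum.inr (Γ.proj γ w') := by simp [contract, hw']
  have hpv' : Γ.proj γ v' = Γ.proj γ v ∨ Γ.proj γ v' = Γ.proj γ w := by grind
  have hpw' : Γ.proj γ w' = Γ.proj γ v ∨ Γ.proj γ w' = Γ.proj γ w := by grind
  refine ⟨⟨hvsub, hsub⟩, ⟨{Γ.proj γ v, Γ.proj γ w}, {⟨e, he⟩, ⟨f, hf⟩}, ?_, ?_⟩, ?_, ?_, ?_⟩
  · rintro x (rfl | rfl)
    · exact ⟨_, Or.inl rfl, c1⟩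
    · exact ⟨_, hpv', c3⟩
  · rintro x (rfl | rfl)
    · exact ⟨_, Or.inr rfl, c2⟩
    · exact ⟨_, hpw', c4⟩
  · refine ⟨Γ.proj γ v, Γ.proj γ w, ⟨e, he⟩, ⟨f, hf⟩, hne, fun h => hef (congrArg Subtype.val h),
      rfl, rfl, ?_, ?_⟩
    · rw [c1, c2]; exact fun h => hne (Sum.inr.inj h)
    · rw [c3, c4]; intro h; have := Sum.inr.inj h; grind
  · apply Set.Subset.antisymm
    · rintro _ ⟨x, hx, rfl⟩
      rw [hδ] at hx
      obtain ⟨y, hy, hxy⟩ := hx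
      rw [hedges] at hy
      rcases hy with hy | rfl | rfl
      · exact Or.inr ⟨x, γ.endpoints_subset ⟨y, hy, hxy⟩, rfl⟩
      · left
        rw [hv, hw] at hxy
        rcases hxy with h | h
        · left; rw [Sum.inr.inj h]
        · right; exact congrArg _ (Sum.inr.inj h).symm
      · left
        rw [hv', hw'] at hxy
        rcases hxy with h | h
        · rw [← Sum.inr.inj h]; exact hpv'
        · rw [← Sum.inr.inj h]; exact hpw'
    · rintro _ ((rfl | rfl) | ⟨x, hx, rfl⟩)
      · exact ⟨v, δ.endpoints_subset ⟨e, heδ, Or.inl hv⟩, rfl⟩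
      · exact ⟨w, δ.endpoints_subset ⟨e, heδ, Or.inr hw⟩, rfl⟩
      · exact ⟨x, hvsub hx, rfl⟩
  · rintro ⟨x, hx⟩
    change _ ↔ x ∈ δ.edges
    rw [hedges]
    constructor
    · rintro (h | h)
      · exact Or.inr (Or.inl (congrArg Subtype.val h))
      · exact Or.inr (Or.inr (congrArg Subtype.val (Set.mem_singleton_iff.1 h)))
    · rintro (h | rfl | rfl)
      · exact absurd h hx
      · exact Or.inl rfl
      · exact Or.inr rfl

/-- The subdiagram spanned by a set of internal edges. -/
def spanSub (Γ : FeynmanDiagram L) (X : Set Γ.E) : Sub Γ where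
  verts := Γ.endpoints {e ∈ X | ∃ v w, Γ.src e = Sum.inr v ∧ Γ.tgt e = Sum.inr w}
  edges := {e ∈ X | ∃ v w, Γ.src e = Sum.inr v ∧ Γ.tgt e = Sum.inr w}
  src_mem := by
    rintro e ⟨he, v, w, hv, hw⟩
    exact ⟨v, ⟨e, ⟨he, v, w, hv, hw⟩, Or.inl hv⟩, hv⟩
  tgt_mem := by
    rintro e ⟨he, v, w, hv, hw⟩
    exact ⟨w, ⟨e, ⟨he, v, w, hv, hw⟩, Or.inr hw⟩, hw⟩

theorem Sub.eq_spanSub (γ : Sub Γ) (hγ : γ.verts = Γ.endpoints γ.edges) :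
    γ = Γ.spanSub γ.edges := by
  have : γ.edges = (Γ.spanSub γ.edges).edges := by
    ext e
    refine ⟨fun he => ⟨he, ?_⟩, fun he => he.1⟩
    obtain ⟨v, -, hv⟩ := γ.src_mem e he
    obtain ⟨w, -, hw⟩ := γ.tgt_mem e he
    exact ⟨v, w, hv, hw⟩
  refine Sub.ext ?_ this
  rw [hγ]
  conv_lhs => rw [this]
  rfl

/-- The labellings of the edges by the times (counted backwards) at which they are extracted. -/
def bubbleLabellings (Γ : FeynmanDiagram L) (K : ℕ) : Set (Γ.E → ℕ) :=
  {l | (∀ e, l e ≤ K) ∧ ∀ j, 1 ≤ j → j ≤ K → ∃ e f, e ≠ f ∧ (∀ x, l x = j ↔ x = e ∨ x = f) ∧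
    Γ.BubbleMod (Relation.EqvGen (Γ.edgeRel {x | j < l x})) e f}

theorem internal_of_mem_bubbleLabellings {K : ℕ} {l : Γ.E → ℕ} (hl : l ∈ Γ.bubbleLabellings K)
    {e : Γ.E} (he : 0 < l e) : ∃ v w, Γ.src e = Sum.inr v ∧ Γ.tgt e = Sum.inr w := by
  obtain ⟨a, b, -, hab, v, w, v', w', hv, hw, hv', hw', -⟩ := hl.2 (l e) he (hl.1 e)
  rcases (hab e).1 rfl with rfl | rfl
  · exact ⟨v, w, hv, hw⟩
  · exact ⟨v', w', hv', hw'⟩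

theorem mem_spanSub_of_label {K : ℕ} {l : Γ.E → ℕ} (hl : l ∈ Γ.bubbleLabellings K) {i : ℕ}
    (hi : i ≤ K) (e : Γ.E) : e ∈ (Γ.spanSub {e | K < l e + i}).edges ↔ K < l e + i := by
  refine ⟨fun h => h.1, fun h => ⟨h, internal_of_mem_bubbleLabellings hl (by omega)⟩⟩

/-- The increasing sequences of subdiagrams that extract `K` bubbles. -/
def bubbleSequences (Γ : FeynmanDiagram L) (K : ℕ) : Set (Fin (K + 1) → Sub Γ) :=
  {s | s 0 = Sub.sUnion ∅ ∧ ∀ i : Fin K, Γ.ExtractionStep (s i.castSucc) (s i.succ)}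

theorem sUnion_empty : (Sub.sUnion ∅ : Sub Γ).verts = ∅ ∧ (Sub.sUnion ∅ : Sub Γ).edges = ∅ := by
  simp [Sub.sUnion]

theorem endpoints_empty : Γ.endpoints ∅ = ∅ := by
  simp [endpoints]

theorem bubbleSequences_verts {K : ℕ} {s : Fin (K + 1) → Sub Γ} (hs : s ∈ Γ.bubbleSequences K)
    (i : Fin (K + 1)) : (s i).verts = Γ.endpoints (s i).edges := by
  induction i using Fin.induction with
  | zero => rw [hs.1, sUnion_empty.1, sUnion_empty.2, endpoints_empty]
  | succ i ih => exact ((hs.2 i).exists_bubble ih).1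

theorem bubbleSequences_mono {K : ℕ} {s : Fin (K + 1) → Sub Γ} (hs : s ∈ Γ.bubbleSequences K) :
    Monotone fun i => (s i).edges :=
  Fin.monotone_iff_le_succ.2 fun i => (hs.2 i).1.2

/-- An edge of positive label `t` enters the sequence at time `K + 1 - t`, and an edge of label `0`
never. The edges with labels above `j` are thus the ones present just before the bubble `j` is
extracted. -/
theorem bijOn_bubbleLabellings (Γ : FeynmanDiagram L) (K : ℕ) :
    Set.BijOn (fun (l : Γ.E → ℕ) (i : Fin (K + 1)) => Γ.spanSub {e | K < l e + i})
      (Γ.bubbleLabellings K) (Γ.bubbleSequences K) := by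
  refine ⟨fun l hl => ⟨?_, fun i => ?_⟩, fun l hl l' hl' h => ?_, fun s hs => ?_⟩
  · have : {e | K < l e + (0 : Fin (K + 1)).val} = ∅ := by
      ext e
      have := hl.1 e
      simp; omega
    simp only [this]
    apply Sub.ext <;> simp [spanSub, sUnion_empty, endpoints_empty]
  -- The passage from time `i` to `i + 1` extracts the bubble with label `K - i`.
  · obtain ⟨e, f, hef, hlab, hB⟩ := hl.2 (K - i) (by omega) (by omega)
    have hi1 : (i.castSucc : ℕ) ≤ K := by simp
    have hi2 : (i.succ : ℕ) ≤ K := by simp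
    have he := (hlab e).2 (Or.inl rfl)
    have hf := (hlab f).2 (Or.inr rfl)
    refine extractionStep_of_bubble rfl rfl hef ?_ ?_ ?_ ?_
    · rw [mem_spanSub_of_label hl hi1, he]; simp
    · rw [mem_spanSub_of_label hl hi1, hf]; simp
    · ext x
      have := hlab x
      rw [Set.mem_union, mem_spanSub_of_label hl hi1, mem_spanSub_of_label hl hi2]
      simp only [Set.mem_insert_iff, Set.mem_singleton_iff, ← hlab, Fin.val_succ, Fin.val_castSucc]
      omega
    · have : (Γ.spanSub {e | K < l e + (i.castSucc : ℕ)}).Adj = Γ.edgeRel {x | K - i < l x} := by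
        have h : (Γ.spanSub {e | K < l e + (i.castSucc : ℕ)}).edges = {x | K - i < l x} := by
          ext x
          rw [mem_spanSub_of_label hl hi1]
          simp; omega
        rw [← h]; rfl
      rw [this]
      exact hB
  · funext e
    have key : ∀ i ≤ K, K < l e + i ↔ K < l' e + i := by
      intro i hi
      rw [← mem_spanSub_of_label hl hi, ← mem_spanSub_of_label hl' hi]
      have := congrFun h ⟨i, by omega⟩
      dsimp only at this
      rw [this]
    have h1 := hl.1 e
    have h2 := hl'.1 e
    have h3 := key (K - l e)
    have h4 := key (K - l' e)
    have h5 := key (K + 1 - l e)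
    have h6 := key (K + 1 - l' e)
    omega
  · classical
    have hmono := bubbleSequences_mono hs
    -- `t` is the time at which the edge appears; the value `K + 1` means that it is never
    -- extracted.
    have hex : ∀ e, ∃ t ≤ K + 1, ∀ i : Fin (K + 1), e ∈ (s i).edges ↔ t ≤ i := by
      intro e
      by_cases h : ∃ t : ℕ, ∃ ht : t < K + 1, e ∈ (s ⟨t, ht⟩).edges
      · obtain ⟨h1, h2⟩ := Nat.find_spec h
        refine ⟨Nat.find h, by omega, fun i => ⟨fun hi => Nat.find_min' h ⟨i.2, hi⟩, fun hi => ?_⟩⟩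
        exact hmono (a := ⟨Nat.find h, h1⟩) (b := i) hi h2
      · push Not at h
        exact ⟨K + 1, le_rfl, fun i => ⟨fun hi => absurd hi (h i i.2), fun hi => by omega⟩⟩
    choose t ht hts using hex
    set l : Γ.E → ℕ := fun e => K + 1 - t e with hldef
    have hlab : ∀ e (i : Fin (K + 1)), e ∈ (s i).edges ↔ K < l e + i := by
      intro e i
      rw [hts]
      have := ht e
      simp only [hldef]
      omega
    have h0 : ∀ e, l e ≤ K := by
      intro e
      have := (hlab e 0).not.1 (by rw [hs.1, sUnion_empty.2]; simp)
      simpa using this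
    have hl : l ∈ Γ.bubbleLabellings K := by
      refine ⟨h0, fun j hj hjK => ?_⟩
      obtain ⟨-, e, f, hef, he, hf, hedges, hB⟩ :=
        (hs.2 ⟨K - j, by omega⟩).exists_bubble (bubbleSequences_verts hs _)
      refine ⟨e, f, hef, fun x => ?_, ?_⟩
      · have h1 : _ ↔ K < l x + (K - j) := hlab x (Fin.castSucc ⟨K - j, by omega⟩)
        have h2 : _ ↔ K < l x + (K - j + 1) := hlab x (Fin.succ ⟨K - j, by omega⟩)
        have he' : ¬ K < l e + (K - j) := (hlab e _).not.1 he
        have hf' : ¬ K < l f + (K - j) := (hlab f _).not.1 hf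
        rw [hedges, Set.mem_union, h1] at h2
        simp only [Set.mem_insert_iff, Set.mem_singleton_iff] at h2
        constructor
        · intro hx
          exact (h2.2 (by omega)).resolve_left (by omega)
        · intro hx
          have := h2.1 (Or.inr hx)
          rcases hx with rfl | rfl <;> omega
      · have : (s (Fin.castSucc ⟨K - j, by omega⟩)).Adj = Γ.edgeRel {x | j < l x} := by
          have h : (s (Fin.castSucc ⟨K - j, by omega⟩)).edges = {x | j < l x} := by
            ext x
            rw [hlab]
            simp; omega
          rw [← h]; rfl
        rw [← this]
        exact hB
    refine ⟨l, hl, funext fun i => ?_⟩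
    have : {e | K < l e + i} = (s i).edges := by
      ext e
      exact (hlab e i).symm
    dsimp only
    rw [this]
    exact (Sub.eq_spanSub (s i) (bubbleSequences_verts hs i)).symm

theorem ncard_bubbleSequences (Γ : FeynmanDiagram L) (K : ℕ) :
    (Γ.bubbleSequences K).ncard = (Γ.bubbleLabellings K).ncard := by
  rw [← Nat.card_coe_set_eq, ← Nat.card_coe_set_eq]
  exact (Nat.card_congr (bijOn_bubbleLabellings Γ K).equiv).symm

theorem extractionSequences_ncard {K : ℕ} (hK : Nat.card Γ.V = K + 1) :
    Γ.extractionSequences.ncard = (Γ.bubbleLabellings K).ncard := by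
  have h : Nat.card Γ.V - 1 = K := by omega
  have : Γ.extractionSequences.ncard = (Γ.bubbleSequences (Nat.card Γ.V - 1)).ncard := rfl
  rw [this, h, ncard_bubbleSequences]

end FeynmanDiagram

end

section

/-! ### Paired trees as matched lines -/

theorem EdgesMatch.symm {r : ℕ → ℕ → Prop} (hr : Equivalence r) {e f : ℕ}
    (h : EdgesMatch r e f) : EdgesMatch r f e := by
  obtain ⟨h1, ⟨h2, h3⟩ | ⟨h2, h3⟩⟩ := h
  · exact ⟨fun h => h1 (hr.trans h2 (hr.trans h (hr.symm h3))), Or.inl ⟨hr.symm h2, hr.symm h3⟩⟩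
  · exact ⟨fun h => h1 (hr.trans h2 (hr.trans (hr.symm h) (hr.symm h3))),
      Or.inr ⟨hr.symm h3, hr.symm h2⟩⟩

namespace Pairing

theorem mk_eq_iff {n m : ℕ} (κ : Pairing n m) (v w : Fin n ⊕ Fin m) :
    Quot.mk (fun v w => κ.1 v = w) v = Quot.mk (fun v w => κ.1 v = w) w ↔ w = v ∨ w = κ.1 v := by
  constructor
  · intro h
    have := Quot.eqvGen_exact h
    induction this with
    | rel v w hvw => exact Or.inr hvw.symm
    | refl v => exact Or.inl rfl
    | symm v w _ ih =>
      rcases ih (Quot.eqvGen_sound ‹_›) with rfl | rfl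
      · exact Or.inl rfl
      · exact Or.inr (κ.2 v).1.symm
    | trans u v w h1 h2 ih₁ ih₂ =>
      rcases ih₁ (Quot.eqvGen_sound h1) with rfl | rfl
      · exact ih₂ (Quot.eqvGen_sound h2)
      · rcases ih₂ (Quot.eqvGen_sound h2) with rfl | rfl
        · exact Or.inr rfl
        · exact Or.inl (κ.2 u).1
  · rintro (rfl | rfl)
    · rfl
    · exact Quot.sound rfl

/-- The fibres of the quotient map are the pairs `{v, κ v}`. -/
theorem two_mul_card {n m : ℕ} (κ : Pairing n m) : 2 * Nat.card (pairedDiagram κ).V = n + m := by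
  classical
  have hV : Nat.card (pairedDiagram κ).V = Nat.card (Quot fun v w => κ.1 v = w) := rfl
  have : Fintype (Quot fun v w => κ.1 v = w) := Fintype.ofFinite _
  have h := Finset.card_eq_sum_card_fiberwise
    (s := (Finset.univ : Finset (Fin n ⊕ Fin m))) (t := Finset.univ)
    (f := Quot.mk fun v w => κ.1 v = w) (by simp)
  have h2 : ∀ q : Quot fun v w => κ.1 v = w,
      (Finset.univ.filter fun v => Quot.mk (fun v w => κ.1 v = w) v = q).card = 2 := by
    intro q
    obtain ⟨v, rfl⟩ := Quot.exists_rep q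
    have : (Finset.univ.filter fun w => Quot.mk (fun v w => κ.1 v = w) w =
        Quot.mk (fun v w => κ.1 v = w) v) = {v, κ.1 v} := by
      ext w
      simp only [Finset.mem_filter, Finset.mem_univ, true_and, Finset.mem_insert,
        Finset.mem_singleton]
      rw [eq_comm, mk_eq_iff]
    rw [this, Finset.card_pair (κ.2 v).2.symm]
  simp only [h2] at h
  rw [hV, Nat.card_eq_fintype_card]
  simp at h
  omega

variable {a b : ℕ}

/-- The place of an inner vertex of a pair of trees when the trees are put one after the other. -/
def pos : Fin (a + 1) ⊕ Fin (b + 1) → ℕ := Sum.elim (fun i => i) fun i => a + 1 + i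

def posInv (a b x : ℕ) : Fin (a + 1) ⊕ Fin (b + 1) :=
  if h : x < a + 1 then Sum.inl ⟨x, h⟩
  else if h : x - (a + 1) < b + 1 then Sum.inr ⟨x - (a + 1), h⟩ else Sum.inl 0

theorem pos_lt (v : Fin (a + 1) ⊕ Fin (b + 1)) : pos v < a + b + 2 := by
  rcases v with v | v <;> simp only [pos, Sum.elim_inl, Sum.elim_inr] <;> omega

theorem posInv_pos (v : Fin (a + 1) ⊕ Fin (b + 1)) : posInv a b (pos v) = v := by
  rcases v with ⟨v, hv⟩ | ⟨v, hv⟩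
  · exact dif_pos hv
  · have h1 : ¬ a + 1 + v < a + 1 := by omega
    have h2 : a + 1 + v - (a + 1) < b + 1 := by omega
    have hp : pos (Sum.inr ⟨v, hv⟩ : Fin (a + 1) ⊕ Fin (b + 1)) = a + 1 + v := rfl
    refine (dif_neg h1).trans ((dif_pos h2).trans ?_)
    congr 2
    omega

theorem pos_posInv {x : ℕ} (hx : x < a + b + 2) : pos (posInv a b x) = x := by
  unfold posInv
  split_ifs with h h'
  · rfl
  · simp only [pos, Sum.elim_inr]; omega
  · omega

/-- The matching of the line that is given by a pairing. -/
def lineMatching (κ : Pairing (a + 1) (b + 1)) (x : ℕ) : ℕ :=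
  if x < a + b + 2 then pos (κ.1 (posInv a b x)) else x

theorem isMatching_lineMatching {K : ℕ} (hK : a + b = 2 * K) (κ : Pairing (a + 1) (b + 1)) :
    IsMatching K κ.lineMatching := by
  refine ⟨fun x => ?_, fun x hx h => ?_, fun x hx => ?_⟩
  · unfold lineMatching
    by_cases hx : x < a + b + 2
    · rw [if_pos hx, if_pos (pos_lt _), posInv_pos, (κ.2 _).1, pos_posInv hx]
    · rw [if_neg hx, if_neg hx]
  · rw [lineMatching, if_pos (by omega)] at h
    apply (κ.2 (posInv a b x)).2
    rw [← posInv_pos (κ.1 _), h]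
  · rw [lineMatching, if_neg (by omega)]

theorem exists_lineMatching {K : ℕ} (hK : a + b = 2 * K) {k : ℕ → ℕ} (hk : IsMatching K k) :
    ∃ κ : Pairing (a + 1) (b + 1), κ.lineMatching = k := by
  have hlt : ∀ v : Fin (a + 1) ⊕ Fin (b + 1), k (pos v) < a + b + 2 := fun v => by
    have := pos_lt v
    have := hk.lt (x := pos v) (by omega)
    omega
  have hinv : Function.Involutive fun v : Fin (a + 1) ⊕ Fin (b + 1) => posInv a b (k (pos v)) := by
    intro v
    dsimp only
    rw [pos_posInv (hlt v), hk.invol, posInv_pos]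
  refine ⟨⟨hinv.toPerm, fun v => ⟨hinv v, fun h => ?_⟩⟩, ?_⟩
  · have := pos_lt v
    apply hk.ne (pos v) (by omega)
    have h' := congrArg pos h
    rwa [Function.Involutive.coe_toPerm, pos_posInv (hlt v)] at h'
  · funext x
    unfold lineMatching
    split_ifs with hx
    · simp only [Function.Involutive.coe_toPerm]
      rw [pos_posInv (hlt _), pos_posInv hx]
    · exact (hk.fix x (by omega)).symm

theorem lineMatching_injective :
    Function.Injective (lineMatching : Pairing (a + 1) (b + 1) → ℕ → ℕ) := by
  intro κ κ' h
  apply Subtype.ext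
  ext1 v
  have := congrFun h (pos v)
  rw [lineMatching, lineMatching, if_pos (pos_lt v), if_pos (pos_lt v), posInv_pos] at this
  rw [← posInv_pos (κ.1 v), this, posInv_pos]

variable (κ : Pairing (a + 1) (b + 1))

/-- The internal vertex at a place of the line. -/
def vert (x : ℕ) : (pairedDiagram κ).V := Quot.mk _ (posInv a b x)

/-- The internal edge that follows a place of the line (except for `a`, where the line is cut). -/
def edgeAt (x : ℕ) : (pairedDiagram κ).E :=
  -- In each tree the edge `0` starts at the bottom leaf, so the edge after inner vertex `i`
  -- (counted from `0`) has the number `i + 1`. For the second tree `i = x - (a + 1)`.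
  if h : x < a then Sum.inl ⟨x + 1, by omega⟩
  else if h : x - a < b + 2 then Sum.inr ⟨x - a, h⟩ else Sum.inl 0

theorem vert_surjective (v : (pairedDiagram κ).V) : ∃ x < a + b + 2, κ.vert x = v := by
  obtain ⟨p, rfl⟩ := Quot.exists_rep v
  exact ⟨pos p, pos_lt p, by rw [vert, posInv_pos]⟩

theorem vert_eq_iff {x y : ℕ} (hx : x < a + b + 2) (hy : y < a + b + 2) :
    κ.vert x = κ.vert y ↔ y = x ∨ y = κ.lineMatching x := by
  have h := κ.mk_eq_iff (posInv a b x) (posInv a b y)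
  refine Iff.trans h ?_
  rw [lineMatching, if_pos hx]
  constructor
  · rintro (h | h)
    · left; rw [← pos_posInv hy, h, pos_posInv hx]
    · right; rw [← pos_posInv hy, h]
  · rintro (rfl | rfl)
    · left; rfl
    · right; rw [posInv_pos]

theorem edgeAt_of_lt {x : ℕ} (h : x < a) : κ.edgeAt x = Sum.inl ⟨x + 1, by omega⟩ := dif_pos h

theorem edgeAt_of_gt {x : ℕ} (h : a < x) (h' : x - a < b + 2) :
    κ.edgeAt x = Sum.inr ⟨x - a, h'⟩ := by
  exact (dif_neg (by omega)).trans (dif_pos h')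

theorem _root_.Anderson.treeVertex_inner {α : Type} {n : ℕ} (bot top : α) (inner : Fin n → α)
    {i j : ℕ} (h : j < n) (hij : i = j + 1) : treeVertex bot top inner i = inner ⟨j, h⟩ := by
  subst hij
  simp [treeVertex, h]

theorem edgeAt_ends {x : ℕ} (hx : x < a + b + 1) (hxa : x ≠ a) :
    (pairedDiagram κ).src (κ.edgeAt x) = Sum.inr (κ.vert x) ∧
      (pairedDiagram κ).tgt (κ.edgeAt x) = Sum.inr (κ.vert (x + 1)) := by
  rcases lt_or_gt_of_ne hxa with h | h
  · have h1 : x < a + 1 := by omega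
    have h2 : x + 1 < a + 1 := by omega
    rw [edgeAt_of_lt κ h, vert, vert, posInv, posInv, dif_pos h1, dif_pos h2]
    have key := fun (i j : ℕ) => treeVertex_inner (α := Leaf ⊕ (pairedDiagram κ).V) (Sum.inl (0, 0))
      (Sum.inl (0, 1)) (fun i : Fin (a + 1) => Sum.inr (Quot.mk _ (Sum.inl i))) (i := i) (j := j)
    exact ⟨key _ _ h1 rfl, key _ _ h2 rfl⟩
  · have h1 : x - (a + 1) < b + 1 := by omega
    have h2 : x + 1 - (a + 1) < b + 1 := by omega
    rw [edgeAt_of_gt κ h (by omega), vert, vert, posInv, posInv, dif_neg (by omega), dif_pos h1,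
      dif_neg (by omega), dif_pos h2]
    have key := fun (i j : ℕ) => treeVertex_inner (α := Leaf ⊕ (pairedDiagram κ).V) (Sum.inl (1, 0))
      (Sum.inl (1, 1)) (fun i : Fin (b + 1) => Sum.inr (Quot.mk _ (Sum.inr i))) (i := i) (j := j)
    exact ⟨key (x - a) _ h1 (by omega), key (x - a + 1) _ h2 (by omega)⟩

theorem exists_edgeAt {e : (pairedDiagram κ).E} {v w : (pairedDiagram κ).V}
    (hv : (pairedDiagram κ).src e = Sum.inr v) (hw : (pairedDiagram κ).tgt e = Sum.inr w) :
    ∃ x < a + b + 1, x ≠ a ∧ κ.edgeAt x = e := by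
  rcases e with ⟨j, hj⟩ | ⟨j, hj⟩
  · have h0 : j ≠ 0 := by rintro rfl; simp [pairedDiagram, treeVertex] at hv
    have h1 : j < a + 1 := by
      by_contra hcon
      obtain rfl : j = a + 1 := by omega
      simp [pairedDiagram, treeVertex] at hw
    refine ⟨j - 1, by omega, by omega, ?_⟩
    rw [edgeAt_of_lt κ (by omega)]
    congr 2
    omega
  · have h0 : j ≠ 0 := by rintro rfl; simp [pairedDiagram, treeVertex] at hv
    have h1 : j < b + 1 := by
      by_contra hcon
      obtain rfl : j = b + 1 := by omega
      simp [pairedDiagram, treeVertex] at hw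
    refine ⟨a + j, by omega, by omega, ?_⟩
    rw [edgeAt_of_gt κ (by omega) (by omega)]
    congr 2
    omega

theorem edgeAt_injective {x y : ℕ} (hx : x < a + b + 1) (hxa : x ≠ a) (hy : y < a + b + 1)
    (hya : y ≠ a) (h : κ.edgeAt x = κ.edgeAt y) : x = y := by
  rcases lt_or_gt_of_ne hxa with h1 | h1 <;> rcases lt_or_gt_of_ne hya with h2 | h2
  · rw [edgeAt_of_lt κ h1, edgeAt_of_lt κ h2] at h
    have := Fin.mk.inj_iff.1 (Sum.inl.inj h)
    omega
  · rw [edgeAt_of_lt κ h1, edgeAt_of_gt κ h2 (by omega)] at h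
    cases h
  · rw [edgeAt_of_gt κ h1 (by omega), edgeAt_of_lt κ h2] at h
    cases h
  · rw [edgeAt_of_gt κ h1 (by omega), edgeAt_of_gt κ h2 (by omega)] at h
    have := Fin.mk.inj_iff.1 (Sum.inr.inj h)
    omega

/-- The labels of the internal edges, in the order of the line. -/
def lineLabels (l : (pairedDiagram κ).E → ℕ) (x : ℕ) : ℕ :=
  if x < a + b + 1 ∧ x ≠ a then l (κ.edgeAt x) else 0

variable {κ} in
-- Steps along the matching become equalities of vertices, and steps along labelled edges become
-- edges of the diagram.
theorem lineRel_lineLabels_iff {l : (pairedDiagram κ).E → ℕ} {K : ℕ} (hK : a + b = 2 * K) {j x y : ℕ} (hx : x < a + b + 2)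
    (hy : y < a + b + 2) : LineRel κ.lineMatching (κ.lineLabels l) j x y ↔
      Relation.EqvGen ((pairedDiagram κ).edgeRel {e | j < l e}) (κ.vert x) (κ.vert y) := by
  have hM := isMatching_lineMatching hK κ
  constructor
  · intro h
    -- The induction also shows that a chain cannot leave the line: beyond its end the matching
    -- fixes every point, and edges there have the label `0`.
    have key : ∀ x y, LineRel κ.lineMatching (κ.lineLabels l) j x y →
        (x < a + b + 2 ↔ y < a + b + 2) ∧ (x < a + b + 2 →
          Relation.EqvGen ((pairedDiagram κ).edgeRel {e | j < l e}) (κ.vert x) (κ.vert y)) := by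
      intro x y h
      induction h with
      | rel x y h =>
        rcases h with rfl | ⟨rfl, h⟩
        · have h1 : x < a + b + 2 ↔ κ.lineMatching x < a + b + 2 := by
            refine ⟨fun h => ?_, fun h => ?_⟩
            · have := hM.lt (x := x) (by omega); omega
            · by_contra hcon
              rw [hM.fix x (by omega)] at h
              exact hcon h
          refine ⟨h1, fun hx => ?_⟩
          rw [(κ.vert_eq_iff hx (h1.1 hx)).2 (Or.inr rfl)]
          exact .refl _
        · have h1 : x < a + b + 1 ∧ x ≠ a := by
            by_contra hcon
            rw [lineLabels, if_neg hcon] at h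
            omega
          rw [lineLabels, if_pos h1] at h
          obtain ⟨h2, h3⟩ := κ.edgeAt_ends h1.1 h1.2
          exact ⟨by omega, fun _ => .rel _ _ ⟨_, h, h2, h3⟩⟩
      | refl x => exact ⟨Iff.rfl, fun _ => .refl _⟩
      | symm x y _ ih => exact ⟨ih.1.symm, fun h => .symm _ _ (ih.2 (ih.1.2 h))⟩
      | trans x y z _ _ ih₁ ih₂ =>
        exact ⟨ih₁.1.trans ih₂.1, fun h => .trans _ _ _ (ih₁.2 h) (ih₂.2 (ih₁.1.1 h))⟩
    exact (key x y h).2 hx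
  · have hvert : ∀ x y, x < a + b + 2 → y < a + b + 2 → κ.vert x = κ.vert y →
        LineRel κ.lineMatching (κ.lineLabels l) j x y := by
      intro x y hx hy h
      rcases (κ.vert_eq_iff hx hy).1 h with rfl | h
      · exact .refl _
      · exact .rel _ _ (Or.inl h)
    have key : ∀ v w, Relation.EqvGen ((pairedDiagram κ).edgeRel {e | j < l e}) v w →
        ∀ x y, x < a + b + 2 → y < a + b + 2 → κ.vert x = v → κ.vert y = w →
          LineRel κ.lineMatching (κ.lineLabels l) j x y := by
      intro v w h
      induction h with
      | rel v w h =>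
        rintro x y hx hy rfl rfl
        obtain ⟨e, he, hv, hw⟩ := h
        obtain ⟨z, hz, hza, rfl⟩ := κ.exists_edgeAt hv hw
        obtain ⟨h2, h3⟩ := κ.edgeAt_ends hz hza
        rw [h2] at hv
        rw [h3] at hw
        refine .trans _ _ _ (hvert x z hx (by omega) (Sum.inr.inj hv).symm) (.trans _ (z + 1) _
          (.rel _ _ (Or.inr ⟨rfl, ?_⟩)) (hvert (z + 1) y (by omega) hy (Sum.inr.inj hw)))
        rw [lineLabels, if_pos ⟨hz, hza⟩]
        exact he
      | refl v => rintro x y hx hy rfl h; exact hvert x y hx hy h.symm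
      | symm v w _ ih => intro x y hx hy h h'; exact .symm _ _ (ih y x hy hx h' h)
      | trans u v w _ _ ih₁ ih₂ =>
        intro x y hx hy h h'
        obtain ⟨z, hz, hz'⟩ := κ.vert_surjective v
        exact .trans _ _ _ (ih₁ x z hx hz h hz') (ih₂ z y hz hy hz' h')
    exact fun h => key _ _ h x y hx hy rfl rfl

variable {κ} in
theorem bubbleMod_iff {l : (pairedDiagram κ).E → ℕ} {K : ℕ} (hK : a + b = 2 * K) {j x y : ℕ} (hx : x < a + b + 1) (hxa : x ≠ a)
    (hy : y < a + b + 1) (hya : y ≠ a) :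
    (pairedDiagram κ).BubbleMod (Relation.EqvGen ((pairedDiagram κ).edgeRel {e | j < l e}))
      (κ.edgeAt x) (κ.edgeAt y) ↔
      EdgesMatch (LineRel κ.lineMatching (κ.lineLabels l) j) x y := by
  obtain ⟨h1, h2⟩ := κ.edgeAt_ends hx hxa
  obtain ⟨h3, h4⟩ := κ.edgeAt_ends hy hya
  unfold EdgesMatch FeynmanDiagram.BubbleMod
  rw [lineRel_lineLabels_iff hK (by omega) (by omega),
    lineRel_lineLabels_iff hK (by omega) (by omega),
    lineRel_lineLabels_iff hK (by omega) (by omega),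
    lineRel_lineLabels_iff hK (by omega) (by omega),
    lineRel_lineLabels_iff hK (by omega) (by omega), h1, h2, h3, h4]
  constructor
  · rintro ⟨v, w, v', w', hv, hw, hv', hw', h⟩
    rwa [Sum.inr.inj hv, Sum.inr.inj hw, Sum.inr.inj hv', Sum.inr.inj hw']
  · exact fun h => ⟨_, _, _, _, rfl, rfl, rfl, rfl, h⟩

/-- Bubble edges join internal vertices, so edges at leaves have the label `0` and no information is
lost by reading only internal edges. The gap between the trees becomes the edge where the line is
cut. -/
theorem bijOn_lineLabels {K : ℕ} (hK : a + b = 2 * K) :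
    Set.BijOn κ.lineLabels ((pairedDiagram κ).bubbleLabellings K)
      {l | IsLabelling K κ.lineMatching l ∧ l a = 0} := by
  classical
  have hzero : ∀ l : (pairedDiagram κ).E → ℕ, κ.lineLabels l a = 0 := fun l => by simp [lineLabels]
  have hbubble : ∀ l ∈ (pairedDiagram κ).bubbleLabellings K, ∀ j, 1 ≤ j → j ≤ K → ∃ e f, e < f ∧
      (∀ x, κ.lineLabels l x = j ↔ x = e ∨ x = f) ∧
      EdgesMatch (LineRel κ.lineMatching (κ.lineLabels l) j) e f := by
    intro l hl j hj hjK
    obtain ⟨e, f, hef, hlab, hB⟩ := hl.2 j hj hjK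
    have hint := fun e => FeynmanDiagram.internal_of_mem_bubbleLabellings hl (e := e)
    have he := (hlab e).2 (Or.inl rfl)
    have hf := (hlab f).2 (Or.inr rfl)
    obtain ⟨v, w, hv, hw⟩ := hint e (by omega)
    obtain ⟨x, hx, hxa, rfl⟩ := κ.exists_edgeAt hv hw
    obtain ⟨v, w, hv, hw⟩ := hint f (by omega)
    obtain ⟨y, hy, hya, rfl⟩ := κ.exists_edgeAt hv hw
    rw [bubbleMod_iff hK hx hxa hy hya] at hB
    have hxy : x ≠ y := fun h => hef (by rw [h])
    have hlab' : ∀ z, κ.lineLabels l z = j ↔ z = x ∨ z = y := by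
      intro z
      unfold lineLabels
      split_ifs with hz
      · rw [hlab]
        constructor
        · rintro (h | h)
          · exact Or.inl (κ.edgeAt_injective hz.1 hz.2 hx hxa h)
          · exact Or.inr (κ.edgeAt_injective hz.1 hz.2 hy hya h)
        · rintro (rfl | rfl) <;> simp
      · constructor
        · omega
        · rintro (rfl | rfl) <;> tauto
    rcases lt_or_gt_of_ne hxy with h | h
    · exact ⟨x, y, h, hlab', hB⟩
    · exact ⟨y, x, h, fun z => by rw [hlab', or_comm], hB.symm (Relation.EqvGen.is_equivalence _)⟩
  have hle : ∀ l ∈ (pairedDiagram κ).bubbleLabellings K, ∀ x, κ.lineLabels l x ≤ K := by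
    intro l hl x
    unfold lineLabels
    split_ifs
    · exact hl.1 _
    · omega
  -- Each of the `K` positive labels occurs twice. If a second place besides `a` had the label `0`,
  -- only `2 K - 1` places would remain for these `2 K` occurrences.
  have hcut : ∀ l ∈ (pairedDiagram κ).bubbleLabellings K, ∀ x < 2 * K + 1,
      κ.lineLabels l x = 0 → x = a := by
    intro l hl x hx h0
    by_contra hxa
    have h1 := Finset.card_eq_sum_card_fiberwise (f := κ.lineLabels l)
      (s := (Finset.range (2 * K + 1)).filter fun x => 1 ≤ κ.lineLabels l x) (t := Finset.Icc 1 K)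
      (fun x hx => by
        have hx := (Finset.mem_filter.1 hx).2
        exact Finset.mem_coe.2 (Finset.mem_Icc.2 ⟨hx, hle l hl x⟩))
    have h2 : ∀ j ∈ Finset.Icc 1 K, (((Finset.range (2 * K + 1)).filter fun x =>
        1 ≤ κ.lineLabels l x).filter fun x => κ.lineLabels l x = j).card = 2 := by
      intro j hj
      obtain ⟨hj, hjK⟩ := Finset.mem_Icc.1 hj
      obtain ⟨e, f, hef, hlab, -⟩ := hbubble l hl j hj hjK
      have : (((Finset.range (2 * K + 1)).filter fun x =>
        1 ≤ κ.lineLabels l x).filter fun x => κ.lineLabels l x = j) = {e, f} := by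
        ext z
        simp only [Finset.mem_filter, Finset.mem_range, Finset.mem_insert, Finset.mem_singleton,
          ← hlab]
        constructor
        · exact fun h => h.2
        · intro h
          refine ⟨⟨?_, by omega⟩, h⟩
          by_contra hcon
          rw [lineLabels, if_neg (by omega)] at h
          omega
      rw [this, Finset.card_pair hef.ne]
    rw [Finset.sum_congr rfl h2] at h1
    have h3 : ((Finset.range (2 * K + 1)).filter fun x => 1 ≤ κ.lineLabels l x) ⊆
        ((Finset.range (2 * K + 1)).erase a).erase x := by
      intro z hz
      simp only [Finset.mem_filter, Finset.mem_range, Finset.mem_erase] at hz ⊢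
      refine ⟨?_, ?_, hz.1⟩
      · rintro rfl; omega
      · rintro rfl
        have := hzero l
        omega
    have h4 := Finset.card_le_card h3
    rw [Finset.card_erase_of_mem (by simp; omega), Finset.card_erase_of_mem (by simp; omega)] at h4
    simp at h1 h4
    omega
  refine ⟨fun l hl => ⟨⟨hle l hl, fun x hx => ?_, ⟨a, by omega, fun x hx => ⟨hcut l hl x hx, ?_⟩⟩,
    hbubble l hl⟩, hzero l⟩, fun l hl l' hl' h => ?_, fun l hl => ?_⟩
  · rw [lineLabels, if_neg (by omega)]
  · rintro rfl; exact hzero l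
  · funext e
    by_cases he : ∃ v w, (pairedDiagram κ).src e = Sum.inr v ∧ (pairedDiagram κ).tgt e = Sum.inr w
    · obtain ⟨v, w, hv, hw⟩ := he
      obtain ⟨x, hx, hxa, rfl⟩ := κ.exists_edgeAt hv hw
      have := congrFun h x
      rwa [lineLabels, lineLabels, if_pos ⟨hx, hxa⟩, if_pos ⟨hx, hxa⟩] at this
    · have h1 : l e = 0 := Nat.eq_zero_of_not_pos fun h =>
        he (FeynmanDiagram.internal_of_mem_bubbleLabellings hl h)
      have h2 : l' e = 0 := Nat.eq_zero_of_not_pos fun h =>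
        he (FeynmanDiagram.internal_of_mem_bubbleLabellings hl' h)
      rw [h1, h2]
  · obtain ⟨hl, hla⟩ := hl
    obtain ⟨l', hl', hl'0⟩ : ∃ l' : (pairedDiagram κ).E → ℕ,
        (∀ x < a + b + 1, x ≠ a → l' (κ.edgeAt x) = l x) ∧
        ∀ e, (¬ ∃ x < a + b + 1, x ≠ a ∧ κ.edgeAt x = e) → l' e = 0 := by
      refine ⟨fun e => if h : ∃ x < a + b + 1, x ≠ a ∧ κ.edgeAt x = e then l h.choose else 0,
        fun x hx hxa => ?_, fun e he => dif_neg he⟩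
      have h : ∃ y < a + b + 1, y ≠ a ∧ κ.edgeAt y = κ.edgeAt x := ⟨x, hx, hxa, rfl⟩
      refine (dif_pos h).trans ?_
      rw [κ.edgeAt_injective h.choose_spec.1 h.choose_spec.2.1 hx hxa h.choose_spec.2.2]
    have hL : κ.lineLabels l' = l := by
      funext x
      unfold lineLabels
      split_ifs with hx
      · exact hl' x hx.1 hx.2
      · by_cases hxa : x = a
        · rw [hxa, hla]
        · exact (hl.out x (by omega)).symm
    refine ⟨l', ⟨fun e => ?_, fun j hj hjK => ?_⟩, hL⟩
    · by_cases he : ∃ x < a + b + 1, x ≠ a ∧ κ.edgeAt x = e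
      · obtain ⟨x, hx, hxa, rfl⟩ := he
        rw [hl' x hx hxa]
        exact hl.le x
      · rw [hl'0 e he]; omega
    · obtain ⟨x, y, hxy, hlab, hE⟩ := hl.bubble j hj hjK
      have hdom : ∀ z, l z = j → z < a + b + 1 ∧ z ≠ a := by
        intro z hz
        constructor
        · by_contra hcon
          have := hl.out z (by omega)
          omega
        · rintro rfl; omega
      obtain ⟨hx, hxa⟩ := hdom x ((hlab x).2 (Or.inl rfl))
      obtain ⟨hy, hya⟩ := hdom y ((hlab y).2 (Or.inr rfl))
      refine ⟨κ.edgeAt x, κ.edgeAt y, fun h => hxy.ne (κ.edgeAt_injective hx hxa hy hya h),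
        fun e => ?_, ?_⟩
      · by_cases he : ∃ x < a + b + 1, x ≠ a ∧ κ.edgeAt x = e
        · obtain ⟨z, hz, hza, rfl⟩ := he
          rw [hl' z hz hza, hlab]
          constructor
          · rintro (rfl | rfl) <;> simp
          · rintro (h | h)
            · exact Or.inl (κ.edgeAt_injective hz hza hx hxa h)
            · exact Or.inr (κ.edgeAt_injective hz hza hy hya h)
        · rw [hl'0 e he]
          constructor
          · omega
          · rintro (rfl | rfl)
            · exact absurd ⟨x, hx, hxa, rfl⟩ he
            · exact absurd ⟨y, hy, hya, rfl⟩ he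
      · rw [bubbleMod_iff hK hx hxa hy hya, hL]
        exact hE

end Pairing

end

section

/-! ### The sum of the variance constants -/

theorem ncard_extractionSequences_pairedDiagram {a b K : ℕ} (hK : a + b = 2 * K)
    (κ : Pairing (a + 1) (b + 1)) : (pairedDiagram κ).extractionSequences.ncard =
      {l | IsLabelling K κ.lineMatching l ∧ l a = 0}.ncard := by
  have hV : Nat.card (pairedDiagram κ).V = K + 1 := by
    have := κ.two_mul_card
    omega
  rw [FeynmanDiagram.extractionSequences_ncard hV, ← Nat.card_coe_set_eq, ← Nat.card_coe_set_eq]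
  exact Nat.card_congr (κ.bijOn_lineLabels hK).equiv

instance (n m : ℕ) : Fintype (Pairing n m) := Fintype.ofFinite _

theorem sum_ncard_extractionSequences {a b K : ℕ} (hK : a + b = 2 * K) :
    ∑ κ : Pairing (a + 1) (b + 1), (pairedDiagram κ).extractionSequences.ncard =
      {c ∈ lineConfigs K | c.2 a = 0}.ncard := by
  have hfin : ∀ κ : Pairing (a + 1) (b + 1),
      {l | IsLabelling K κ.lineMatching l ∧ l a = 0}.Finite := by
    intro κ
    refine ((finite_lineConfigs K).image Prod.snd).subset ?_
    rintro l ⟨hl, -⟩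
    exact ⟨(κ.lineMatching, l), ⟨Pairing.isMatching_lineMatching hK κ, hl⟩, rfl⟩
  have : Nat.card (Σ κ : Pairing (a + 1) (b + 1),
      {l | IsLabelling K κ.lineMatching l ∧ l a = 0}) =
      Nat.card {c ∈ lineConfigs K | c.2 a = 0} := by
    refine Nat.card_congr (Equiv.ofBijective (fun p => ⟨(p.1.lineMatching, p.2.1),
      ⟨Pairing.isMatching_lineMatching hK p.1, p.2.2.1⟩, p.2.2.2⟩) ⟨?_, ?_⟩)
    · rintro ⟨κ, l, hl⟩ ⟨κ', l', hl'⟩ h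
      have h := congrArg Subtype.val h
      obtain ⟨h1, rfl⟩ := Prod.mk.inj h
      obtain rfl := Pairing.lineMatching_injective h1
      rfl
    · rintro ⟨⟨k, l⟩, ⟨hk, hl⟩, hla⟩
      obtain ⟨κ, rfl⟩ := Pairing.exists_lineMatching hK hk
      exact ⟨⟨κ, l, hl, hla⟩, rfl⟩
  have hf : ∀ κ : Pairing (a + 1) (b + 1),
      Finite {l | IsLabelling K κ.lineMatching l ∧ l a = 0} := fun κ => (hfin κ).to_subtype
  rw [Nat.card_sigma] at this
  rw [← Nat.card_coe_set_eq, ← this]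
  refine Finset.sum_congr rfl fun κ _ => ?_
  rw [ncard_extractionSequences_pairedDiagram hK, Nat.card_coe_set_eq]

/-- A labelled line has exactly one edge of label `0`, so it arises from exactly one way of cutting
the line into two trees. Only the sum over all cuts is computed; the individual numbers are not
needed. -/
theorem sum_antidiagonal_ncard_extractionSequences (K : ℕ) :
    ∑ p ∈ Finset.HasAntidiagonal.antidiagonal (2 * K), ∑ κ : Pairing (p.1 + 1) (p.2 + 1),
      (pairedDiagram κ).extractionSequences.ncard = 4 ^ K * K.factorial := by
  classical
  have h1 : ∑ p ∈ Finset.HasAntidiagonal.antidiagonal (2 * K), ∑ κ : Pairing (p.1 + 1) (p.2 + 1),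
      (pairedDiagram κ).extractionSequences.ncard =
      ∑ p ∈ Finset.HasAntidiagonal.antidiagonal (2 * K), {c ∈ lineConfigs K | c.2 p.1 = 0}.ncard :=
    Finset.sum_congr rfl fun p hp => sum_ncard_extractionSequences (Finset.HasAntidiagonal.mem_antidiagonal.1 hp)
  rw [h1, ← ncard_lineConfigs, Finset.Nat.sum_antidiagonal_eq_sum_range_succ_mk]
  set C := (finite_lineConfigs K).toFinset with hC
  have hmem : ∀ c, c ∈ C ↔ c ∈ lineConfigs K := fun c => Set.Finite.mem_toFinset _
  have h2 : ∀ a, {c ∈ lineConfigs K | c.2 a = 0}.ncard = (C.filter fun c => c.2 a = 0).card := by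
    intro a
    rw [← Set.ncard_coe_finset]
    congr 1
    ext c
    simp [hmem]
  simp only [h2]
  rw [Set.ncard_eq_toFinset_card _ (finite_lineConfigs K), ← Finset.card_biUnion]
  · congr 1
    ext c
    simp only [Finset.mem_biUnion, Finset.mem_range, Finset.mem_filter, hmem]
    constructor
    · rintro ⟨a, -, hc, -⟩
      exact (hmem c).2 hc
    · intro hc
      have hc := (hmem c).1 hc
      obtain ⟨a, ha, ha'⟩ := hc.2.cut
      exact ⟨a, by omega, hc, (ha' a ha).2 rfl⟩
  · intro x hx y hy hxy
    rw [Function.onFun, Finset.disjoint_left]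
    intro c hc hc'
    rw [Finset.mem_filter, hmem] at hc hc'
    obtain ⟨a, ha, ha'⟩ := hc.1.2.cut
    have hx := Finset.mem_coe.1 hx
    have hy := Finset.mem_coe.1 hy
    rw [Finset.mem_range] at hx hy
    exact hxy (((ha' x (by omega)).1 hc.2).trans ((ha' y (by omega)).1 hc'.2).symm)

end

section

namespace FeynmanDiagram
variable {L : Type} {Γ : FeynmanDiagram L}

/-! ### Diagrams made of bubbles need no renormalisation -/

/-- The number of components of the diagram with edges `X` that meet a set of vertices. -/
def classCount (Γ : FeynmanDiagram L) (X : Set Γ.E) (A : Set Γ.V) : ℕ :=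
  (Quot.mk (Γ.edgeRel X) '' A).ncard

theorem classCount_eq_image {X Y : Set Γ.E} (h : X ⊆ Y) (A : Set Γ.V) :
    ∃ φ : Quot (Γ.edgeRel X) → Quot (Γ.edgeRel Y),
      (∀ v, φ (Quot.mk _ v) = Quot.mk _ v) ∧
      Γ.classCount Y A = (φ '' (Quot.mk (Γ.edgeRel X) '' A)).ncard := by
  refine ⟨Quot.map id fun v w ⟨e, he, h'⟩ => ⟨e, h he, h'⟩, fun v => rfl, ?_⟩
  rw [Set.image_image]
  rfl

theorem classCount_mono {X Y : Set Γ.E} (h : X ⊆ Y) (A : Set Γ.V) :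
    Γ.classCount Y A ≤ Γ.classCount X A := by
  obtain ⟨φ, -, h⟩ := classCount_eq_image h A
  rw [h]
  exact Set.ncard_image_le (Set.toFinite _)

theorem classCount_lt {X Y : Set Γ.E} (h : X ⊆ Y) {A : Set Γ.V} {v w : Γ.V} (hv : v ∈ A)
    (hw : w ∈ A) (hX : ¬ Relation.EqvGen (Γ.edgeRel X) v w)
    (hY : Relation.EqvGen (Γ.edgeRel Y) v w) : Γ.classCount Y A < Γ.classCount X A := by
  refine lt_of_le_of_ne (classCount_mono h A) fun heq => hX ?_
  obtain ⟨φ, hφ, h⟩ := classCount_eq_image h A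
  rw [h] at heq
  have hinj := Set.injOn_of_ncard_image_eq heq (Set.toFinite _)
  apply Quot.eqvGen_exact
  apply hinj (Set.mem_image_of_mem _ hv) (Set.mem_image_of_mem _ hw)
  rw [hφ, hφ]
  exact Quot.eqvGen_sound hY

/-- Follow the extraction inside `γ`. A step adds at most two edges of `γ`, and if it adds any, it
merges two components that meet `γ`. So the number of edges plus twice the number of components
never exceeds its initial value, twice the number of vertices, and at the end at least one component
is left. -/
theorem Sub.ncard_edges_add_two_le {K : ℕ} {l : Γ.E → ℕ} (hl : l ∈ Γ.bubbleLabellings K)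
    (hpos : ∀ e v w, Γ.src e = Sum.inr v → Γ.tgt e = Sum.inr w → 0 < l e) (γ : Sub Γ)
    (hγ : γ.verts.Nonempty) : γ.edges.ncard + 2 ≤ 2 * γ.verts.ncard := by
  have key : ∀ i ≤ K, {e ∈ γ.edges | K - i < l e}.ncard +
      2 * Γ.classCount {e | K - i < l e} γ.verts ≤ 2 * γ.verts.ncard := by
    intro i
    induction i with
    | zero =>
      intro _
      have h1 : {e ∈ γ.edges | K - 0 < l e} = ∅ := by
        ext e
        have := hl.1 e
        simp; omega
      rw [h1, Set.ncard_empty, zero_add]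
      exact Nat.mul_le_mul_left 2 (Set.ncard_image_le (Set.toFinite _))
    | succ i ih =>
      intro hi
      have ih := ih (by omega)
      obtain ⟨e, f, hef, hlab, v, w, v', w', hv, hw, hv', hw', hne, hm⟩ :=
        hl.2 (K - i) (by omega) (by omega)
      have hX : {x | K - i < l x} ⊆ {x | K - (i + 1) < l x} := by
        intro x hx
        rw [Set.mem_ofPred_eq] at hx ⊢
        omega
      have hsub : {x ∈ γ.edges | K - (i + 1) < l x} ⊆
          {x ∈ γ.edges | K - i < l x} ∪ ({e, f} ∩ γ.edges) := by
        rintro x ⟨hx, hx'⟩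
        by_cases h : K - i < l x
        · exact Or.inl ⟨hx, h⟩
        · exact Or.inr ⟨(hlab x).1 (by omega), hx⟩
      have hc := (Set.ncard_le_ncard hsub (Set.toFinite _)).trans (Set.ncard_union_le _ _)
      have hmem : ∀ x a b, x ∈ γ.edges → Γ.src x = Sum.inr a → Γ.tgt x = Sum.inr b →
          a ∈ γ.verts ∧ b ∈ γ.verts := fun x a b hx ha hb =>
        ⟨γ.endpoints_subset ⟨x, hx, Or.inl ha⟩, γ.endpoints_subset ⟨x, hx, Or.inr hb⟩⟩
      have hlt : ∀ x, x ∈ ({e, f} : Set Γ.E) ∩ γ.edges →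
          Γ.classCount {x | K - (i + 1) < l x} γ.verts <
            Γ.classCount {x | K - i < l x} γ.verts := by
        rintro x ⟨hx, hxγ⟩
        have hlx : K - (i + 1) < l x := by
          have := (hlab x).2 hx
          omega
        rcases hx with rfl | rfl
        · obtain ⟨h1, h2⟩ := hmem _ v w hxγ hv hw
          exact classCount_lt hX h1 h2 hne (.rel _ _ ⟨x, hlx, hv, hw⟩)
        · obtain ⟨h1, h2⟩ := hmem _ v' w' hxγ hv' hw'
          refine classCount_lt hX h1 h2 (fun h => hne ?_) (.rel _ _ ⟨x, hlx, hv', hw'⟩)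
          have heq := Relation.EqvGen.is_equivalence (Γ.edgeRel {x | K - i < l x})
          rcases hm with ⟨h3, h4⟩ | ⟨h3, h4⟩
          · exact heq.trans h3 (heq.trans h (heq.symm h4))
          · exact heq.trans h3 (heq.trans (heq.symm h) (heq.symm h4))
      have hmono := classCount_mono hX γ.verts
      rcases (({e, f} : Set Γ.E) ∩ γ.edges).eq_empty_or_nonempty with h0 | ⟨x, hx⟩
      · rw [h0, Set.ncard_empty] at hc
        omega
      · have := hlt x hx
        have h2 := (Set.ncard_le_ncard (Set.inter_subset_left (s := {e, f}) (t := γ.edges))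
          (Set.toFinite _)).trans (Set.ncard_insert_le e {f})
        rw [Set.ncard_singleton] at h2
        omega
  have h := key K le_rfl
  have h1 : {e ∈ γ.edges | K - K < l e} = γ.edges := by
    ext e
    refine ⟨fun h => h.1, fun he => ⟨he, ?_⟩⟩
    obtain ⟨v, -, hv⟩ := γ.src_mem e he
    obtain ⟨w, -, hw⟩ := γ.tgt_mem e he
    have := hpos e v w hv hw
    omega
  have h2 : 0 < Γ.classCount {e | K - K < l e} γ.verts :=
    (Set.ncard_pos (Set.toFinite _)).2 (hγ.image _)
  rw [h1] at h
  omega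

/-- With `v` vertices and `e` edges, `e + 2 ≤ 2 v` says precisely that the degree `4 (v - 1) - 2 e`
is nonnegative. -/
theorem not_divergent {K : ℕ} {l : Γ.E → ℕ} (hl : l ∈ Γ.bubbleLabellings K)
    (hpos : ∀ e v w, Γ.src e = Sum.inr v → Γ.tgt e = Sum.inr w → 0 < l e) (γ : Sub Γ) :
    ¬ γ.Divergent := by
  rintro ⟨⟨hne, -⟩, -, hdeg⟩
  have := γ.ncard_edges_add_two_le hl hpos hne
  unfold Sub.deg at hdeg
  omega

theorem val_contract_empty (k : T4 → ℝ) (Γ : FeynmanDiagram L) (x : L → T4) :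
    (Γ.contract (Sub.sUnion ∅)).val k x = Γ.val k x := by
  classical
  have hadj : ∀ v w, ¬ (Sub.sUnion ∅ : Sub Γ).Adj v w := by
    rintro v w ⟨e, he, -⟩
    rw [sUnion_empty.2] at he
    exact he
  have hinj : Function.Injective (Γ.proj (Sub.sUnion ∅)) := by
    intro v w h
    replace h := (proj_eq_iff _ v w).1 h
    induction h with
    | rel v w h => exact absurd h (hadj v w)
    | refl v => rfl
    | symm v w _ ih => exact ih.symm
    | trans u v w _ _ ih₁ ih₂ => exact ih₁.trans ih₂
  let σ : Γ.V ≃ (Γ.contract (Sub.sUnion ∅)).V :=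
    Equiv.ofBijective (Γ.proj (Sub.sUnion ∅)) ⟨hinj, Quot.mk_surjective⟩
  let τ : (Γ.contract (Sub.sUnion ∅)).E ≃ Γ.E :=
    Equiv.subtypeUnivEquiv fun e => by rw [sUnion_empty.2]; exact fun h => h
  unfold val
  rw [← (volume_measurePreserving_piCongrLeft (fun _ => T4) σ).integral_comp'
    (g := fun z => ∏ e, k (Sum.elim x z ((Γ.contract (Sub.sUnion ∅)).tgt e) -
      Sum.elim x z ((Γ.contract (Sub.sUnion ∅)).src e)))]
  congr 1
  funext z
  have key : ∀ u : L ⊕ Γ.V, Sum.elim x ((MeasurableEquiv.piCongrLeft (fun _ => T4) σ) z)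
      (Sum.map id (Γ.proj (Sub.sUnion ∅)) u) = Sum.elim x z u := by
    rintro (u | u)
    · rfl
    · exact Equiv.piCongrLeft_apply_apply (fun _ => T4) σ z u
  refine Fintype.prod_equiv τ _ _ fun e => ?_
  have h1 := key (Γ.tgt (τ e))
  have h2 := key (Γ.src (τ e))
  rw [← h1, ← h2]
  rfl

/-- Without divergent subdiagrams the empty forest is the only one. -/
theorem renVal_eq_val {K : ℕ} {l : Γ.E → ℕ} (hl : l ∈ Γ.bubbleLabellings K)
    (hpos : ∀ e v w, Γ.src e = Sum.inr v → Γ.tgt e = Sum.inr w → 0 < l e) (k : T4 → ℝ)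
    (x : L → T4) : Γ.renVal k x = Γ.val k x := by
  have h : {F : Set (Sub Γ) | IsForest F} = {∅} := by
    ext F
    simp only [Set.mem_ofPred_eq, Set.mem_singleton_iff]
    constructor
    · intro hF
      exact Set.eq_empty_of_forall_notMem fun γ hγ => not_divergent hl hpos γ (hF.1 γ hγ)
    · rintro rfl
      exact ⟨by simp, by simp⟩
  unfold renVal
  rw [h, finsum_mem_singleton, Set.ncard_empty, pow_zero, one_mul, forestVal, val_contract_empty]
  simp

end FeynmanDiagram

namespace Pairing

theorem pos_of_internal {a b K : ℕ} (hK : a + b = 2 * K) (κ : Pairing (a + 1) (b + 1))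
    {l : (pairedDiagram κ).E → ℕ} (hl : l ∈ (pairedDiagram κ).bubbleLabellings K)
    (e : (pairedDiagram κ).E) (v w : (pairedDiagram κ).V)
    (hv : (pairedDiagram κ).src e = Sum.inr v) (hw : (pairedDiagram κ).tgt e = Sum.inr w) :
    0 < l e := by
  obtain ⟨x, hx, hxa, rfl⟩ := κ.exists_edgeAt hv hw
  obtain ⟨h1, h2⟩ := (κ.bijOn_lineLabels hK).mapsTo hl
  obtain ⟨c, hc, hc'⟩ := h1.cut
  have hac := (hc' a (by omega)).1 h2
  have hx0 := (hc' x (by omega)).not.2 (by omega)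
  rw [lineLabels, if_pos ⟨hx, hxa⟩] at hx0
  omega

end Pairing

end

section

/-! ### Lower bound on the valuation of a diagram made of bubbles -/

open scoped ENNReal

theorem measurable_sub_eval {V : Type*} (a b : V) :
    Measurable fun z : V → T4 => z b - z a :=
  (measurable_pi_apply b).sub (measurable_pi_apply a)

/-- The increments along the edges `(p i, q i)` of a forest are independent. -/
theorem lintegral_prod_increments {V : Type*} [Fintype V] (p q : ℕ → V) (r : ℕ → V → V → Prop)
    (hr : ∀ i, Equivalence (r i)) (F : ℕ → T4 → ℝ≥0∞) (hF : ∀ i, Measurable (F i)) (K : ℕ)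
    (hne : ∀ i < K, ¬ r i (p i) (q i)) (hlt : ∀ i < K, ∀ j < i, r i (p j) (q j)) :
    volume (Set.univ : Set T4) ^ K *
      ∫⁻ z : V → T4, ∏ i ∈ Finset.range K, F i (z (q i) - z (p i)) =
    volume (Set.univ : Set (V → T4)) * ∏ i ∈ Finset.range K, ∫⁻ w, F i w := by
  classical
  induction K with
  | zero => simp
  | succ K ih =>
    have ih := ih (fun i hi => hne i (by omega)) (fun i hi => hlt i (by omega))
    set H : (V → T4) → ℝ≥0∞ := fun z => ∏ i ∈ Finset.range K, F i (z (q i) - z (p i)) with hH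
    have hHm : Measurable H :=
      Finset.measurable_prod _ fun i _ => (hF i).comp (measurable_sub_eval _ _)
    -- Translate all variables in the `r K`-class of `q K` by `u`. The ends of an earlier increment
    -- lie in one class, so that increment is unchanged, while the last one is shifted by `u`.
    let s : T4 → V → T4 := fun u v => if r K v (q K) then u else 0
    have hshift : ∀ u : T4, ∫⁻ z : V → T4, H z * F K (z (q K) - z (p K)) =
        ∫⁻ z : V → T4, H z * F K (z (q K) - z (p K) + u) := by
      intro u
      rw [← lintegral_add_left_eq_self _ (s u)]
      refine lintegral_congr fun z => ?_
      have h1 : H (s u + z) = H z := by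
        refine Finset.prod_congr rfl fun i hi => ?_
        have hi := hlt K (by omega) i (Finset.mem_range.1 hi)
        have : r K (p i) (q K) ↔ r K (q i) (q K) :=
          ⟨fun h => (hr K).trans ((hr K).symm hi) h, fun h => (hr K).trans hi h⟩
        simp only [Pi.add_apply, s, this]
        congr 1
        abel
      have h2 : (s u + z) (q K) - (s u + z) (p K) = z (q K) - z (p K) + u := by
        have h3 : r K (q K) (q K) := (hr K).refl _
        have h4 := hne K (by omega)
        simp only [Pi.add_apply, s, h3, h4, if_true, if_false]
        abel
      rw [h1, h2]
    have hjoint : Measurable fun x : T4 × (V → T4) => H x.2 * F K (x.2 (q K) - x.2 (p K) + x.1) :=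
      (hHm.comp measurable_snd).mul ((hF K).comp
        (((measurable_sub_eval (p K) (q K)).comp measurable_snd).add measurable_fst))
    -- Averaging over the shift `u` frees the last increment from the others.
    have hmain : volume (Set.univ : Set T4) * ∫⁻ z : V → T4, H z * F K (z (q K) - z (p K)) =
        (∫⁻ z, H z) * ∫⁻ w, F K w := by
      calc volume (Set.univ : Set T4) * ∫⁻ z : V → T4, H z * F K (z (q K) - z (p K))
          = ∫⁻ _u : T4, ∫⁻ z : V → T4, H z * F K (z (q K) - z (p K)) := by
            rw [lintegral_const, mul_comm]
        _ = ∫⁻ u : T4, ∫⁻ z : V → T4, H z * F K (z (q K) - z (p K) + u) :=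
            lintegral_congr fun u => hshift u
        _ = ∫⁻ z : V → T4, ∫⁻ u : T4, H z * F K (z (q K) - z (p K) + u) :=
            lintegral_lintegral_swap hjoint.aemeasurable
        _ = ∫⁻ z : V → T4, H z * ∫⁻ w, F K w := by
            refine lintegral_congr fun z => ?_
            rw [lintegral_const_mul _ (show Measurable fun u => F K (z (q K) - z (p K) + u) from
              (hF K).comp (measurable_const_add _))]
            congr 1
            exact lintegral_add_left_eq_self _ _
        _ = (∫⁻ z, H z) * ∫⁻ w, F K w := lintegral_mul_const _ hHm
    simp only [Finset.prod_range_succ]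
    rw [pow_succ, mul_assoc, hmain, ← mul_assoc, ih, mul_assoc]

/-- The dyadic annulus between the radii `2⁻ᵇ` and `2⁻ᵃ`. -/
def annulus (a b : ℕ) : Set T4 := {w | (2 ^ b : ℝ)⁻¹ < ‖w‖ ∧ ‖w‖ ≤ (2 ^ a : ℝ)⁻¹}

theorem measurableSet_annulus (a b : ℕ) : MeasurableSet (annulus a b) :=
  (measurableSet_lt measurable_const measurable_norm).inter
    (measurableSet_le measurable_norm measurable_const)

theorem volume_closedBall_T4 {r : ℝ} (hr : 0 ≤ r) (hr' : r ≤ Real.pi) :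
    volume (Metric.closedBall (0 : T4) r) = ENNReal.ofReal ((2 * r) ^ 4) := by
  rw [closedBall_pi _ hr, volume_pi_pi]
  simp only [Pi.zero_apply, AddCircle.volume_closedBall]
  rw [min_eq_right (by linarith)]
  simp [ENNReal.ofReal_pow (by linarith : 0 ≤ 2 * r)]

/-- With `r = 2⁻ᵃ`, balls being cubes, the shell has volume `(2 r)⁴ - r⁴ = 15 r⁴`, and the integrand
is at least `r⁻⁴` there. -/
theorem one_le_lintegral_annulus (a : ℕ) :
    1 ≤ ∫⁻ w in annulus a (a + 1), ENNReal.ofReal ((‖w‖ ^ 4)⁻¹) := by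
  have hball : annulus a (a + 1) =
      Metric.closedBall 0 (2 ^ a : ℝ)⁻¹ \ Metric.closedBall 0 (2 ^ (a + 1) : ℝ)⁻¹ := by
    ext w
    simp [annulus, and_comm]
  have hle : ((2 : ℝ) ^ a)⁻¹ ≤ 1 := inv_le_one_of_one_le₀ (one_le_pow₀ (by norm_num))
  have hle' : ((2 : ℝ) ^ (a + 1))⁻¹ ≤ 1 := inv_le_one_of_one_le₀ (one_le_pow₀ (by norm_num))
  have hpi := Real.pi_gt_three
  have hpos : (0 : ℝ) < (2 ^ a)⁻¹ := by positivity
  have hhalf : ((2 : ℝ) ^ (a + 1))⁻¹ = (2 ^ a)⁻¹ / 2 := by rw [pow_succ]; field_simp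
  have hvol : volume (annulus a (a + 1)) =
      ENNReal.ofReal (15 * ((2 : ℝ) ^ a)⁻¹ ^ 4) := by
    rw [hball, measure_sdiff (Metric.closedBall_subset_closedBall (by rw [hhalf]; linarith))
      Metric.isClosed_closedBall.measurableSet.nullMeasurableSet (measure_ne_top _ _),
      volume_closedBall_T4 hpos.le (by linarith), volume_closedBall_T4 (by positivity) (by linarith),
      ← ENNReal.ofReal_sub _ (by positivity), hhalf]
    congr 1
    ring
  calc (1 : ℝ≥0∞) ≤ ENNReal.ofReal 15 := by simp
    _ = ∫⁻ w in annulus a (a + 1), ENNReal.ofReal ((((2 : ℝ) ^ a)⁻¹ ^ 4)⁻¹) := by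
        rw [setLIntegral_const, hvol, ← ENNReal.ofReal_mul (by positivity)]
        congr 1
        field_simp
    _ ≤ _ := by
        refine setLIntegral_mono' (measurableSet_annulus _ _) fun w hw => ?_
        apply ENNReal.ofReal_le_ofReal
        have : 0 < ‖w‖ := lt_trans (by positivity) hw.1
        exact inv_anti₀ (by positivity) (pow_le_pow_left₀ this.le hw.2 4)

/-- Every dyadic shell contributes at least `1`: this is the logarithmic divergence of `∫ ‖w‖⁻⁴` in
dimension four, the source of the powers of `log (1/ε)`. -/
theorem le_lintegral_annulus (a n : ℕ) :
    (n : ℝ≥0∞) ≤ ∫⁻ w in annulus a (a + n), ENNReal.ofReal ((‖w‖ ^ 4)⁻¹) := by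
  induction n with
  | zero => simp
  | succ n ih =>
    have hdisj : Disjoint (annulus a (a + n)) (annulus (a + n) (a + n + 1)) := by
      rw [Set.disjoint_left]
      intro w hw hw'
      exact absurd hw.1 (not_lt.2 hw'.2)
    have hsub : annulus a (a + n) ∪ annulus (a + n) (a + n + 1) ⊆ annulus a (a + (n + 1)) := by
      have h1 : ((2 : ℝ) ^ (a + (n + 1)))⁻¹ ≤ (2 ^ (a + n))⁻¹ :=
        inv_anti₀ (by positivity) (pow_le_pow_right₀ (by norm_num) (by omega))
      have h2 : ((2 : ℝ) ^ (a + n))⁻¹ ≤ (2 ^ a)⁻¹ :=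
        inv_anti₀ (by positivity) (pow_le_pow_right₀ (by norm_num) (by omega))
      rintro w (hw | hw)
      · exact ⟨h1.trans_lt hw.1, hw.2⟩
      · exact ⟨hw.1, hw.2.trans h2⟩
    calc ((n + 1 : ℕ) : ℝ≥0∞) = n + 1 := by push_cast; rfl
      _ ≤ (∫⁻ w in annulus a (a + n), ENNReal.ofReal ((‖w‖ ^ 4)⁻¹)) +
          ∫⁻ w in annulus (a + n) (a + n + 1), ENNReal.ofReal ((‖w‖ ^ 4)⁻¹) :=
          add_le_add ih (one_le_lintegral_annulus _)
      _ = ∫⁻ w in annulus a (a + n) ∪ annulus (a + n) (a + n + 1), ENNReal.ofReal ((‖w‖ ^ 4)⁻¹) :=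
          (lintegral_union (measurableSet_annulus _ _) hdisj).symm
      _ ≤ _ := lintegral_mono_set hsub

end

/-! ### Bubbles on nested scales -/

section

open scoped ENNReal

/-- Links between the class of `p` and the class of `q` can only merge these two classes; a path
that crosses twice is back in its class. -/
theorem eqvGen_of_merge {α : Type*} {R S : α → α → Prop} (hR : Equivalence R) {p q : α}
    (hS : ∀ v w, S v w → R v w ∨ (R v p ∧ R q w) ∨ (R v q ∧ R p w)) {v w : α}
    (h : Relation.EqvGen S v w) : R v w ∨ (R v p ∧ R q w) ∨ (R v q ∧ R p w) := by
  induction h with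
  | rel v w h => exact hS v w h
  | refl v => exact Or.inl (hR.refl v)
  | symm v w _ ih =>
    rcases ih with h | ⟨h, h'⟩ | ⟨h, h'⟩
    · exact Or.inl (hR.symm h)
    · exact Or.inr (Or.inr ⟨hR.symm h', hR.symm h⟩)
    · exact Or.inr (Or.inl ⟨hR.symm h', hR.symm h⟩)
  | trans u v w _ _ ih₁ ih₂ =>
    rcases ih₁ with h | ⟨h, h'⟩ | ⟨h, h'⟩ <;> rcases ih₂ with g | ⟨g, g'⟩ | ⟨g, g'⟩
    · exact Or.inl (hR.trans h g)
    · exact Or.inr (Or.inl ⟨hR.trans h g, g'⟩)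
    · exact Or.inr (Or.inr ⟨hR.trans h g, g'⟩)
    · exact Or.inr (Or.inl ⟨h, hR.trans h' g⟩)
    · exact Or.inr (Or.inl ⟨h, g'⟩)
    · exact Or.inl (hR.trans h g')
    · exact Or.inr (Or.inr ⟨h, hR.trans h' g⟩)
    · exact Or.inl (hR.trans h g')
    · exact Or.inr (Or.inr ⟨h, g'⟩)

theorem norm_T4_le (x : T4) : ‖x‖ ≤ 4 := by
  rw [pi_norm_le_iff_of_nonneg (by norm_num)]
  intro i
  have := AddCircle.norm_le_half_period (2 * Real.pi) (x := x i) (by positivity)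
  rw [abs_of_pos (by positivity)] at this
  have := Real.pi_lt_four
  linarith

namespace FeynmanDiagram
variable {L : Type} {Γ : FeynmanDiagram L}

theorem measurable_val_integrand {k : T4 → ℝ} (hk : Measurable k) :
    Measurable fun t : (L → T4) × (Γ.V → T4) =>
      ∏ e, k (Sum.elim t.1 t.2 (Γ.tgt e) - Sum.elim t.1 t.2 (Γ.src e)) := by
  have h : ∀ u : L ⊕ Γ.V, Measurable fun t : (L → T4) × (Γ.V → T4) => Sum.elim t.1 t.2 u := by
    rintro (u | u)
    · exact (measurable_pi_apply u).comp measurable_fst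
    · exact (measurable_pi_apply u).comp measurable_snd
  exact Finset.measurable_prod _ fun e _ => hk.comp ((h _).sub (h _))

theorem abs_val_integrand_le {k : T4 → ℝ} {B : ℝ} (hB : ∀ x, |k x| ≤ B) (x : L → T4)
    (z : Γ.V → T4) :
    ‖∏ e, k (Sum.elim x z (Γ.tgt e) - Sum.elim x z (Γ.src e))‖ ≤ B ^ Fintype.card Γ.E := by
  rw [norm_prod, ← Finset.card_univ, ← Finset.prod_const]
  exact Finset.prod_le_prod (fun e _ => norm_nonneg _) fun e _ => hB _

theorem integrable_val_integrand {k : T4 → ℝ} (hk : Measurable k) {B : ℝ} (hB : ∀ x, |k x| ≤ B)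
    (x : L → T4) : Integrable fun z : Γ.V → T4 =>
      ∏ e, k (Sum.elim x z (Γ.tgt e) - Sum.elim x z (Γ.src e)) :=
  Integrable.of_bound
    ((measurable_val_integrand hk).comp measurable_prodMk_left).aestronglyMeasurable _
    (Eventually.of_forall fun z => abs_val_integrand_le hB x z)

theorem integrable_val [Fintype L] {k : T4 → ℝ} (hk : Measurable k) {B : ℝ}
    (hB : ∀ x, |k x| ≤ B) : Integrable fun x : L → T4 => Γ.val k x := by
  refine Integrable.of_bound ?_ (B ^ Fintype.card Γ.E * volume.real (Set.univ : Set (Γ.V → T4)))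
    (Eventually.of_forall fun x => ?_)
  · exact (measurable_val_integrand hk).stronglyMeasurable.integral_prod_right.aestronglyMeasurable
  · exact norm_integral_le_of_norm_le_const
      (Eventually.of_forall fun z => abs_val_integrand_le hB x z)

/-- The edges of a labelled diagram merge its vertices step by step. -/
theorem exists_merges [Nonempty Γ.V] {K : ℕ} {l : Γ.E → ℕ} (hl : l ∈ Γ.bubbleLabellings K) :
    ∃ p q : ℕ → Γ.V, ∀ i < K, ∃ e f p' q', e ≠ f ∧ (∀ x, l x = K - i ↔ x = e ∨ x = f) ∧
      Γ.src e = Sum.inr (p i) ∧ Γ.tgt e = Sum.inr (q i) ∧ Γ.src f = Sum.inr p' ∧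
      Γ.tgt f = Sum.inr q' ∧
      ¬ Relation.EqvGen (Γ.edgeRel {x | K - i < l x}) (p i) (q i) ∧
      ((Relation.EqvGen (Γ.edgeRel {x | K - i < l x}) (p i) p' ∧
        Relation.EqvGen (Γ.edgeRel {x | K - i < l x}) (q i) q') ∨
      (Relation.EqvGen (Γ.edgeRel {x | K - i < l x}) (p i) q' ∧
        Relation.EqvGen (Γ.edgeRel {x | K - i < l x}) (q i) p')) := by
  have : ∀ i, ∃ v w, i < K → ∃ e f p' q', e ≠ f ∧ (∀ x, l x = K - i ↔ x = e ∨ x = f) ∧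
      Γ.src e = Sum.inr v ∧ Γ.tgt e = Sum.inr w ∧ Γ.src f = Sum.inr p' ∧ Γ.tgt f = Sum.inr q' ∧
      ¬ Relation.EqvGen (Γ.edgeRel {x | K - i < l x}) v w ∧
      ((Relation.EqvGen (Γ.edgeRel {x | K - i < l x}) v p' ∧
        Relation.EqvGen (Γ.edgeRel {x | K - i < l x}) w q') ∨
      (Relation.EqvGen (Γ.edgeRel {x | K - i < l x}) v q' ∧
        Relation.EqvGen (Γ.edgeRel {x | K - i < l x}) w p')) := by
    intro i
    by_cases hi : i < K
    · obtain ⟨e, f, hef, hlab, v, w, v', w', hv, hw, hv', hw', hne, hm⟩ :=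
        hl.2 (K - i) (by omega) (by omega)
      exact ⟨v, w, fun _ => ⟨e, f, v', w', hef, hlab, hv, hw, hv', hw', hne, hm⟩⟩
    · exact ⟨Classical.arbitrary _, Classical.arbitrary _, fun h => absurd h hi⟩
  choose p q h using this
  exact ⟨p, q, h⟩

/-- If the kernel is at least `c ‖x‖⁻²` down to the scale `2 ^ (- K N)`, then the valuation of a
diagram made of `K` bubbles is at least a multiple of `N ^ K`. -/
theorem exists_le_val [Nonempty Γ.V] {K : ℕ} {l : Γ.E → ℕ} (hl : l ∈ Γ.bubbleLabellings K)
    {c : ℝ} (hc : 0 < c) : ∃ C > 0, ∀ (k : T4 → ℝ) (B ε : ℝ) (N : ℕ) (x : L → T4),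
      Measurable k → (∀ x, |k x| ≤ B) → ε ≤ (2 ^ (K * N) : ℝ)⁻¹ →
      (∀ x r, ε ≤ r → ‖x‖ ≤ r → c / r ^ 2 ≤ k x) → C * (N : ℝ) ^ K ≤ Γ.val k x := by
  classical
  obtain ⟨p, q, hpq⟩ := exists_merges hl
  set n₀ := (Finset.univ.filter fun e : Γ.E => l e = 0).card
  -- Edges of label `0` are bounded by the diameter of the torus, which is at most `4`. Both edges
  -- of a bubble have length at most `2 ^ K` times its increment, as shown below.
  set C₀ : ℝ := (c / 4 ^ 2) ^ n₀ * ((c / (2 ^ K) ^ 2) ^ 2) ^ K with hC₀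
  have hC₀pos : 0 < C₀ := by positivity
  set v₀ := volume (Set.univ : Set T4) with hv₀
  set v₁ := volume (Set.univ : Set (Γ.V → T4)) with hv₁
  have hv₀top : v₀ ≠ ∞ := measure_ne_top _ _
  have hv₁top : v₁ ≠ ∞ := measure_ne_top _ _
  have hv₀pos : v₀ ≠ 0 := (Measure.measure_univ_ne_zero).2 (NeZero.ne _)
  have hv₁pos : v₁ ≠ 0 := (Measure.measure_univ_ne_zero).2 (NeZero.ne _)
  refine ⟨C₀ * (v₁.toReal / v₀.toReal ^ K), mul_pos hC₀pos (div_pos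
    (ENNReal.toReal_pos hv₁pos hv₁top) (pow_pos (ENNReal.toReal_pos hv₀pos hv₀top) _)), ?_⟩
  intro k B ε N x hk hB hε hker
  have hε1 : ε ≤ 1 := hε.trans (inv_le_one_of_one_le₀ (one_le_pow₀ (by norm_num)))
  have hk0 : ∀ y, c / 4 ^ 2 ≤ k y := fun y => hker y 4 (by linarith) (norm_T4_le y)
  have hknn : ∀ y, 0 ≤ k y := fun y => le_trans (by positivity) (hk0 y)
  -- The `i`-th bubble gets its own block of `N` dyadic shells, and bubbles extracted earlier live
  -- on smaller scales. What has been contracted before is then small compared with the current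
  -- increment.
  set F : ℕ → T4 → ℝ≥0∞ := fun i =>
    (annulus ((K - 1 - i) * N) ((K - 1 - i) * N + N)).indicator
      fun w => ENNReal.ofReal ((‖w‖ ^ 4)⁻¹) with hF
  have hFm : ∀ i, Measurable (F i) := fun i =>
    (measurable_norm.pow_const 4).inv.ennreal_ofReal.indicator (measurableSet_annulus _ _)
  set r : ℕ → Γ.V → Γ.V → Prop := fun i => Relation.EqvGen (Γ.edgeRel {e | K - i < l e}) with hr
  have hrE : ∀ i, Equivalence (r i) := fun i => Relation.EqvGen.is_equivalence _
  have htree := lintegral_prod_increments p q r hrE F hFm K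
    (fun i hi => by
      obtain ⟨e, f, p', q', -, -, -, -, -, -, h, -⟩ := hpq i hi
      exact h)
    (fun i hi j hj => by
      obtain ⟨e, f, p', q', -, hlab, hp, hq, -⟩ := hpq j (by omega)
      refine .rel _ _ ⟨e, ?_, hp, hq⟩
      have := (hlab e).2 (Or.inl rfl)
      rw [Set.mem_ofPred_eq]
      omega)
  have hFint : ∀ i, (N : ℝ≥0∞) ≤ ∫⁻ w, F i w := fun i => by
    rw [hF, lintegral_indicator (measurableSet_annulus _ _)]
    exact le_lintegral_annulus _ _
  -- pointwise lower bound
  have hpt : ∀ z : Γ.V → T4,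
      ENNReal.ofReal C₀ * ∏ i ∈ Finset.range K, F i (z (q i) - z (p i)) ≤
        ENNReal.ofReal (∏ e, k (Sum.elim x z (Γ.tgt e) - Sum.elim x z (Γ.src e))) := by
    intro z
    by_cases hz : ∀ i < K, z (q i) - z (p i) ∈
        annulus ((K - 1 - i) * N) ((K - 1 - i) * N + N)
    swap
    · push Not at hz
      obtain ⟨i, hi, hzi⟩ := hz
      have : ∏ i ∈ Finset.range K, F i (z (q i) - z (p i)) = 0 :=
        Finset.prod_eq_zero (Finset.mem_range.2 hi) (Set.indicator_of_notMem hzi _)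
      rw [this, mul_zero]
      exact zero_le
    have hFz : ∏ i ∈ Finset.range K, F i (z (q i) - z (p i)) =
        ENNReal.ofReal (∏ i ∈ Finset.range K, (‖z (q i) - z (p i)‖ ^ 4)⁻¹) := by
      rw [ENNReal.ofReal_prod_of_nonneg fun i _ => by positivity]
      exact Finset.prod_congr rfl fun i hi =>
        Set.indicator_of_mem (hz i (Finset.mem_range.1 hi)) _
    rw [hFz, ← ENNReal.ofReal_mul hC₀pos.le]
    apply ENNReal.ofReal_le_ofReal
    set ω : ℕ → ℝ := fun i => ‖z (q i) - z (p i)‖ with hω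
    have hωε : ∀ i < K, ε ≤ ω i := by
      intro i hi
      refine hε.trans (le_trans ?_ (hz i hi).1.le)
      refine inv_anti₀ (by positivity) (pow_le_pow_right₀ (by norm_num) ?_)
      calc (K - 1 - i) * N + N = (K - 1 - i + 1) * N := by ring
        _ ≤ K * N := Nat.mul_le_mul_right _ (by omega)
    have hωpos : ∀ i < K, 0 < ω i := fun i hi => lt_trans (by positivity) (hz i hi).1
    have hωmono : ∀ i < K, ∀ j < i, ω j ≤ ω i := by
      intro i hi j hj
      refine (hz j (by omega)).2.trans (le_trans ?_ (hz i hi).1.le)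
      refine inv_anti₀ (by positivity) (pow_le_pow_right₀ (by norm_num) ?_)
      calc (K - 1 - i) * N + N = (K - 1 - i + 1) * N := by ring
        _ ≤ (K - 1 - j) * N := Nat.mul_le_mul_right _ (by omega)
    -- A merge joins two classes by an increment of size at most `ρ`, so diameters obey `D ↦ 2 D +
    -- ρ` starting from `0`, whence `(2 ^ i - 1) ρ`.
    have hdiam : ∀ i ≤ K, ∀ ρ, 0 ≤ ρ → (∀ j < i, ω j ≤ ρ) → ∀ v w, r i v w →
        ‖z v - z w‖ ≤ (2 ^ i - 1) * ρ := by
      intro i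
      induction i with
      | zero =>
        intro _ ρ _ _ v w h
        have : v = w := by
          induction h with
          | rel v w h =>
            obtain ⟨e, he, -⟩ := h
            have := hl.1 e
            rw [Set.mem_ofPred_eq] at he
            omega
          | refl v => rfl
          | symm v w _ ih => exact ih.symm
          | trans u v w _ _ ih₁ ih₂ => exact ih₁.trans ih₂
        simp [this]
      | succ i ih =>
        intro hi ρ hρ hωρ v w h
        have ih := ih (by omega) ρ hρ fun j hj => hωρ j (by omega)
        obtain ⟨e, f, p', q', -, hlab, hp, hq, hp', hq', -, hm⟩ := hpq i (by omega)
        have hmerge := eqvGen_of_merge (hrE i) (p := p i) (q := q i) (fun v w h => by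
          obtain ⟨y, hy, hv, hw⟩ := h
          rw [Set.mem_ofPred_eq] at hy
          by_cases hyi : K - i < l y
          · exact Or.inl (.rel _ _ ⟨y, hyi, hv, hw⟩)
          · rcases (hlab y).1 (by omega) with rfl | rfl
            · rw [hp] at hv
              rw [hq] at hw
              rw [← Sum.inr.inj hv, ← Sum.inr.inj hw]
              exact Or.inr (Or.inl ⟨(hrE i).refl _, (hrE i).refl _⟩)
            · rw [hp'] at hv
              rw [hq'] at hw
              rw [← Sum.inr.inj hv, ← Sum.inr.inj hw]
              rcases hm with ⟨h1, h2⟩ | ⟨h1, h2⟩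
              · exact Or.inr (Or.inl ⟨(hrE i).symm h1, h2⟩)
              · exact Or.inr (Or.inr ⟨(hrE i).symm h2, h1⟩)) h
        have hi' : ω i ≤ ρ := hωρ i (by omega)
        have h1 : (1 : ℝ) ≤ 2 ^ i := one_le_pow₀ (by norm_num)
        have hnn : 0 ≤ (2 ^ i - 1) * ρ := mul_nonneg (by linarith) hρ
        have hfin : ∀ a b, ‖z a - z b‖ = ω i → r i v a → r i b w →
            ‖z v - z w‖ ≤ (2 ^ (i + 1) - 1) * ρ := by
          intro a b hab h1 h2
          have : z v - z w = (z v - z a) + (z a - z b) + (z b - z w) := by abel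
          rw [this]
          have h3 := norm_add₃_le (a := z v - z a) (b := z a - z b) (c := z b - z w)
          have h4 := ih _ _ h1
          have h5 := ih _ _ h2
          rw [pow_succ]
          linarith
        rcases hmerge with h | ⟨h, h'⟩ | ⟨h, h'⟩
        · have := ih v w h
          rw [pow_succ]
          nlinarith
        · exact hfin _ _ (norm_sub_rev _ _) h h'
        · exact hfin _ _ rfl h h'
    have hprod : ∏ e, k (Sum.elim x z (Γ.tgt e) - Sum.elim x z (Γ.src e)) =
        ∏ j ∈ Finset.range (K + 1), ∏ e ∈ Finset.univ.filter (fun e : Γ.E => l e = j),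
          k (Sum.elim x z (Γ.tgt e) - Sum.elim x z (Γ.src e)) :=
      (Finset.prod_fiberwise_of_maps_to (fun e _ => Finset.mem_range.2 (by
        have := hl.1 e; omega)) _).symm
    rw [hprod, Finset.prod_range_succ', mul_comm (∏ _ ∈ _, _), hC₀, mul_assoc]
    have hzero : (c / 4 ^ 2) ^ n₀ ≤ ∏ e ∈ Finset.univ.filter (fun e : Γ.E => l e = 0),
        k (Sum.elim x z (Γ.tgt e) - Sum.elim x z (Γ.src e)) := by
      rw [← Finset.prod_const]
      exact Finset.prod_le_prod (fun _ _ => by positivity) fun e _ => hk0 _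
    have hpos : ((c / (2 ^ K) ^ 2) ^ 2) ^ K * ∏ i ∈ Finset.range K, (ω i ^ 4)⁻¹ ≤
        ∏ j ∈ Finset.range K, ∏ e ∈ Finset.univ.filter (fun e : Γ.E => l e = j + 1),
          k (Sum.elim x z (Γ.tgt e) - Sum.elim x z (Γ.src e)) := by
      have hcard : ((c / (2 ^ K) ^ 2) ^ 2) ^ K =
          ∏ _i ∈ Finset.range K, (c / (2 ^ K) ^ 2) ^ 2 := by simp
      rw [hcard, ← Finset.prod_mul_distrib, ← Finset.prod_range_reflect (fun j =>
        ∏ e ∈ Finset.univ.filter (fun e : Γ.E => l e = j + 1), _)]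
      refine Finset.prod_le_prod (fun i _ => by positivity) fun i hi => ?_
      have hi := Finset.mem_range.1 hi
      obtain ⟨e, f, p', q', hef, hlab, hp, hq, hp', hq', -, hm⟩ := hpq i hi
      have hfilter : Finset.univ.filter (fun e : Γ.E => l e = K - 1 - i + 1) = {e, f} := by
        ext y
        simp only [Finset.mem_filter, Finset.mem_univ, true_and, Finset.mem_insert,
          Finset.mem_singleton, ← hlab]
        omega
      rw [hfilter, Finset.prod_pair hef, hp, hq, hp', hq']
      simp only [Sum.elim_inr]
      have hωi := hωpos i hi
      have h2i : (1 : ℝ) ≤ 2 ^ i := one_le_pow₀ (by norm_num)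
      have h2K : (2 : ℝ) ^ (i + 1) ≤ 2 ^ K := pow_le_pow_right₀ (by norm_num) (by omega)
      have h2K1 : (1 : ℝ) ≤ 2 ^ K := one_le_pow₀ (by norm_num)
      have hεr : ε ≤ 2 ^ K * ω i := (hωε i hi).trans (le_mul_of_one_le_left hωi.le h2K1)
      have he : c / (2 ^ K * ω i) ^ 2 ≤ k (z (q i) - z (p i)) :=
        hker _ _ hεr (le_mul_of_one_le_left hωi.le h2K1)
      have hd := hdiam i hi.le (ω i) hωi.le (hωmono i hi)
      -- Two class diameters and one increment: `2 (2 ^ i - 1) + 1 ≤ 2 ^ (i + 1) ≤ 2 ^ K` times `ω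
      -- i`. This is how the second edge of the bubble is compared with the first.
      have hfin : ∀ a b a' b', ‖z a - z b‖ = ω i → r i a a' → r i b b' →
          ‖z a' - z b'‖ ≤ 2 ^ K * ω i := by
        intro a b a' b' hab h1 h2
        have : z a' - z b' = (z a' - z a) + (z a - z b) + (z b - z b') := by abel
        rw [this]
        have h3 := norm_add₃_le (a := z a' - z a) (b := z a - z b) (c := z b - z b')
        have h4 := hd _ _ ((hrE i).symm h1)
        have h5 := hd _ _ h2
        rw [pow_succ] at h2K
        nlinarith
      have hf : c / (2 ^ K * ω i) ^ 2 ≤ k (z q' - z p') := by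
        refine hker _ _ hεr ?_
        rcases hm with ⟨h1, h2⟩ | ⟨h1, h2⟩
        · exact hfin (q i) (p i) q' p' rfl h2 h1
        · exact hfin (p i) (q i) q' p' (norm_sub_rev _ _) h1 h2
      calc (c / (2 ^ K) ^ 2) ^ 2 * (ω i ^ 4)⁻¹
          = c / (2 ^ K * ω i) ^ 2 * (c / (2 ^ K * ω i) ^ 2) := by field_simp
        _ ≤ _ := mul_le_mul he hf (by positivity) (hknn _)
    exact mul_le_mul hzero hpos (mul_nonneg (by positivity)
      (Finset.prod_nonneg fun i _ => by positivity)) (Finset.prod_nonneg fun e _ => hknn _)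
  -- integration
  have hval : ENNReal.ofReal (Γ.val k x) =
      ∫⁻ z, ENNReal.ofReal (∏ e, k (Sum.elim x z (Γ.tgt e) - Sum.elim x z (Γ.src e))) :=
    ofReal_integral_eq_lintegral_ofReal (integrable_val_integrand hk hB x)
      (Eventually.of_forall fun z => Finset.prod_nonneg fun e _ => hknn _)
  have hlow : ENNReal.ofReal C₀ * (v₁ * (N : ℝ≥0∞) ^ K) ≤ v₀ ^ K * ENNReal.ofReal (Γ.val k x) := by
    calc ENNReal.ofReal C₀ * (v₁ * (N : ℝ≥0∞) ^ K)
        ≤ ENNReal.ofReal C₀ * (v₁ * ∏ i ∈ Finset.range K, ∫⁻ w, F i w) := by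
          gcongr
          calc (N : ℝ≥0∞) ^ K = ∏ _i ∈ Finset.range K, (N : ℝ≥0∞) := by simp
            _ ≤ _ := Finset.prod_le_prod' fun i _ => hFint i
      _ = v₀ ^ K * (ENNReal.ofReal C₀ *
            ∫⁻ z : Γ.V → T4, ∏ i ∈ Finset.range K, F i (z (q i) - z (p i))) := by
          rw [← htree]; ring
      _ = v₀ ^ K * (∫⁻ z : Γ.V → T4, ENNReal.ofReal C₀ *
            ∏ i ∈ Finset.range K, F i (z (q i) - z (p i))) := by
          rw [lintegral_const_mul]
          exact Finset.measurable_prod _ fun i _ => (hFm i).comp (measurable_sub_eval _ _)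
      _ ≤ _ := by rw [hval]; exact mul_le_mul_right (lintegral_mono hpt) _
  have hvalnn : 0 ≤ Γ.val k x := integral_nonneg fun z => Finset.prod_nonneg fun e _ => hknn _
  have hreal := ENNReal.toReal_mono (ENNReal.mul_ne_top (ENNReal.pow_ne_top hv₀top)
    ENNReal.ofReal_ne_top) hlow
  simp only [ENNReal.toReal_mul, ENNReal.toReal_pow, ENNReal.toReal_ofReal hC₀pos.le,
    ENNReal.toReal_ofReal hvalnn, ENNReal.toReal_natCast] at hreal
  have hv : 0 < v₀.toReal ^ K := pow_pos (ENNReal.toReal_pos hv₀pos hv₀top) _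
  calc C₀ * (v₁.toReal / v₀.toReal ^ K) * (N : ℝ) ^ K
      = C₀ * (v₁.toReal * (N : ℝ) ^ K) / v₀.toReal ^ K := by ring
    _ ≤ Γ.val k x := by rw [div_le_iff₀ hv, mul_comm (Γ.val k x)]; exact hreal

end FeynmanDiagram

end

section

open scoped ENNReal

/-! ### Periodisation -/

/-- The half-open period box. -/
def periodBox : Set (Fin 4 → ℝ) := Set.univ.pi fun _ => Set.Ioc 0 (2 * Real.pi)

/-- The representative of a point of the torus in the period box. -/
def toBox (x : T4) : Fin 4 → ℝ := fun i => (AddCircle.measurableEquivIoc (2 * Real.pi) 0 (x i)).1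

/-- The vectors of the period lattice. -/
def period (k : Fin 4 → ℤ) : Fin 4 → ℝ := fun i => k i * (2 * Real.pi)

theorem measurable_toBox : Measurable toBox :=
  measurable_pi_lambda _ fun i => measurable_subtype_coe.comp
    ((AddCircle.measurableEquivIoc _ _).measurable.comp (measurable_pi_apply i))

theorem continuous_toT4 : Continuous toT4 :=
  continuous_pi fun i => (AddCircle.continuous_mk' _).comp (continuous_apply i)

theorem toT4_toBox (x : T4) : toT4 (toBox x) = x := by
  funext i
  exact (AddCircle.equivIoc (2 * Real.pi) 0).symm_apply_apply (x i)

theorem toT4_add_period (v : Fin 4 → ℝ) (k : Fin 4 → ℤ) : toT4 (v + period k) = toT4 v := by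
  funext i
  simp only [toT4, Pi.add_apply, period, AddCircle.coe_add]
  have : (((k i : ℝ) * (2 * Real.pi) : ℝ) : AddCircle (2 * Real.pi)) = 0 :=
    (AddCircle.coe_eq_zero_iff _).2 ⟨k i, by simp⟩
  rw [this, add_zero]

theorem toT4_sub (v w : Fin 4 → ℝ) : toT4 (v - w) = toT4 v - toT4 w := rfl

theorem toBox_mem (x : T4) : toBox x ∈ periodBox := fun i _ => by
  have := (AddCircle.measurableEquivIoc (2 * Real.pi) 0 (x i)).2
  exact ⟨this.1, this.2.trans_eq (zero_add _)⟩

theorem exists_period_of_toT4_eq {v w : Fin 4 → ℝ} (h : toT4 v = toT4 w) :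
    ∃ k, v = w + period k := by
  have : ∀ i, ∃ n : ℤ, v i = w i + n * (2 * Real.pi) := by
    intro i
    have hi : ((v i - w i : ℝ) : AddCircle (2 * Real.pi)) = 0 := by
      have := congrFun h i
      simp only [toT4] at this
      rw [AddCircle.coe_sub, this, sub_self]
    obtain ⟨n, hn⟩ := (AddCircle.coe_eq_zero_iff _).1 hi
    exact ⟨n, by rw [← zsmul_eq_mul, hn]; ring⟩
  choose k hk using this
  exact ⟨k, funext hk⟩

theorem period_eq_zero_of_mem {v : Fin 4 → ℝ} {k : Fin 4 → ℤ} (hv : v ∈ periodBox)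
    (hk : v + period k ∈ periodBox) : k = 0 := by
  funext i
  have h1 := hv i trivial
  have h2 := hk i trivial
  simp only [Pi.add_apply, period, Set.mem_Ioc] at h1 h2
  have hp := Real.two_pi_pos
  have h3 : (k i : ℝ) < 1 := by
    by_contra h
    nlinarith
  have h4 : (-1 : ℝ) < k i := by
    by_contra h
    nlinarith
  have h5 : k i < 1 := by exact_mod_cast h3
  have h6 : -1 < k i := by exact_mod_cast h4
  simp only [Pi.zero_apply]
  omega

theorem toBox_toT4 {v : Fin 4 → ℝ} (hv : v ∈ periodBox) : toBox (toT4 v) = v := by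
  obtain ⟨k, hk⟩ := exists_period_of_toT4_eq (toT4_toBox (toT4 v))
  have := toBox_mem (toT4 v)
  rw [hk] at this
  rw [hk, period_eq_zero_of_mem hv this]
  funext i
  simp [period]

theorem measurableSet_periodBox : MeasurableSet periodBox :=
  MeasurableSet.univ_pi fun _ => measurableSet_Ioc

theorem measurePreserving_toT4 : MeasurePreserving toT4 (volume.restrict periodBox) volume := by
  have h := measurePreserving_pi (fun _ : Fin 4 => volume.restrict (Set.Ioc (0 : ℝ) (2 * Real.pi)))
    (fun _ : Fin 4 => (volume : Measure (AddCircle (2 * Real.pi))))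
    (f := fun _ => QuotientAddGroup.mk) fun _ => by
      have := AddCircle.measurePreserving_mk (2 * Real.pi) 0
      rwa [zero_add] at this
  rwa [← Measure.restrict_pi_pi] at h

theorem lintegral_T4 {h : T4 → ℝ≥0∞} (hh : Measurable h) :
    ∫⁻ x, h x = ∫⁻ v in periodBox, h (toT4 v) :=
  (measurePreserving_toT4.lintegral_comp hh).symm

/-- The lattice translates of the half-open period box tile `ℝ⁴`. -/
theorem lintegral_periodize {g : (Fin 4 → ℝ) → ℝ≥0∞} (hg : Measurable g) :
    ∫⁻ x : T4, ∑' k, g (toBox x + period k) = ∫⁻ v, g v := by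
  have hm : ∀ k, Measurable fun x : T4 => g (toBox x + period k) := fun k =>
    hg.comp (measurable_toBox.add_const _)
  have himg : ∀ k, MeasurableSet ((fun v => v + -period k) ⁻¹' periodBox) := fun k =>
    measurableSet_periodBox.preimage (measurable_add_const _)
  calc ∫⁻ x : T4, ∑' k, g (toBox x + period k)
      = ∑' k, ∫⁻ x : T4, g (toBox x + period k) := lintegral_tsum fun k => (hm k).aemeasurable
    _ = ∑' k, ∫⁻ v in (fun v => v + -period k) ⁻¹' periodBox, g v := by
        congr 1
        funext k
        rw [lintegral_T4 (hm k), ← lintegral_indicator measurableSet_periodBox,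
          ← lintegral_indicator (himg k), ← lintegral_add_right_eq_self _ (-period k)]
        refine lintegral_congr fun v => ?_
        by_cases hv : v + -period k ∈ periodBox
        · have hv' : v ∈ (fun v => v + -period k) ⁻¹' periodBox := hv
          rw [Set.indicator_of_mem hv, Set.indicator_of_mem hv', toBox_toT4 hv]
          congr 1
          abel
        · have hv' : v ∉ (fun v => v + -period k) ⁻¹' periodBox := hv
          rw [Set.indicator_of_notMem hv, Set.indicator_of_notMem hv']
    _ = ∫⁻ v in ⋃ k, (fun v => v + -period k) ⁻¹' periodBox, g v := by
        refine (lintegral_iUnion himg (fun k l hkl => ?_) g).symm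
        refine Set.disjoint_left.2 fun v hv hv' => hkl ?_
        have h1 : v + -period k ∈ periodBox := hv
        have h2 : v + -period l ∈ periodBox := hv'
        have h3 : v + -period l = v + -period k + period (k - l) := by
          funext i
          simp only [Pi.add_apply, Pi.neg_apply, period, Pi.sub_apply]
          push_cast
          ring
        rw [h3] at h2
        exact sub_eq_zero.1 (period_eq_zero_of_mem h1 h2)
    _ = ∫⁻ v, g v := by
        have : ⋃ k, (fun v => v + -period k) ⁻¹' periodBox = Set.univ := by
          refine Set.eq_univ_of_forall fun v => Set.mem_iUnion.2 ?_
          obtain ⟨k, hk⟩ := exists_period_of_toT4_eq (toT4_toBox (toT4 v)).symm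
          refine ⟨k, ?_⟩
          have := toBox_mem (toT4 v)
          rw [Set.mem_preimage, ← sub_eq_add_neg]
          rwa [← sub_eq_of_eq_add hk] at this
        rw [this, setLIntegral_univ]

theorem quasiMeasurePreserving_toT4 : Measure.QuasiMeasurePreserving toT4 volume volume := by
  refine ⟨continuous_toT4.measurable, Measure.AbsolutelyContinuous.mk fun s hs h0 => ?_⟩
  rw [Measure.map_apply continuous_toT4.measurable hs, ← lintegral_indicator_one
    (continuous_toT4.measurable hs), ← lintegral_periodize
    (measurable_one.indicator (continuous_toT4.measurable hs))]
  rw [lintegral_eq_zero_iff]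
  · have : ∀ᵐ x : T4, x ∉ s := measure_eq_zero_iff_ae_notMem.1 h0
    filter_upwards [this] with x hx
    simp only [Pi.zero_apply, ENNReal.tsum_eq_zero]
    intro k
    refine Set.indicator_of_notMem ?_ _
    rwa [Set.mem_preimage, toT4_add_period, toT4_toBox]
  · exact Measurable.tsum fun k =>
      (measurable_one.indicator (continuous_toT4.measurable hs)).comp
        (measurable_toBox.add_const _)

/-- Integrals over bounded sets of periodic functions. -/
theorem exists_setLIntegral_toT4_le (R : ℝ) : ∃ M : ℝ≥0∞, M ≠ ∞ ∧ ∀ h : T4 → ℝ≥0∞, Measurable h →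
    ∫⁻ v in Metric.closedBall 0 R, h (toT4 v) ≤ M * ∫⁻ x, h x := by
  -- Only finitely many translates of the box meet the ball, and their number bounds the
  -- multiplicity; `8` leaves room for the side `2 π` of the box.
  obtain ⟨m, hm⟩ := exists_nat_ge (|R| + 8)
  let I : Finset (Fin 4 → ℤ) := Fintype.piFinset fun _ => Finset.Icc (-m : ℤ) m
  refine ⟨I.card, ENNReal.natCast_ne_top _, fun h hh => ?_⟩
  have hg : Measurable ((Metric.closedBall (0 : Fin 4 → ℝ) R).indicator fun v => h (toT4 v)) :=
    (hh.comp continuous_toT4.measurable).indicator Metric.isClosed_closedBall.measurableSet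
  rw [← lintegral_indicator Metric.isClosed_closedBall.measurableSet, ← lintegral_periodize hg,
    ← lintegral_const_mul _ hh]
  refine lintegral_mono fun x => ?_
  rw [tsum_eq_sum (s := I)]
  · rw [← nsmul_eq_mul, ← Finset.sum_const]
    refine Finset.sum_le_sum fun k _ => ?_
    refine (Set.indicator_le_self _ _ _).trans ?_
    simp only [toT4_add_period, toT4_toBox, le_refl]
  · intro k hk
    refine Set.indicator_of_notMem (fun hmem => hk ?_) _
    rw [mem_closedBall_zero_iff] at hmem
    refine Fintype.mem_piFinset.2 fun i => ?_
    have h1 := (norm_le_pi_norm (toBox x + period k) i).trans hmem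
    have h2 := toBox_mem x i trivial
    simp only [Pi.add_apply, period, Real.norm_eq_abs, Set.mem_Ioc] at h1 h2
    have h3 := abs_le.1 (h1.trans (le_abs_self R))
    have hp := Real.pi_gt_three
    have hp' := Real.pi_lt_four
    have habs := abs_nonneg R
    have hup : (k i : ℝ) ≤ m := by
      by_contra hcon
      push Not at hcon
      nlinarith
    have hlo : -(m : ℝ) ≤ k i := by
      by_contra hcon
      push Not at hcon
      nlinarith
    rw [Finset.mem_Icc]
    exact ⟨by exact_mod_cast hlo, by exact_mod_cast hup⟩

end

section

open scoped ENNReal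

/-! ### The heat kernel and the Green's function -/

/-- The heat kernel of `ℝ⁴`. -/
def gauss (t : ℝ) (v : Fin 4 → ℝ) : ℝ :=
  ((4 * Real.pi * t) ^ 2)⁻¹ * Real.exp (-(∑ i, v i ^ 2) / (4 * t))

theorem gauss_nonneg (t : ℝ) (v : Fin 4 → ℝ) : 0 ≤ gauss t v := by
  unfold gauss
  positivity

theorem measurable_gauss : Measurable fun p : ℝ × (Fin 4 → ℝ) => gauss p.1 p.2 := by
  unfold gauss
  have h : ∀ i : Fin 4, Measurable fun p : ℝ × (Fin 4 → ℝ) => p.2 i := fun i =>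
    (measurable_pi_apply i).comp measurable_snd
  fun_prop

theorem measurable_gauss_right (t : ℝ) : Measurable (gauss t) :=
  measurable_gauss.comp (measurable_prodMk_left (x := t))

/-- The heat kernel of the torus, as a nonnegative extended number. -/
def heatE (t : ℝ) (x : T4) : ℝ≥0∞ := ∑' k, ENNReal.ofReal (gauss t (toBox x + period k))

theorem measurable_heatE {α : Type*} [MeasurableSpace α] {f : α → ℝ} {g : α → T4}
    (hf : Measurable f) (hg : Measurable g) : Measurable fun a => heatE (f a) (g a) :=
  Measurable.tsum fun k => ENNReal.measurable_ofReal.comp (measurable_gauss.comp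
    (hf.prodMk ((measurable_toBox.comp hg).add_const (period k))))

/-- The points of `ℝ⁴` above a point of the torus. -/
def fibreEquiv (x : T4) : (Fin 4 → ℤ) ≃ {v : Fin 4 → ℝ // toT4 v = x} :=
  Equiv.ofBijective (fun k => ⟨toBox x + period k, by rw [toT4_add_period, toT4_toBox]⟩) <| by
    constructor
    · intro k l h
      have h := congrArg Subtype.val h
      funext i
      have hi := congrFun h i
      simp only [Pi.add_apply, period, add_right_inj] at hi
      have := mul_right_cancel₀ Real.two_pi_pos.ne' hi
      exact_mod_cast this
    · rintro ⟨v, hv⟩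
      obtain ⟨k, hk⟩ := exists_period_of_toT4_eq (hv.trans (toT4_toBox x).symm)
      exact ⟨k, Subtype.ext hk.symm⟩

theorem heatKernel_eq (t : ℝ) (x : T4) : heatKernel t x = (heatE t x).toReal := by
  unfold heatE
  rw [ENNReal.tsum_toReal_eq fun _ => ENNReal.ofReal_ne_top]
  simp only [ENNReal.toReal_ofReal (gauss_nonneg _ _)]
  exact ((fibreEquiv x).tsum_eq fun v : {v : Fin 4 → ℝ // toT4 v = x} => gauss t v.1).symm

theorem le_heatE (t : ℝ) {x : T4} {v : Fin 4 → ℝ} (hv : toT4 v = x) :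
    ENNReal.ofReal (gauss t v) ≤ heatE t x := by
  obtain ⟨k, hk⟩ := exists_period_of_toT4_eq (hv.trans (toT4_toBox x).symm)
  rw [hk]
  exact ENNReal.le_tsum (f := fun k => ENNReal.ofReal (gauss t (toBox x + period k))) k

theorem lintegral_gauss {t : ℝ} (ht : 0 < t) : ∫⁻ v, ENNReal.ofReal (gauss t v) = 1 := by
  have h1 : ∀ v, gauss t v =
      ((4 * Real.pi * t) ^ 2)⁻¹ * ∏ i : Fin 4, Real.exp (-(1 / (4 * t)) * v i ^ 2) := by
    intro v
    rw [gauss, ← Real.exp_sum, ← Finset.mul_sum]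
    congr 2
    ring
  have hint : Integrable (gauss t) := by
    rw [funext h1]
    have h2 : Integrable fun y : ℝ => Real.exp (-(1 / (4 * t)) * y ^ 2) :=
      integrable_exp_neg_mul_sq (by positivity)
    exact (Integrable.fintype_prod (μ := fun _ : Fin 4 => (volume : Measure ℝ))
      (f := fun (_ : Fin 4) (y : ℝ) => Real.exp (-(1 / (4 * t)) * y ^ 2)) fun _ => h2).const_mul _
  rw [← ofReal_integral_eq_lintegral_ofReal hint (Eventually.of_forall (gauss_nonneg t)),
    ← ENNReal.ofReal_one]
  congr 1
  have hpi := Real.pi_pos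
  simp only [h1]
  rw [integral_const_mul, integral_fintype_prod_volume_eq_prod
    (fun (_ : Fin 4) (y : ℝ) => Real.exp (-(1 / (4 * t)) * y ^ 2))]
  simp only [integral_gaussian, Finset.prod_const, Finset.card_univ, Fintype.card_fin]
  rw [show (4 : ℕ) = 2 * 2 from rfl, pow_mul, Real.sq_sqrt (by positivity)]
  field_simp

theorem lintegral_heatE {t : ℝ} (ht : 0 < t) : ∫⁻ x, heatE t x = 1 := by
  rw [← lintegral_gauss ht, ← lintegral_periodize (measurable_gauss_right t).ennreal_ofReal]
  rfl

/-- The Green's function, as a nonnegative extended number. -/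
def greenE (x : T4) : ℝ≥0∞ :=
  ∫⁻ t in Set.Ioi (0 : ℝ), ENNReal.ofReal (Real.exp (-t)) * heatE t x

theorem measurable_greenE_integrand :
    Measurable fun p : T4 × ℝ => ENNReal.ofReal (Real.exp (-p.2)) * heatE p.2 p.1 :=
  Measurable.mul (f := fun p : T4 × ℝ => ENNReal.ofReal (Real.exp (-p.2)))
    (Real.measurable_exp.comp measurable_snd.neg).ennreal_ofReal (measurable_heatE measurable_snd measurable_fst)

theorem measurable_greenE : Measurable greenE :=
  measurable_greenE_integrand.lintegral_prod_right'

theorem lintegral_greenE : ∫⁻ x, greenE x = 1 := by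
  unfold greenE
  rw [lintegral_lintegral_swap measurable_greenE_integrand.aemeasurable]
  have : ∀ t ∈ Set.Ioi (0 : ℝ), ∫⁻ x, ENNReal.ofReal (Real.exp (-t)) * heatE t x =
      ENNReal.ofReal (Real.exp (-t)) := by
    intro t ht
    rw [lintegral_const_mul _ (measurable_heatE measurable_const measurable_id :
      Measurable fun x : T4 => heatE t x), lintegral_heatE ht, mul_one]
  rw [setLIntegral_congr_fun measurableSet_Ioi this,
    ← ofReal_integral_eq_lintegral_ofReal (integrableOn_exp_neg_Ioi 0)
      (Eventually.of_forall fun t => (Real.exp_pos _).le), integral_exp_neg_Ioi_zero,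
    ENNReal.ofReal_one]

theorem green_nonneg (x : T4) : 0 ≤ green x :=
  setIntegral_nonneg measurableSet_Ioi fun t _ =>
    mul_nonneg (Real.exp_pos _).le (by rw [heatKernel_eq]; exact ENNReal.toReal_nonneg)

theorem measurable_green : Measurable green := by
  have : StronglyMeasurable fun x : T4 =>
      ∫ t in Set.Ioi (0 : ℝ), Real.exp (-t) * (heatE t x).toReal := by
    refine StronglyMeasurable.integral_prod_right (f := fun (x : T4) (t : ℝ) =>
      Real.exp (-t) * (heatE t x).toReal) (Measurable.stronglyMeasurable ?_)
    exact Measurable.mul (f := fun p : T4 × ℝ => Real.exp (-p.2))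
      (Real.measurable_exp.comp measurable_snd.neg) (measurable_heatE measurable_snd measurable_fst).ennreal_toReal
  have h := this.measurable
  simp only [← heatKernel_eq] at h
  exact h

/-- The real integral defining `green` takes its default value `0` where it diverges, as at the
origin, so agreement with `greenE` requires finiteness. It holds almost everywhere because `greenE`
has total mass one. -/
theorem green_eq_of_ne_top {x : T4} (hx : greenE x ≠ ∞) : ENNReal.ofReal (green x) = greenE x := by
  have hm : AEMeasurable (fun t : ℝ => ENNReal.ofReal (Real.exp (-t)) * heatE t x)
      (volume.restrict (Set.Ioi 0)) :=
    (measurable_greenE_integrand.comp (measurable_prodMk_left (x := x))).aemeasurable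
  have h := integral_toReal hm (ae_lt_top' hm hx)
  have h' : green x = (greenE x).toReal := by
    unfold green greenE
    rw [← h]
    congr 1
    funext t
    rw [heatKernel_eq, ENNReal.toReal_mul, ENNReal.toReal_ofReal (Real.exp_pos _).le]
  rw [h', ENNReal.ofReal_toReal hx]

theorem ae_green_eq : ∀ᵐ x : T4, ENNReal.ofReal (green x) = greenE x := by
  have : ∀ᵐ x : T4, greenE x < ∞ :=
    ae_lt_top measurable_greenE (by rw [lintegral_greenE]; exact ENNReal.one_ne_top)
  filter_upwards [this] with x hx using green_eq_of_ne_top hx.ne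

theorem lintegral_green : ∫⁻ x, ENNReal.ofReal (green x) = 1 := by
  rw [lintegral_congr_ae ae_green_eq, lintegral_greenE]

/-- The Green's function has a singularity of order `|x|⁻²` at the origin. -/
theorem exists_le_green (D : ℝ) : ∃ c > 0, ∀ a, 0 < a → a ≤ D → ∀ v : Fin 4 → ℝ,
    ∑ i, v i ^ 2 ≤ 4 * a → ENNReal.ofReal (c / a) ≤ greenE (toT4 v) := by
  have hpi := Real.pi_pos
  refine ⟨Real.exp (-(2 * D)) * (((8 * Real.pi) ^ 2)⁻¹ * Real.exp (-1)), by positivity,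
    fun a ha haD v hv => ?_⟩
  -- Times of order `a` suffice. For them the Gaussian exponent is at least `-1`, its prefactor is
  -- of order `a⁻²` and `e^{-t} ≥ e^{-2 D}`; the time interval has length `a`, which leaves `1 / a`.
  have hpt : ∀ t ∈ Set.Icc a (2 * a),
      ENNReal.ofReal (Real.exp (-(2 * D)) * (((8 * Real.pi * a) ^ 2)⁻¹ * Real.exp (-1))) ≤
        ENNReal.ofReal (Real.exp (-t)) * heatE t (toT4 v) := by
    intro t ht
    have ht0 : 0 < t := ha.trans_le ht.1
    rw [ENNReal.ofReal_mul (Real.exp_pos _).le]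
    refine mul_le_mul' (ENNReal.ofReal_le_ofReal (Real.exp_le_exp.2 (by linarith [ht.2]))) ?_
    refine (ENNReal.ofReal_le_ofReal ?_).trans (le_heatE t rfl)
    unfold gauss
    have h1 : (-1 : ℝ) ≤ -(∑ i, v i ^ 2) / (4 * t) := by
      rw [le_div_iff₀ (by positivity)]
      linarith [ht.1]
    have h2 : ((8 * Real.pi * a) ^ 2)⁻¹ ≤ ((4 * Real.pi * t) ^ 2)⁻¹ := by
      refine inv_anti₀ (by positivity) (pow_le_pow_left₀ (by positivity) ?_ 2)
      nlinarith [ht.2]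
    exact mul_le_mul h2 (Real.exp_le_exp.2 h1) (Real.exp_pos _).le (by positivity)
  calc ENNReal.ofReal (Real.exp (-(2 * D)) * (((8 * Real.pi) ^ 2)⁻¹ * Real.exp (-1)) / a)
      = ∫⁻ _t in Set.Icc a (2 * a),
          ENNReal.ofReal (Real.exp (-(2 * D)) * (((8 * Real.pi * a) ^ 2)⁻¹ * Real.exp (-1))) := by
        rw [setLIntegral_const, Real.volume_Icc, ← ENNReal.ofReal_mul (by positivity)]
        congr 1
        field_simp
        ring
    _ ≤ ∫⁻ t in Set.Icc a (2 * a), ENNReal.ofReal (Real.exp (-t)) * heatE t (toT4 v) :=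
        setLIntegral_mono' measurableSet_Icc hpt
    _ ≤ greenE (toT4 v) := lintegral_mono_set fun t ht => ha.trans_le ht.1

end

section

open scoped ENNReal

/-! ### The mollified Green's function -/

theorem continuous_ofLp_four :
    Continuous fun y : EuclideanSpace ℝ (Fin 4) => (fun i => y i : Fin 4 → ℝ) :=
  PiLp.continuous_ofLp 2 _

theorem quasiMeasurePreserving_toT4_ofLp (x : T4) :
    Measure.QuasiMeasurePreserving
      (fun y : EuclideanSpace ℝ (Fin 4) => x - toT4 fun i => y i) volume volume :=
  (quasiMeasurePreserving_sub_left volume x).comp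
    (quasiMeasurePreserving_toT4.comp (PiLp.volume_preserving_ofLp (Fin 4)).quasiMeasurePreserving)

instance : (volume : Measure T4).IsNegInvariant :=
  Measure.IsAddHaarMeasure.isNegInvariant_of_regular volume

theorem exists_setLIntegral_green_le (R : ℝ) : ∃ M : ℝ≥0∞, M ≠ ∞ ∧ ∀ x : T4,
    ∫⁻ y in Metric.closedBall (0 : EuclideanSpace ℝ (Fin 4)) R,
      ENNReal.ofReal (green (x - toT4 fun i => y i)) ≤ M := by
  obtain ⟨M, hM, h⟩ := exists_setLIntegral_toT4_le R
  refine ⟨M, hM, fun x => ?_⟩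
  have hm : Measurable fun z : T4 => ENNReal.ofReal (green (x - z)) :=
    (measurable_green.comp (measurable_const_sub x)).ennreal_ofReal
  calc ∫⁻ y in Metric.closedBall (0 : EuclideanSpace ℝ (Fin 4)) R,
        ENNReal.ofReal (green (x - toT4 fun i => y i))
      ≤ ∫⁻ y in (WithLp.ofLp : EuclideanSpace ℝ (Fin 4) → Fin 4 → ℝ) ⁻¹' Metric.closedBall 0 R,
        ENNReal.ofReal (green (x - toT4 fun i => y i)) := by
        refine lintegral_mono_set fun y hy => ?_
        rw [mem_closedBall_zero_iff] at hy
        rw [Set.mem_preimage, mem_closedBall_zero_iff]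
        exact (pi_norm_le_iff_of_nonneg ((norm_nonneg _).trans hy)).2 fun i =>
          (PiLp.norm_apply_le y i).trans hy
    _ = ∫⁻ v in Metric.closedBall (0 : Fin 4 → ℝ) R, ENNReal.ofReal (green (x - toT4 v)) :=
        (PiLp.volume_preserving_ofLp (Fin 4)).setLIntegral_comp_preimage
          Metric.isClosed_closedBall.measurableSet (hm.comp continuous_toT4.measurable)
    _ ≤ M * ∫⁻ z, ENNReal.ofReal (green (x - z)) := h _ hm
    _ = M := by
        rw [lintegral_sub_left_eq_self (fun z => ENNReal.ofReal (green z)) x, lintegral_green,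
          mul_one]

variable {ρ : EuclideanSpace ℝ (Fin 4) → ℝ}

/-- The rescaled mollifier. -/
def scaled (ρ : EuclideanSpace ℝ (Fin 4) → ℝ) (ε : ℝ) (y : EuclideanSpace ℝ (Fin 4)) : ℝ :=
  (ε ^ 4)⁻¹ * ρ (ε⁻¹ • y)

theorem IsMollifier.continuous_scaled (hρ : IsMollifier ρ) (ε : ℝ) : Continuous (scaled ρ ε) :=
  continuous_const.mul (hρ.smooth.continuous.comp (continuous_const_smul _))

theorem IsMollifier.scaled_nonneg (hρ : IsMollifier ρ) {ε : ℝ} (hε : 0 < ε)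
    (y : EuclideanSpace ℝ (Fin 4)) : 0 ≤ scaled ρ ε y :=
  mul_nonneg (by positivity) (hρ.nonneg _)

theorem IsMollifier.integral_scaled (hρ : IsMollifier ρ) {ε : ℝ} (hε : 0 < ε) :
    ∫ y, scaled ρ ε y = 1 := by
  unfold scaled
  rw [integral_const_mul, Measure.integral_comp_inv_smul, hρ.integral_eq_one,
    finrank_euclideanSpace, Fintype.card_fin, abs_of_pos (by positivity)]
  simp [hε.ne']

theorem IsMollifier.exists_support (hρ : IsMollifier ρ) : ∃ R, 0 ≤ R ∧ ∀ ε y, 0 < ε →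
    scaled ρ ε y ≠ 0 → ‖y‖ ≤ R * ε := by
  obtain ⟨R, hR⟩ := hρ.compact_support.isCompact.isBounded.subset_closedBall (0 : EuclideanSpace ℝ (Fin 4))
  refine ⟨|R|, abs_nonneg R, fun ε y hε hy => ?_⟩
  have h1 : ε⁻¹ • y ∈ tsupport ρ := subset_tsupport _ (right_ne_zero_of_mul hy)
  have h2 := mem_closedBall_zero_iff.1 (hR h1)
  rw [norm_smul, norm_inv, Real.norm_eq_abs, abs_of_pos hε] at h2
  calc ‖y‖ = ε⁻¹ * ‖y‖ * ε := by field_simp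
    _ ≤ |R| * ε := by gcongr; exact h2.trans (le_abs_self R)

theorem IsMollifier.exists_scaled_le (hρ : IsMollifier ρ) {ε : ℝ} (hε : 0 < ε) :
    ∃ A, 0 ≤ A ∧ ∀ y, scaled ρ ε y ≤ A := by
  obtain ⟨A, hA⟩ := hρ.compact_support.exists_bound_of_continuous hρ.smooth.continuous
  refine ⟨(ε ^ 4)⁻¹ * |A|, by positivity, fun y => ?_⟩
  refine mul_le_mul_of_nonneg_left ?_ (by positivity)
  exact (le_abs_self _).trans ((hA _).trans (le_abs_self A))

theorem measurable_greenMoll_integrand (hρ : IsMollifier ρ) (ε : ℝ) :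
    Measurable fun p : T4 × EuclideanSpace ℝ (Fin 4) =>
      scaled ρ ε p.2 * green (p.1 - toT4 fun i => p.2 i) :=
  ((hρ.continuous_scaled ε).measurable.comp measurable_snd).mul (measurable_green.comp
    (measurable_fst.sub ((continuous_toT4.comp continuous_ofLp_four).measurable.comp
      measurable_snd)))

theorem measurable_greenMoll (hρ : IsMollifier ρ) (ε : ℝ) : Measurable (greenMoll ρ ε) :=
  (StronglyMeasurable.integral_prod_right (f := fun (x : T4) (y : EuclideanSpace ℝ (Fin 4)) =>
    scaled ρ ε y * green (x - toT4 fun i => y i))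
    (measurable_greenMoll_integrand hρ ε).stronglyMeasurable).measurable

theorem greenMoll_integrand_nonneg (hρ : IsMollifier ρ) {ε : ℝ} (hε : 0 < ε) (x : T4)
    (y : EuclideanSpace ℝ (Fin 4)) : 0 ≤ scaled ρ ε y * green (x - toT4 fun i => y i) :=
  mul_nonneg (hρ.scaled_nonneg hε y) (green_nonneg _)

theorem exists_lintegral_greenMoll_le (hρ : IsMollifier ρ) {ε : ℝ} (hε : 0 < ε) :
    ∃ M : ℝ≥0∞, M ≠ ∞ ∧ ∀ x : T4, ∫⁻ y : EuclideanSpace ℝ (Fin 4),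
      ENNReal.ofReal (scaled ρ ε y * green (x - toT4 fun i => y i)) ≤ M := by
  obtain ⟨R, hR, hsupp⟩ := hρ.exists_support
  obtain ⟨A, hA, hle⟩ := hρ.exists_scaled_le hε
  obtain ⟨M, hM, hint⟩ := exists_setLIntegral_green_le (R * ε)
  refine ⟨ENNReal.ofReal A * M, ENNReal.mul_ne_top ENNReal.ofReal_ne_top hM, fun x => ?_⟩
  refine le_trans ?_ (mul_le_mul_right (hint x) _)
  have hm : Measurable fun y : EuclideanSpace ℝ (Fin 4) =>
      ENNReal.ofReal (green (x - toT4 fun i => y i)) :=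
    (measurable_green.comp (measurable_const.sub
      (continuous_toT4.comp continuous_ofLp_four).measurable)).ennreal_ofReal
  rw [← lintegral_const_mul _ hm, ← lintegral_indicator Metric.isClosed_closedBall.measurableSet]
  refine lintegral_mono fun y => ?_
  by_cases hy : scaled ρ ε y = 0
  · simp [hy]
  · rw [Set.indicator_of_mem (mem_closedBall_zero_iff.2 (hsupp ε y hε hy)),
      ← ENNReal.ofReal_mul hA]
    exact ENNReal.ofReal_le_ofReal (mul_le_mul_of_nonneg_right (hle y) (green_nonneg _))

theorem integrable_greenMoll_integrand (hρ : IsMollifier ρ) {ε : ℝ} (hε : 0 < ε) (x : T4) :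
    Integrable fun y : EuclideanSpace ℝ (Fin 4) =>
      scaled ρ ε y * green (x - toT4 fun i => y i) := by
  obtain ⟨M, hM, h⟩ := exists_lintegral_greenMoll_le hρ hε
  refine ⟨((measurable_greenMoll_integrand hρ ε).comp
    (measurable_prodMk_left (x := x))).aestronglyMeasurable, ?_⟩
  rw [hasFiniteIntegral_iff_ofReal
    (Eventually.of_forall fun y => greenMoll_integrand_nonneg hρ hε x y)]
  exact (h x).trans_lt hM.lt_top

theorem exists_abs_greenMoll_le (hρ : IsMollifier ρ) {ε : ℝ} (hε : 0 < ε) :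
    ∃ B, ∀ x, |greenMoll ρ ε x| ≤ B := by
  obtain ⟨M, hM, h⟩ := exists_lintegral_greenMoll_le hρ hε
  refine ⟨M.toReal, fun x => ?_⟩
  have hnn := greenMoll_integrand_nonneg hρ hε x
  have h0 : 0 ≤ greenMoll ρ ε x := integral_nonneg hnn
  rw [abs_of_nonneg h0]
  refine (ENNReal.ofReal_le_iff_le_toReal hM).1 ?_
  refine le_trans (le_of_eq ?_) (h x)
  exact ofReal_integral_eq_lintegral_ofReal (integrable_greenMoll_integrand hρ hε x)
    (Eventually.of_forall hnn)

/-- Rounding each coordinate to the nearest period gives a shortest representative. -/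
theorem exists_lift_norm_le (x : T4) : ∃ v, toT4 v = x ∧ ‖v‖ ≤ ‖x‖ := by
  refine ⟨fun i => toBox x i - round ((2 * Real.pi)⁻¹ * toBox x i) * (2 * Real.pi), ?_, ?_⟩
  · have := toT4_add_period (toBox x) fun i => -round ((2 * Real.pi)⁻¹ * toBox x i)
    rw [toT4_toBox] at this
    refine Eq.trans (congrArg toT4 (funext fun i => ?_)) this
    simp only [Pi.add_apply, period]
    push_cast
    ring
  · refine (pi_norm_le_iff_of_nonneg (norm_nonneg _)).2 fun i => ?_
    refine le_trans (le_of_eq ?_) (norm_le_pi_norm x i)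
    rw [Real.norm_eq_abs, ← AddCircle.norm_eq]
    exact congrArg norm (congrFun (toT4_toBox x) i)

/-- The mollified Green's function is at least of order `|x|⁻²` down to the scale `ε`. -/
theorem exists_le_greenMoll (hρ : IsMollifier ρ) : ∃ c > 0, ∀ ε x r, 0 < ε → ε ≤ 1 → ε ≤ r →
    ‖x‖ ≤ r → c / r ^ 2 ≤ greenMoll ρ ε x := by
  obtain ⟨R, hR, hsupp⟩ := hρ.exists_support
  -- The points `x - y` with `‖x‖ ≤ r` and `y` in the support of the mollifier have size at most `(1
  -- + R) r`. So `a = (1 + R)² r²` will be used, with `r ≤ 4`.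
  obtain ⟨c, hc, hgreen⟩ := exists_le_green ((1 + R) ^ 2 * 4 ^ 2)
  have main : ∀ ε x r, 0 < ε → ε ≤ r → r ≤ 4 → ‖x‖ ≤ r →
      c / ((1 + R) ^ 2 * r ^ 2) ≤ greenMoll ρ ε x := by
    intro ε x r hε hεr hr4 hx
    have hr : 0 < r := hε.trans_le hεr
    obtain ⟨v, rfl, hv⟩ := exists_lift_norm_le x
    -- The bound fails at points where `green` has its default value, hence only an almost
    -- everywhere statement.
    have hae : ∀ᵐ y : EuclideanSpace ℝ (Fin 4),
        scaled ρ ε y * (c / ((1 + R) ^ 2 * r ^ 2)) ≤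
          scaled ρ ε y * green (toT4 v - toT4 fun i => y i) := by
      filter_upwards [(quasiMeasurePreserving_toT4_ofLp (toT4 v)).ae ae_green_eq] with y hy
      by_cases h0 : scaled ρ ε y = 0
      · simp [h0]
      refine mul_le_mul_of_nonneg_left ?_ (hρ.scaled_nonneg hε y)
      rw [← ENNReal.ofReal_le_ofReal_iff (green_nonneg _), hy, ← toT4_sub]
      refine hgreen _ (by positivity) (by gcongr) _ ?_
      have hyr : ‖y‖ ≤ R * r := (hsupp ε y hε h0).trans (by gcongr)
      have hi : ∀ i, (v - fun i => y i) i ^ 2 ≤ (1 + R) ^ 2 * r ^ 2 := by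
        intro i
        have h1 := ((norm_le_pi_norm v i).trans hv).trans hx
        have h2 := (PiLp.norm_apply_le y i).trans hyr
        rw [← mul_pow, ← sq_abs, Pi.sub_apply]
        refine pow_le_pow_left₀ (abs_nonneg _) ?_ 2
        calc |v i - y i| ≤ |v i| + |y i| := abs_sub _ _
          _ ≤ r + R * r := add_le_add h1 h2
          _ = (1 + R) * r := by ring
      calc ∑ i, (v - fun i => y i) i ^ 2 ≤ ∑ _i : Fin 4, (1 + R) ^ 2 * r ^ 2 :=
            Finset.sum_le_sum fun i _ => hi i
        _ = 4 * ((1 + R) ^ 2 * r ^ 2) := by simp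
    have hint : Integrable (scaled ρ ε) := by
      by_contra h
      have := hρ.integral_scaled hε
      rw [integral_undef h] at this
      exact zero_ne_one this
    calc c / ((1 + R) ^ 2 * r ^ 2) = ∫ y, scaled ρ ε y * (c / ((1 + R) ^ 2 * r ^ 2)) := by
          rw [integral_mul_const, hρ.integral_scaled hε, one_mul]
      _ ≤ ∫ y, scaled ρ ε y * green (toT4 v - toT4 fun i => y i) :=
          integral_mono_ae (hint.mul_const _) (integrable_greenMoll_integrand hρ hε _) hae
  refine ⟨c / (1 + R) ^ 2, by positivity, fun ε x r hε hε1 hεr hx => ?_⟩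
  have hr : 0 < r := hε.trans_le hεr
  -- All norms on the torus are at most `4`, so larger radii may be truncated; a smaller radius only
  -- strengthens the bound.
  have h := main ε x (min r 4) hε (le_min hεr (by linarith)) (min_le_right _ _)
    (le_min hx (norm_T4_le x))
  refine le_trans ?_ h
  rw [div_div]
  have : 0 < min r 4 := lt_min hr (by norm_num)
  gcongr
  exact min_le_left _ _

end

section

open scoped ENNReal

/-! ### The contributing pairings and the covariance coefficients -/

/-- The constant test function suffices. Each of the `K` bubbles is given `N` dyadic scales, with
`N` of order `log (1/ε)`, so the valuation is at least of order `(log (1/ε))^K`. The normalisation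
has exactly the exponent `-(a + b) / 2 = -K`, and a positive lower bound holds for all small `ε`. -/
theorem contributes_of_mem {ρ : EuclideanSpace ℝ (Fin 4) → ℝ} (hρ : IsMollifier ρ) {a b K : ℕ}
    (hK : a + b = 2 * K) (κ : Pairing (a + 1) (b + 1)) {l : (pairedDiagram κ).E → ℕ}
    (hl : l ∈ (pairedDiagram κ).bubbleLabellings K) : Contributes ρ κ := by
  have : Nonempty (pairedDiagram κ).V := ⟨κ.vert 0⟩
  obtain ⟨c, hc, hgreen⟩ := exists_le_greenMoll hρ
  obtain ⟨C, hC, hval⟩ := FeynmanDiagram.exists_le_val hl hc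
  set vol := volume.real (Set.univ : Set (Leaf → T4)) with hvol
  have hvolpos : 0 < vol :=
    ENNReal.toReal_pos ((Measure.measure_univ_ne_zero).2 (NeZero.ne _)) (measure_ne_top _ _)
  refine ⟨⟨fun _ => 1, (contDiff_const : ContDiff ℝ (⊤ : ℕ∞)
    fun _ : Leaf → Fin 4 → ℝ => (1 : ℝ))⟩, ?_⟩
  have hδ : 0 < (2 * (K + 1) : ℝ)⁻¹ ^ K * (C * vol) := by positivity
  refine (ENNReal.ofReal_pos.2 hδ).trans_le (le_limsup_of_frequently_le
    (Eventually.frequently ?_))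
  -- This range of `ε` makes `Λ / (K + 1)` at least `2`, so taking the integer part loses at most a
  -- factor `2`.
  have hmem : Set.Ioo (0 : ℝ) (Real.exp (-(2 * (K + 1)))) ∈ 𝓝[>] (0 : ℝ) :=
    Ioo_mem_nhdsGT (Real.exp_pos _)
  filter_upwards [hmem] with ε hε
  apply ENNReal.ofReal_le_ofReal
  have hε1 : ε ≤ 1 := hε.2.le.trans (Real.exp_le_one_iff.2 (by linarith [(Nat.cast_nonneg K : (0 : ℝ) ≤ K)]))
  set Λ := Real.log (1 / ε) with hΛ
  have hΛ2 : 2 * (K + 1 : ℝ) ≤ Λ := by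
    rw [hΛ, one_div, Real.log_inv]
    have := (Real.log_lt_log hε.1 hε.2).le
    rw [Real.log_exp] at this
    linarith
  have hK1 : (0 : ℝ) < K + 1 := by positivity
  have hΛpos : 0 < Λ := by linarith
  set N := ⌊Λ / (K + 1)⌋₊ with hN
  have hNle : (N : ℝ) ≤ Λ / (K + 1) := Nat.floor_le (by positivity)
  have hNge : Λ / (2 * (K + 1)) ≤ N := by
    have h1 : Λ / (K + 1) < N + 1 := Nat.lt_floor_add_one _
    have h2 : 2 ≤ Λ / (K + 1) := by rwa [le_div_iff₀ hK1]
    have h3 : Λ / (2 * (K + 1)) = Λ / (K + 1) / 2 := by field_simp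
    rw [h3]
    linarith
  -- The `K` blocks fit above the scale `ε`: as `N ≤ Λ / (K + 1)` and `2 ≤ e`, one has `2 ^ (K N) ≤
  -- e ^ Λ = 1 / ε`.
  have hεN : ε ≤ (2 ^ (K * N) : ℝ)⁻¹ := by
    rw [le_inv_comm₀ hε.1 (by positivity), ← one_div]
    calc (2 : ℝ) ^ (K * N) ≤ Real.exp 1 ^ (K * N) := by
          gcongr
          linarith [Real.add_one_le_exp (1 : ℝ)]
      _ = Real.exp (K * N) := by rw [← Real.exp_nat_mul]; push_cast; ring_nf
      _ ≤ Real.exp Λ := by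
          apply Real.exp_le_exp.2
          rw [le_div_iff₀ hK1] at hNle
          nlinarith [(Nat.cast_nonneg N : (0 : ℝ) ≤ N)]
      _ = 1 / ε := Real.exp_log (by have := hε.1; positivity)
  obtain ⟨B, hB⟩ := exists_abs_greenMoll_le hρ hε.1
  have hm := measurable_greenMoll hρ ε
  have hpt : ∀ x, C * (N : ℝ) ^ K ≤ (pairedDiagram κ).val (greenMoll ρ ε) x := fun x =>
    hval _ B ε N x hm hB hεN fun x r h1 h2 => hgreen ε x r hε.1 hε1 h1 h2
  have hint : C * (N : ℝ) ^ K * vol ≤ ∫ x, (pairedDiagram κ).val (greenMoll ρ ε) x := by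
    calc C * (N : ℝ) ^ K * vol = ∫ _x : Leaf → T4, C * (N : ℝ) ^ K := by
          rw [integral_const, smul_eq_mul, mul_comm]
      _ ≤ _ := integral_mono (integrable_const _) (FeynmanDiagram.integrable_val hm hB) hpt
  have hren : ∀ x, (pairedDiagram κ).renVal (greenMoll ρ ε) x = (pairedDiagram κ).val (greenMoll ρ ε) x :=
    fun x => FeynmanDiagram.renVal_eq_val hl (Pairing.pos_of_internal hK κ hl) _ _
  have hexp : (a + 1 - 1) + (b + 1 - 1) = 2 * K := by omega
  simp only [hren, mul_one]
  rw [hexp, pow_mul, inv_pow (√Λ), Real.sq_sqrt hΛpos.le]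
  calc (2 * (K + 1) : ℝ)⁻¹ ^ K * (C * vol)
      = Λ⁻¹ ^ K * (C * (Λ / (2 * (K + 1))) ^ K * vol) := by
        rw [div_eq_mul_inv, mul_pow, inv_pow, inv_pow]
        field_simp
    _ ≤ Λ⁻¹ ^ K * (C * (N : ℝ) ^ K * vol) := by gcongr
    _ ≤ _ := by
        gcongr
        exact hint.trans (le_abs_self _)

theorem card_pairedDiagram {a b K : ℕ} (hK : a + b = 2 * K) (κ : Pairing (a + 1) (b + 1)) :
    Nat.card (pairedDiagram κ).V = K + 1 := by
  have := κ.two_mul_card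
  omega

theorem inv_sqrt_eight_pi_pow (K : ℕ) :
    (1 / (Real.sqrt 8 * Real.pi)) ^ (2 * K) = (1 / (2 * Real.pi ^ 2)) ^ K / 4 ^ K := by
  rw [pow_mul, div_pow, mul_pow, Real.sq_sqrt (by norm_num), ← div_pow, div_div]
  congr 2
  norm_num
  ring

/-- The restriction to contributing pairings can be dropped: a pairing that does not contribute has
no extraction sequence and so has variance zero. Whether pairings without extraction sequences may
contribute is irrelevant. -/
theorem covCoeff_eq {ρ : EuclideanSpace ℝ (Fin 4) → ℝ} (hρ : IsMollifier ρ) {a b K : ℕ}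
    (hK : a + b = 2 * K) : covCoeff ρ (a + 1) (b + 1) =
      (1 / (2 * Real.pi ^ 2)) ^ K / 4 ^ K / K.factorial *
        ((∑ κ : Pairing (a + 1) (b + 1), (pairedDiagram κ).extractionSequences.ncard : ℕ) : ℝ) := by
  classical
  have hvar : ∀ κ : Pairing (a + 1) (b + 1), (pairedDiagram κ).variance =
      (1 / (2 * Real.pi ^ 2)) ^ K / 4 ^ K / K.factorial *
        ((pairedDiagram κ).extractionSequences.ncard : ℝ) := by
    intro κ
    have h : Nat.card (pairedDiagram κ).V - 1 = K := by rw [card_pairedDiagram hK κ]; rfl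
    have h' : (pairedDiagram κ).variance =
        (1 / (Real.sqrt 8 * Real.pi)) ^ (2 * K) *
          ((pairedDiagram κ).extractionSequences.ncard : ℝ) / (K.factorial : ℝ) := by
      unfold FeynmanDiagram.variance
      congr 3; rw [h]
    rw [h', inv_sqrt_eight_pi_pow]
    ring
  have hzero : ∀ κ : Pairing (a + 1) (b + 1), κ ∉ {κ : Pairing (a + 1) (b + 1) | Contributes ρ κ} →
      (pairedDiagram κ).variance = 0 := by
    intro κ hκ
    have : (pairedDiagram κ).bubbleLabellings K = ∅ :=
      Set.eq_empty_of_forall_notMem fun l hl => hκ (contributes_of_mem hρ hK κ hl)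
    rw [hvar, FeynmanDiagram.extractionSequences_ncard (card_pairedDiagram hK κ), this]
    simp
  have h : covCoeff ρ (a + 1) (b + 1) =
      ∑ᶠ κ : Pairing (a + 1) (b + 1), (pairedDiagram κ).variance := by
    refine finsum_congr fun κ => ?_
    by_cases hκ : κ ∈ {κ : Pairing (a + 1) (b + 1) | Contributes ρ κ}
    · exact finsum_eq_if.trans (if_pos hκ)
    · exact (finsum_eq_if.trans (if_neg hκ)).trans (hzero κ hκ).symm
  rw [h, finsum_eq_sum_of_fintype, Nat.cast_sum, Finset.mul_sum]
  exact Finset.sum_congr rfl fun κ _ => hvar κ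

theorem covCoeff_nonneg (ρ : EuclideanSpace ℝ (Fin 4) → ℝ) (n m : ℕ) : 0 ≤ covCoeff ρ n m :=
  finsum_nonneg fun κ => finsum_nonneg fun _ => by
    unfold FeynmanDiagram.variance
    positivity

/-- An odd number of vertices has no perfect matching. -/
theorem covCoeff_of_odd (ρ : EuclideanSpace ℝ (Fin 4) → ℝ) {n m : ℕ} (h : Odd (n + m)) :
    covCoeff ρ n m = 0 := by
  have : IsEmpty (Pairing n m) := ⟨fun κ => by
    have := κ.two_mul_card
    obtain ⟨k, hk⟩ := h
    omega⟩
  exact finsum_of_isEmpty _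

/-- The count `4 ^ K * K!` cancels against the factors `4 ^ K` and `K!` in the variance. -/
theorem sum_antidiagonal_covCoeff {ρ : EuclideanSpace ℝ (Fin 4) → ℝ} (hρ : IsMollifier ρ) (K : ℕ) :
    ∑ p ∈ Finset.HasAntidiagonal.antidiagonal (2 * K), covCoeff ρ (p.1 + 1) (p.2 + 1) =
      (1 / (2 * Real.pi ^ 2)) ^ K := by
  rw [Finset.sum_congr rfl fun p hp => covCoeff_eq hρ (Finset.HasAntidiagonal.mem_antidiagonal.1 hp),
    ← Finset.mul_sum, ← Nat.cast_sum, sum_antidiagonal_ncard_extractionSequences]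
  have : (K.factorial : ℝ) ≠ 0 := by exact_mod_cast K.factorial_ne_zero
  push_cast
  field_simp

/-- One term of a sum of nonnegative numbers. It bounds `σ_n` geometrically, with the ratio that
gives the radius `√2 π`. -/
theorem covCoeff_le {ρ : EuclideanSpace ℝ (Fin 4) → ℝ} (hρ : IsMollifier ρ) (a : ℕ) :
    covCoeff ρ (a + 1) (a + 1) ≤ (1 / (2 * Real.pi ^ 2)) ^ a := by
  rw [← sum_antidiagonal_covCoeff hρ a]
  exact Finset.single_le_sum (f := fun p : ℕ × ℕ => covCoeff ρ (p.1 + 1) (p.2 + 1))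
    (fun p _ => covCoeff_nonneg _ _ _)
    (Finset.HasAntidiagonal.mem_antidiagonal.2 (two_mul a).symm : (a, a) ∈ _)

/-! ### The ladder -/

/-- The pairing of equal heights. -/
def ladder (a : ℕ) : Pairing (a + 1) (a + 1) :=
  ⟨Equiv.sumComm _ _, by rintro (v | v) <;> simp⟩

/-- The height of a vertex of the ladder. -/
def ladderHeight (a : ℕ) : (pairedDiagram (ladder a)).V → ℕ :=
  Quot.lift (Sum.elim (fun i => i.1) fun i => i.1) <| by
    rintro (v | v) w rfl <;> rfl

def ladderVert (a j : ℕ) (h : j < a + 1) : (pairedDiagram (ladder a)).V :=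
  Quot.mk _ (Sum.inl ⟨j, h⟩)

theorem mk_inr_eq_ladderVert {a j : ℕ} (h : j < a + 1) :
    (Quot.mk _ (Sum.inr ⟨j, h⟩) : (pairedDiagram (ladder a)).V) = ladderVert a j h :=
  Quot.sound (show (ladder a).1 (Sum.inr ⟨j, h⟩) = Sum.inl ⟨j, h⟩ from rfl)

theorem ladder_ends {a : ℕ} (j : Fin (a + 2)) (h1 : 1 ≤ j.1) (h2 : j.1 ≤ a)
    (e : (pairedDiagram (ladder a)).E) (he : e = Sum.inl j ∨ e = Sum.inr j) :
    (pairedDiagram (ladder a)).src e = Sum.inr (ladderVert a (j - 1) (by omega)) ∧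
      (pairedDiagram (ladder a)).tgt e = Sum.inr (ladderVert a j (by omega)) := by
  have hj0 : j.1 ≠ 0 := by omega
  have hj1 : j.1 - 1 < a + 1 := by omega
  have hj2 : j.1 + 1 - 1 < a + 1 := by omega
  rcases he with rfl | rfl
  · exact ⟨(if_neg hj0).trans (dif_pos hj1), (if_neg (t := Sum.inl (0, 0)) (Nat.succ_ne_zero j.1)).trans (dif_pos hj2)⟩
  · exact ⟨((if_neg hj0).trans (dif_pos hj1)).trans (congrArg _ (mk_inr_eq_ladderVert _)),
      ((if_neg (t := Sum.inl (1, 0)) (Nat.succ_ne_zero j.1)).trans (dif_pos hj2)).trans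
        (congrArg _ (mk_inr_eq_ladderVert _))⟩

/-- The two edges between the same consecutive rungs form a bubble, labelled by the height of its
upper end. The edges at the leaves, numbers `0` and `a + 1`, get `0`. -/
def ladderLabel (a : ℕ) : (pairedDiagram (ladder a)).E → ℕ :=
  Sum.elim (fun j : Fin (a + 2) => if j.1 ≤ a then j.1 else 0)
    fun j : Fin (a + 2) => if j.1 ≤ a then j.1 else 0

theorem ladderLabel_eq_iff {a j : ℕ} (hj : 1 ≤ j) (hja : j ≤ a) (e : (pairedDiagram (ladder a)).E) :
    ladderLabel a e = j ↔ e = Sum.inl (⟨j, by omega⟩ : Fin (a + 2)) ∨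
      e = Sum.inr (⟨j, by omega⟩ : Fin (a + 2)) := by
  have key : ∀ i : Fin (a + 2), (if i.1 ≤ a then i.1 else 0) = j ↔ i = ⟨j, by omega⟩ := by
    intro i
    rw [Fin.ext_iff]
    show (if i.1 ≤ a then i.1 else 0) = j ↔ i.1 = j
    split_ifs <;> omega
  have hE : (pairedDiagram (ladder a)).E = (Fin (a + 2) ⊕ Fin (a + 2)) := rfl
  rcases e with i | i
  · refine (key i).trans ⟨fun h => Or.inl (congrArg _ h), ?_⟩
    rintro (h | h)
    · exact Sum.inl.inj h
    · exact absurd h (by simp)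
  · refine (key i).trans ⟨fun h => Or.inr (congrArg _ h), ?_⟩
    rintro (h | h)
    · exact absurd h (by simp)
    · exact Sum.inr.inj h

theorem ladderLabel_mem (a : ℕ) : ladderLabel a ∈ (pairedDiagram (ladder a)).bubbleLabellings a := by
  refine ⟨?_, fun j hj hja => ?_⟩
  · rintro (i | i)
    · show (if i.1 ≤ a then i.1 else 0) ≤ a
      split_ifs <;> omega
    · show (if i.1 ≤ a then i.1 else 0) ≤ a
      split_ifs <;> omega
  refine ⟨Sum.inl (⟨j, by omega⟩ : Fin (a + 2)), Sum.inr (⟨j, by omega⟩ : Fin (a + 2)),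
    fun h => Sum.inl_ne_inr h,
    ladderLabel_eq_iff hj hja, ladderVert a (j - 1) (by omega), ladderVert a j (by omega),
    ladderVert a (j - 1) (by omega), ladderVert a j (by omega),
    (ladder_ends ⟨j, by omega⟩ hj hja _ (Or.inl rfl)).1,
    (ladder_ends ⟨j, by omega⟩ hj hja _ (Or.inl rfl)).2,
    (ladder_ends ⟨j, by omega⟩ hj hja _ (Or.inr rfl)).1,
    (ladder_ends ⟨j, by omega⟩ hj hja _ (Or.inr rfl)).2, ?_,
    Or.inl ⟨Relation.EqvGen.refl _, Relation.EqvGen.refl _⟩⟩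
  -- Edges of label above `j` join heights that are at least `j`, so they cannot connect the heights
  -- `j - 1` and `j`.
  have key : ∀ v w, Relation.EqvGen ((pairedDiagram (ladder a)).edgeRel
      {x | j < ladderLabel a x}) v w → (ladderHeight a v < j ↔ ladderHeight a w < j) := by
    intro v w h
    induction h with
    | rel v w h =>
      obtain ⟨e, he, hs, ht⟩ := h
      have he : j < ladderLabel a e := he
      have hle : ladderLabel a e ≤ a := by
        rcases e with i | i
        · show (if i.1 ≤ a then i.1 else 0) ≤ a
          split_ifs <;> omega
        · show (if i.1 ≤ a then i.1 else 0) ≤ a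
          split_ifs <;> omega
      have hends := ladder_ends ⟨ladderLabel a e, by omega⟩ (show 1 ≤ ladderLabel a e by omega) hle e
        ((ladderLabel_eq_iff (by omega) hle e).1 rfl)
      rw [hs, ht] at hends
      obtain ⟨h1, h2⟩ := hends
      have h1 := congrArg (ladderHeight a) (Sum.inr.inj h1)
      have h2 := congrArg (ladderHeight a) (Sum.inr.inj h2)
      rw [h1, h2]
      show ladderLabel a e - 1 < j ↔ ladderLabel a e < j
      omega
    | refl => exact Iff.rfl
    | symm _ _ _ ih => exact ih.symm
    | trans _ _ _ _ _ ih₁ ih₂ => exact ih₁.trans ih₂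
  intro h
  have h := key _ _ h
  have h1 : ladderHeight a (ladderVert a (j - 1) (by omega)) = j - 1 := rfl
  have h2 : ladderHeight a (ladderVert a j (by omega)) = j := rfl
  omega

/-- The ladder supplies an extraction sequence. Positivity matters because the covariance of the
fields is normalised by `σ_n σ_m`, and these factors have to cancel. -/
theorem covCoeff_pos {ρ : EuclideanSpace ℝ (Fin 4) → ℝ} (hρ : IsMollifier ρ) (a : ℕ) :
    0 < covCoeff ρ (a + 1) (a + 1) := by
  rw [covCoeff_eq hρ (two_mul a).symm]
  have hpi := Real.pi_pos
  refine mul_pos (by positivity) (Nat.cast_pos.2 ?_)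
  refine lt_of_lt_of_le ?_ (Finset.single_le_sum (f := fun κ : Pairing (a + 1) (a + 1) =>
    (pairedDiagram κ).extractionSequences.ncard) (fun κ _ => Nat.zero_le _)
    (Finset.mem_univ (ladder a)))
  rw [FeynmanDiagram.extractionSequences_ncard (card_pairedDiagram (two_mul a).symm (ladder a))]
  have hfin : ((pairedDiagram (ladder a)).bubbleLabellings a).Finite :=
    (Set.Finite.pi' fun _ => Set.finite_Iic a).subset fun l hl e => hl.1 e
  exact (Set.ncard_pos hfin).2 ⟨_, ladderLabel_mem a⟩

theorem sigma_pos {ρ : EuclideanSpace ℝ (Fin 4) → ℝ} (hρ : IsMollifier ρ) {n : ℕ} (hn : 1 ≤ n) :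
    0 < sigma ρ n := by
  obtain ⟨a, rfl⟩ := Nat.exists_eq_add_of_le' hn
  exact Real.sqrt_pos.2 (covCoeff_pos hρ a)

end

section

/-! ### Seminorms on test functions -/

section TestFunctions

variable {ι : Type} [Fintype ι]

/-- The projection of `(ℝ⁴)^ι` to `(𝕋⁴)^ι`. -/
def toTorus (v : ι → Fin 4 → ℝ) : ι → T4 := fun i => toT4 (v i)

theorem toTorus_add {ι : Type} (v w : ι → Fin 4 → ℝ) : toTorus (v + w) = toTorus v + toTorus w := rfl

theorem lift_apply {ι : Type} (f : (ι → T4) → ℝ) (v : ι → Fin 4 → ℝ) : lift f v = f (toTorus v) := rfl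

theorem toTorus_toBox {ι : Type} (x : ι → T4) : toTorus (fun i => toBox (x i)) = x :=
  funext fun i => toT4_toBox (x i)

/-- A compact set that contains a period box. -/
def periodCompact (ι : Type) [Fintype ι] : TopologicalSpace.Compacts (ι → Fin 4 → ℝ) :=
  -- The radius only has to exceed `2 π`.
  ⟨Metric.closedBall 0 7, isCompact_closedBall 0 7⟩

theorem toBox_mem_periodCompact (x : ι → T4) : (fun i => toBox (x i)) ∈ periodCompact ι := by
  show _ ∈ Metric.closedBall _ _
  rw [mem_closedBall_zero_iff]
  refine (pi_norm_le_iff_of_nonneg (by norm_num)).2 fun i =>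
    (pi_norm_le_iff_of_nonneg (by norm_num)).2 fun j => ?_
  have := toBox_mem (x i) j trivial
  have hpi := Real.pi_lt_d2
  rw [Real.norm_eq_abs, abs_of_pos this.1]
  linarith [this.2]

namespace TestFun

theorem derivMap_sub (m : ℕ) (φ ψ : TestFun ι) :
    derivMap m (φ - ψ) = derivMap m φ - derivMap m ψ := by
  ext1 v
  have h : ∀ χ : TestFun ι, ContDiffAt ℝ m (lift χ) v := fun χ =>
    (χ.contDiff_lift.of_le (by exact_mod_cast le_top)).contDiffAt
  exact iteratedFDeriv_sub_apply (h φ) (h ψ)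

theorem derivMap_smul (m : ℕ) (c : ℝ) (φ : TestFun ι) :
    derivMap m (c • φ) = c • derivMap m φ := by
  ext1 v
  have h : ContDiffAt ℝ m (lift φ) v :=
    (φ.contDiff_lift.of_le (by exact_mod_cast le_top)).contDiffAt
  exact iteratedFDeriv_const_smul_apply h

theorem continuous_derivMap (m : ℕ) : Continuous (derivMap m : TestFun ι → _) :=
  continuous_iInf_dom continuous_induced_dom

/-- The norm of the `m`-th derivative on a period box. -/
def derivNorm (m : ℕ) (φ : TestFun ι) : C(periodCompact ι, ℝ) :=
  ((⟨fun A => ‖A‖, continuous_norm⟩ : C((ι → Fin 4 → ℝ) [×m]→L[ℝ] ℝ, ℝ)).comp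
    (derivMap m φ)).restrict (periodCompact ι)

theorem derivNorm_apply (m : ℕ) (φ : TestFun ι) (v : periodCompact ι) :
    derivNorm m φ v = ‖iteratedFDeriv ℝ m (lift φ) v‖ := rfl

/-- The supremum of the `m`-th derivative. -/
def seminorm (m : ℕ) (φ : TestFun ι) : ℝ := ‖derivNorm m φ‖

theorem seminorm_nonneg (m : ℕ) (φ : TestFun ι) : 0 ≤ seminorm m φ := by
  unfold seminorm
  exact norm_nonneg _

theorem continuous_seminorm_sub (m : ℕ) (ψ : TestFun ι) :
    Continuous fun φ => seminorm m (φ - ψ) := by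
  have h : Continuous fun φ : TestFun ι => derivNorm m (φ - ψ) := by
    simp only [derivNorm, derivMap_sub]
    exact (ContinuousMap.continuous_restrict _).comp ((ContinuousMap.continuous_postcomp _).comp
      ((continuous_derivMap m).sub continuous_const))
  unfold seminorm
  exact h.norm

theorem seminorm_smul (m : ℕ) (c : ℝ) (φ : TestFun ι) :
    seminorm m (c • φ) = |c| * seminorm m φ := by
  have h : derivNorm m (c • φ) = |c| • derivNorm m φ := by
    ext1 v
    have : derivNorm m (c • φ) v = ‖derivMap m (c • φ) v‖ := rfl
    rw [this, derivMap_smul, ContinuousMap.smul_apply, norm_smul]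
    rfl
  unfold seminorm
  rw [h, norm_smul, Real.norm_eq_abs, abs_abs]

/-- By periodicity, a derivative at any point equals the one at the representative in the period
box. -/
theorem norm_iteratedFDeriv_le (m : ℕ) (φ : TestFun ι) (v : ι → Fin 4 → ℝ) :
    ‖iteratedFDeriv ℝ m (lift φ) v‖ ≤ seminorm m φ := by
  set w : ι → Fin 4 → ℝ := fun i => toBox (toTorus v i) with hw
  have h : ∀ u, lift φ u = lift φ (u + (v - w)) := by
    intro u
    rw [lift_apply, lift_apply, toTorus_add]
    have : toTorus (v - w) = 0 := by
      funext i
      show toT4 (v i) - toT4 (w i) = 0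
      rw [hw]
      simp only [toT4_toBox]
      exact sub_self _
    rw [this, add_zero]
  have h1 : iteratedFDeriv ℝ m (lift φ) v = iteratedFDeriv ℝ m (lift φ) w := by
    conv_rhs => rw [funext h]
    rw [iteratedFDeriv_comp_add_right]
    congr 1
    abel
  rw [h1]
  have h2 := ContinuousMap.norm_coe_le_norm (derivNorm m φ) ⟨w, toBox_mem_periodCompact _⟩
  rwa [derivNorm_apply, norm_norm] at h2

/-- The unit ball of a continuous seminorm is a neighbourhood of zero, so it absorbs bounded sets.
-/
theorem exists_seminorm_le {S : Set (TestFun ι)} (hS : Bornology.IsVonNBounded ℝ S) (m : ℕ) :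
    ∃ B, ∀ φ ∈ S, seminorm m φ ≤ B := by
  have hV : {φ : TestFun ι | seminorm m φ < 1} ∈ 𝓝 (0 : TestFun ι) := by
    have h := continuous_seminorm_sub (ι := ι) m 0
    simp only [sub_zero] at h
    refine h.continuousAt.eventually_lt continuousAt_const ?_
    have := seminorm_smul m 0 (0 : TestFun ι)
    rw [zero_smul, abs_zero, zero_mul] at this
    rw [this]
    exact one_pos
  obtain ⟨r, hr⟩ := (hS hV).exists_pos
  obtain ⟨hr0, hr⟩ := hr
  refine ⟨r, fun φ hφ => ?_⟩
  obtain ⟨ψ, hψ, rfl⟩ := hr r (le_abs_self r) hφ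
  show seminorm m (r • ψ) ≤ r
  rw [seminorm_smul, abs_of_pos hr0]
  exact mul_le_of_le_one_right hr0.le (le_of_lt hψ)

end TestFun

/-! ### Finite differences -/

/-- The difference of a function and its translate. -/
def diffBy (u : ι → Fin 4 → ℝ) (f : (ι → T4) → ℝ) (x : ι → T4) : ℝ := f (x + toTorus u) - f x

theorem lift_diffBy {ι : Type} (u : ι → Fin 4 → ℝ) (f : (ι → T4) → ℝ) :
    lift (diffBy u f) = fun v => lift f (v + u) - lift f v := rfl

/-- By the mean value inequality each difference costs one derivative and gains a factor `‖u‖`.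
Finite differences replace integration by parts on the torus. -/
theorem norm_iteratedFDeriv_diffBy_le (u : ι → Fin 4 → ℝ) {f : (ι → T4) → ℝ}
    (hf : ContDiff ℝ (⊤ : ℕ∞) (lift f)) (r j : ℕ) {B : ℝ}
    (hB : ∀ v, ‖iteratedFDeriv ℝ (j + r) (lift f) v‖ ≤ B) :
    ContDiff ℝ (⊤ : ℕ∞) (lift ((diffBy u)^[r] f)) ∧
      ∀ v, ‖iteratedFDeriv ℝ j (lift ((diffBy u)^[r] f)) v‖ ≤ ‖u‖ ^ r * B := by
  induction r generalizing j B with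
  | zero => exact ⟨hf, fun v => by simpa using hB v⟩
  | succ r ih =>
    obtain ⟨hg, hbound⟩ := ih (j + 1) (B := B) (by rwa [add_right_comm, add_assoc])
    rw [Function.iterate_succ_apply', lift_diffBy]
    set g := lift ((diffBy u)^[r] f) with hgdef
    have hshift : ContDiff ℝ (⊤ : ℕ∞) fun v => g (v + u) := hg.comp (contDiff_id.add contDiff_const)
    refine ⟨hshift.sub hg, fun v => ?_⟩
    have hle : ∀ (h : (ι → Fin 4 → ℝ) → ℝ), ContDiff ℝ (⊤ : ℕ∞) h → ContDiffAt ℝ j h v :=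
      fun h hh => (hh.of_le (by exact_mod_cast le_top)).contDiffAt
    have h1 : iteratedFDeriv ℝ j (fun v => g (v + u) - g v) v =
        iteratedFDeriv ℝ j g (v + u) - iteratedFDeriv ℝ j g v := by
      rw [← iteratedFDeriv_comp_add_right]
      exact iteratedFDeriv_sub_apply (hle _ hshift) (hle _ hg)
    rw [h1]
    have hd : Differentiable ℝ (iteratedFDeriv ℝ j g) :=
      hg.differentiable_iteratedFDeriv (by exact_mod_cast WithTop.coe_lt_top j)
    have h2 := Convex.norm_image_sub_le_of_norm_fderiv_le (𝕜 := ℝ) (f := iteratedFDeriv ℝ j g)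
      (s := Set.univ) (x := v) (y := v + u) (C := ‖u‖ ^ r * B) (fun x _ => hd x)
      (fun x _ => by rw [norm_fderiv_iteratedFDeriv]; exact hbound x) convex_univ trivial trivial
    refine h2.trans (le_of_eq ?_)
    rw [add_sub_cancel_left]
    ring

end TestFunctions

end

section

section Fourier

/-! ### Fourier coefficients on `(𝕋⁴)^ι` -/

variable {ι : Type} [Fintype ι]

/-- The frequencies. -/
abbrev Freq (ι : Type) : Type := ι × Fin 4 → ℤ

/-- The phase `k · v`. -/
def phase (k : Freq ι) : (ι → Fin 4 → ℝ) →L[ℝ] ℝ :=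
  ∑ p : ι × Fin 4, (k p : ℝ) • (ContinuousLinearMap.proj (R := ℝ) (φ := fun _ : Fin 4 => ℝ) p.2).comp
    (ContinuousLinearMap.proj (R := ℝ) (φ := fun _ : ι => Fin 4 → ℝ) p.1)

theorem phase_apply (k : Freq ι) (v : ι → Fin 4 → ℝ) :
    phase k v = ∑ p : ι × Fin 4, (k p : ℝ) * v p.1 p.2 := by
  simp [phase]

theorem norm_phase_le (k : Freq ι) : ‖phase k‖ ≤ Fintype.card (ι × Fin 4) * ‖k‖ := by
  refine ContinuousLinearMap.opNorm_le_bound _ (by positivity) fun v => ?_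
  rw [phase_apply]
  refine (norm_sum_le _ _).trans ?_
  calc ∑ p : ι × Fin 4, ‖(k p : ℝ) * v p.1 p.2‖ ≤ ∑ _p : ι × Fin 4, ‖k‖ * ‖v‖ := by
        refine Finset.sum_le_sum fun p _ => ?_
        rw [norm_mul]
        refine mul_le_mul ?_ ((norm_le_pi_norm (v p.1) p.2).trans (norm_le_pi_norm v p.1))
          (norm_nonneg _) (norm_nonneg _)
        exact norm_le_pi_norm k p
    _ = Fintype.card (ι × Fin 4) * ‖k‖ * ‖v‖ := by
        rw [Finset.sum_const, Finset.card_univ, nsmul_eq_mul, mul_assoc]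

theorem two_pi_ne_zero : (2 * Real.pi) ≠ 0 := Real.two_pi_pos.ne'

/-- The rescaling of the torus to unit periods. -/
def toUnit (x : ι → T4) : UnitAddTorus (ι × Fin 4) :=
  fun p => AddCircle.equivAddCircle (2 * Real.pi) 1 two_pi_ne_zero one_ne_zero (x p.1 p.2)

/-- The inverse rescaling. -/
def ofUnit (θ : UnitAddTorus (ι × Fin 4)) : ι → T4 :=
  fun i j => AddCircle.equivAddCircle 1 (2 * Real.pi) one_ne_zero two_pi_ne_zero (θ (i, j))

theorem ofUnit_toUnit {ι : Type} (x : ι → T4) : ofUnit (toUnit x) = x := by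
  funext i j
  exact (AddCircle.equivAddCircle (2 * Real.pi) 1 two_pi_ne_zero one_ne_zero).symm_apply_apply _

theorem ofUnit_add {ι : Type} (θ η : UnitAddTorus (ι × Fin 4)) : ofUnit (θ + η) = ofUnit θ + ofUnit η := by
  funext i j
  exact map_add _ _ _

theorem continuous_ofUnit {ι : Type} : Continuous (ofUnit : UnitAddTorus (ι × Fin 4) → ι → T4) :=
  continuous_pi fun i => continuous_pi fun j =>
    (AddCircle.homeomorphAddCircle 1 (2 * Real.pi) one_ne_zero two_pi_ne_zero).continuous.comp
      (continuous_apply (i, j))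

theorem mFourier_apply_add {d : Type*} [Fintype d] (k : d → ℤ) (x y : UnitAddTorus d) :
    UnitAddTorus.mFourier k (x + y) = UnitAddTorus.mFourier k x * UnitAddTorus.mFourier k y := by
  simp [UnitAddTorus.mFourier, fourier_apply, smul_add, AddCircle.toCircle_add,
    Finset.prod_mul_distrib]

theorem norm_mFourier_apply {d : Type*} [Fintype d] (k : d → ℤ) (x : UnitAddTorus d) :
    ‖UnitAddTorus.mFourier k x‖ = 1 := by
  refine (norm_prod _ _).trans (Finset.prod_eq_one fun i _ => ?_)
  rw [fourier_apply, Circle.norm_coe]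

theorem mFourier_toUnit (k : Freq ι) (v : ι → Fin 4 → ℝ) :
    UnitAddTorus.mFourier k (toUnit (toTorus v)) = Complex.exp (phase k v * Complex.I) := by
  have h : ∀ p : ι × Fin 4, fourier (k p) (toUnit (toTorus v) p) =
      Complex.exp ((k p : ℂ) * v p.1 p.2 * Complex.I) := by
    intro p
    have : toUnit (toTorus v) p = ((v p.1 p.2 * ((2 * Real.pi)⁻¹ * 1) : ℝ) : AddCircle (1 : ℝ)) := rfl
    rw [this, fourier_coe_apply]
    congr 1
    have hpi : (Real.pi : ℂ) ≠ 0 := by exact_mod_cast Real.pi_ne_zero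
    push_cast
    field_simp
  have h' : UnitAddTorus.mFourier k (toUnit (toTorus v)) =
      ∏ p, fourier (k p) (toUnit (toTorus v) p) := rfl
  rw [h', Finset.prod_congr rfl fun p _ => h p, ← Complex.exp_sum, ← Finset.sum_mul, phase_apply]
  push_cast
  rfl

/-- The real part of the Fourier mode of frequency `k`. -/
def cosFun (k : Freq ι) : TestFun ι :=
  ⟨fun x => (UnitAddTorus.mFourier k (toUnit x)).re, by
    have : lift (fun x : ι → T4 => (UnitAddTorus.mFourier k (toUnit x)).re) =
        Real.cos ∘ phase k := by
      funext v
      rw [lift_apply, mFourier_toUnit, Complex.exp_ofReal_mul_I_re]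
      rfl
    show ContDiff ℝ (⊤ : ℕ∞) (lift fun x : ι → T4 => _)
    rw [this]
    exact Real.contDiff_cos.comp (phase k).contDiff⟩

/-- The imaginary part of the Fourier mode of frequency `k`. -/
def sinFun (k : Freq ι) : TestFun ι :=
  ⟨fun x => (UnitAddTorus.mFourier k (toUnit x)).im, by
    have : lift (fun x : ι → T4 => (UnitAddTorus.mFourier k (toUnit x)).im) =
        Real.sin ∘ phase k := by
      funext v
      rw [lift_apply, mFourier_toUnit, Complex.exp_ofReal_mul_I_im]
      rfl
    show ContDiff ℝ (⊤ : ℕ∞) (lift fun x : ι → T4 => _)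
    rw [this]
    exact Real.contDiff_sin.comp (phase k).contDiff⟩

theorem lift_cosFun (k : Freq ι) : lift (cosFun k) = Real.cos ∘ phase k := by
  funext v
  rw [lift_apply]
  show (UnitAddTorus.mFourier k (toUnit (toTorus v))).re = _
  rw [mFourier_toUnit, Complex.exp_ofReal_mul_I_re]
  rfl

theorem lift_sinFun (k : Freq ι) : lift (sinFun k) = Real.sin ∘ phase k := by
  funext v
  rw [lift_apply]
  show (UnitAddTorus.mFourier k (toUnit (toTorus v))).im = _
  rw [mFourier_toUnit, Complex.exp_ofReal_mul_I_im]
  rfl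

theorem abs_cosFun_le (k : Freq ι) (x : ι → T4) : |cosFun k x| ≤ 1 :=
  (Complex.abs_re_le_norm _).trans (norm_mFourier_apply k (toUnit x)).le

theorem abs_sinFun_le (k : Freq ι) (x : ι → T4) : |sinFun k x| ≤ 1 :=
  (Complex.abs_im_le_norm _).trans (norm_mFourier_apply k (toUnit x)).le

theorem norm_iteratedFDeriv_comp_phase_le {g : ℝ → ℝ} (hg : ContDiff ℝ (⊤ : ℕ∞) g)
    (hb : ∀ m x, |iteratedDeriv m g x| ≤ 1) (k : Freq ι) (m : ℕ) (v : ι → Fin 4 → ℝ) :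
    ‖iteratedFDeriv ℝ m (g ∘ phase k) v‖ ≤ (Fintype.card (ι × Fin 4) * ‖k‖) ^ m := by
  rw [ContinuousLinearMap.iteratedFDeriv_comp_right (phase k) hg v (by exact_mod_cast le_top)]
  refine (ContinuousMultilinearMap.norm_compContinuousLinearMap_le _ _).trans ?_
  rw [norm_iteratedFDeriv_eq_norm_iteratedDeriv, Finset.prod_const, Finset.card_univ,
    Fintype.card_fin]
  calc ‖iteratedDeriv m g (phase k v)‖ * ‖phase k‖ ^ m
      ≤ 1 * (Fintype.card (ι × Fin 4) * ‖k‖) ^ m :=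
        mul_le_mul (hb m _) (pow_le_pow_left₀ (norm_nonneg _) (norm_phase_le k) m)
          (by positivity) zero_le_one
    _ = _ := one_mul _

/-- The normalised Haar measure. -/
def unitHaar (d : Type*) [Fintype d] : Measure (UnitAddTorus d) :=
  Measure.pi fun _ => AddCircle.haarAddCircle

instance (d : Type*) [Fintype d] : IsProbabilityMeasure (unitHaar d) := by
  unfold unitHaar
  infer_instance

instance (d : Type*) [Fintype d] : (unitHaar d).IsAddHaarMeasure := by
  unfold unitHaar
  infer_instance

/-- The Fourier coefficients. -/
def coef (f : (ι → T4) → ℝ) (k : Freq ι) : ℂ :=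
  UnitAddTorus.mFourierCoeff (fun θ => (f (ofUnit θ) : ℂ)) k

theorem coef_eq (f : (ι → T4) → ℝ) (k : Freq ι) :
    coef f k = ∫ θ, UnitAddTorus.mFourier (-k) θ • (f (ofUnit θ) : ℂ) ∂unitHaar (ι × Fin 4) := rfl

theorem isQuotientMap_toTorus {ι : Type} : IsQuotientMap (toTorus : (ι → Fin 4 → ℝ) → ι → T4) :=
  (IsOpenQuotientMap.piMap fun _ => IsOpenQuotientMap.piMap fun _ =>
    QuotientAddGroup.isOpenQuotientMap_mk).isQuotientMap

theorem continuous_of_contDiff_lift {f : (ι → T4) → ℝ} (hf : ContDiff ℝ (⊤ : ℕ∞) (lift f)) :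
    Continuous f :=
  isQuotientMap_toTorus.continuous_iff.2 hf.continuous

theorem norm_coef_le {f : (ι → T4) → ℝ} {B : ℝ} (hB : ∀ x, |f x| ≤ B) (k : Freq ι) :
    ‖coef f k‖ ≤ B := by
  rw [coef_eq]
  refine (norm_integral_le_of_norm_le_const (C := B) (Eventually.of_forall fun θ => ?_)).trans ?_
  · rw [norm_smul, norm_mFourier_apply, one_mul, Complex.norm_real]
    exact hB _
  · simp

/-- Translation invariance of Haar measure turns the difference into multiplication by `e^{i k·u} -
1`. -/
theorem coef_diffBy {f : (ι → T4) → ℝ} (hf : Continuous f) (u : ι → Fin 4 → ℝ) (k : Freq ι) :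
    coef (diffBy u f) k = (Complex.exp (phase k u * Complex.I) - 1) * coef f k := by
  set a := toUnit (toTorus u) with ha
  set G : UnitAddTorus (ι × Fin 4) → ℂ := fun θ =>
    UnitAddTorus.mFourier (-k) θ * (f (ofUnit θ) : ℂ) with hG
  have hGc : Continuous G := (UnitAddTorus.mFourier (-k)).continuous.mul
    (Complex.continuous_ofReal.comp (hf.comp continuous_ofUnit))
  have hGi : ∀ g : UnitAddTorus (ι × Fin 4) → ℂ, Continuous g →
      Integrable g (unitHaar (ι × Fin 4)) := fun g hg =>
    hg.integrable_of_hasCompactSupport (HasCompactSupport.of_compactSpace g)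
  have hinv : UnitAddTorus.mFourier k a * UnitAddTorus.mFourier (-k) a = 1 := by
    rw [UnitAddTorus.mFourier_neg, Complex.mul_conj, Complex.normSq_eq_norm_sq,
      norm_mFourier_apply]
    simp
  have hpt : ∀ θ, UnitAddTorus.mFourier (-k) θ • ((diffBy u f (ofUnit θ) : ℝ) : ℂ) =
      UnitAddTorus.mFourier k a * G (a + θ) - G θ := by
    intro θ
    simp only [hG, diffBy, mFourier_apply_add, ofUnit_add, ha, ofUnit_toUnit, smul_eq_mul]
    rw [← mul_assoc, ← mul_assoc, ← ha, hinv, one_mul, add_comm (toTorus u)]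
    push_cast
    ring
  have hcoef : coef f k = ∫ θ, G θ ∂unitHaar (ι × Fin 4) := rfl
  rw [hcoef, coef_eq, integral_congr_ae (Eventually.of_forall hpt), integral_sub
    ((hGi (fun θ => G (a + θ)) (hGc.comp (continuous_const_add a))).const_mul _) (hGi G hGc), integral_const_mul,
    integral_add_left_eq_self, ← mFourier_toUnit]
  ring

/-- Differences by half a wavelength multiply the coefficient by `-2` each, while `m` of them are
bounded by `(π / |k_p|)^m` times the `m`-th seminorm. -/
theorem norm_coef_mul_le (m : ℕ) (φ : TestFun ι) (k : Freq ι) :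
    ‖coef φ k‖ * ‖k‖ ^ m ≤ 2 ^ m * (φ.seminorm 0 + φ.seminorm m) := by
  have hzero : ‖coef φ k‖ ≤ φ.seminorm 0 := by
    refine norm_coef_le (fun x => ?_) k
    have h := φ.norm_iteratedFDeriv_le 0 fun i => toBox (x i)
    rw [norm_iteratedFDeriv_zero, lift_apply, toTorus_toBox] at h
    exact h
  have h0 := φ.seminorm_nonneg 0
  have hm := φ.seminorm_nonneg m
  by_cases hk : k = 0
  · subst hk
    rcases Nat.eq_zero_or_pos m with rfl | hm'
    · simp only [pow_zero, mul_one, one_mul]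
      linarith
    · rw [norm_zero, zero_pow hm'.ne', mul_zero]
      positivity
  obtain ⟨p₀, hp₀⟩ := Function.ne_iff.1 hk
  have : Nonempty (ι × Fin 4) := ⟨p₀⟩
  obtain ⟨p, hp⟩ := Finite.exists_max fun q => ‖k q‖
  have hkp : k p ≠ 0 := fun h => hp₀ (norm_le_zero_iff.1 ((hp p₀).trans (by rw [h, norm_zero])))
  have hnorm : ‖k‖ ≤ |(k p : ℝ)| := (pi_norm_le_iff_of_nonneg (norm_nonneg _)).2 hp
  have hkp' : 0 < |(k p : ℝ)| := abs_pos.2 (by exact_mod_cast hkp)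
  classical
  -- The shift is along a coordinate where `|k_p|` is maximal, so `|k_p| = ‖k‖`, and is chosen so
  -- that `k · u = π`.
  set u : ι → Fin 4 → ℝ := Pi.single p.1 (Pi.single p.2 (Real.pi / k p)) with hu
  have hphase : phase k u = Real.pi := by
    rw [phase_apply, Finset.sum_eq_single p]
    · rw [hu, Pi.single_eq_same, Pi.single_eq_same]
      field_simp
    · rintro ⟨i, j⟩ - hne
      by_cases hi : i = p.1
      · subst hi
        have hj : j ≠ p.2 := fun h => hne (Prod.ext rfl h)
        rw [hu, Pi.single_eq_same, Pi.single_eq_of_ne hj, mul_zero]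
      · rw [hu, Pi.single_eq_of_ne hi, Pi.zero_apply, mul_zero]
    · simp
  have hunorm : ‖u‖ = Real.pi / |(k p : ℝ)| := by
    rw [hu, Pi.norm_single, Pi.norm_single, norm_div, Real.norm_of_nonneg Real.pi_pos.le,
      Real.norm_eq_abs]
  have hdiff := fun r => norm_iteratedFDeriv_diffBy_le u φ.contDiff_lift r 0 (B := φ.seminorm r)
    (by rw [zero_add]; exact φ.norm_iteratedFDeriv_le r)
  have hcoef : ∀ r, coef ((diffBy u)^[r] φ) k = (-2) ^ r * coef φ k := by
    intro r
    induction r with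
    | zero => simp
    | succ r ih =>
      rw [Function.iterate_succ_apply', coef_diffBy (continuous_of_contDiff_lift (hdiff r).1), ih,
        hphase, Complex.exp_pi_mul_I]
      ring
  have hle : ‖coef ((diffBy u)^[m] φ) k‖ ≤ (Real.pi / |(k p : ℝ)|) ^ m * φ.seminorm m := by
    refine norm_coef_le (fun x => ?_) k
    have h := (hdiff m).2 fun i => toBox (x i)
    rw [norm_iteratedFDeriv_zero, lift_apply, toTorus_toBox, hunorm] at h
    exact h
  rw [hcoef, norm_mul, norm_pow, norm_neg, Complex.norm_two, div_pow, div_mul_eq_mul_div,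
    le_div_iff₀ (by positivity)] at hle
  have hpi : Real.pi ^ m ≤ 4 ^ m := pow_le_pow_left₀ Real.pi_pos.le Real.pi_lt_four.le m
  have h2 : (0 : ℝ) < 2 ^ m := by positivity
  have h4 : (4 : ℝ) ^ m = 2 ^ m * 2 ^ m := by rw [← mul_pow]; norm_num
  have hk4 : ‖coef φ k‖ * ‖k‖ ^ m ≤ ‖coef φ k‖ * |(k p : ℝ)| ^ m := by gcongr
  have : 2 ^ m * (‖coef φ k‖ * |(k p : ℝ)| ^ m) ≤ 2 ^ m * (2 ^ m * φ.seminorm m) := by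
    calc 2 ^ m * (‖coef φ k‖ * |(k p : ℝ)| ^ m) = 2 ^ m * ‖coef φ k‖ * |(k p : ℝ)| ^ m := by ring
      _ ≤ Real.pi ^ m * φ.seminorm m := hle
      _ ≤ 4 ^ m * φ.seminorm m := by gcongr
      _ = _ := by rw [h4]; ring
  have := le_of_mul_le_mul_left this h2
  nlinarith [mul_nonneg h2.le h0]

/-- The decay of the Fourier coefficients. -/
theorem norm_coef_le_inv_pow (m : ℕ) (φ : TestFun ι) (k : Freq ι) :
    ‖coef φ k‖ ≤ 4 ^ (m + 1) * (φ.seminorm 0 + φ.seminorm m) * (1 + ‖k‖)⁻¹ ^ m := by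
  have h0 := φ.seminorm_nonneg 0
  have hm := φ.seminorm_nonneg m
  have hz := norm_coef_mul_le 0 φ k
  have hmm := norm_coef_mul_le m φ k
  have hk : 0 ≤ ‖k‖ := norm_nonneg k
  rw [inv_pow, ← div_eq_mul_inv, le_div_iff₀ (by positivity)]
  have h1 : (1 + ‖k‖) ^ m ≤ 2 ^ m * (1 + ‖k‖ ^ m) := by
    have : (1 + ‖k‖) ^ m ≤ (2 * max 1 ‖k‖) ^ m := by
      refine pow_le_pow_left₀ (by positivity) ?_ m
      linarith [le_max_left 1 ‖k‖, le_max_right 1 ‖k‖]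
    refine this.trans ?_
    rw [mul_pow]
    refine mul_le_mul_of_nonneg_left ?_ (by positivity)
    rcases le_total 1 ‖k‖ with h | h
    · rw [max_eq_right h]; linarith
    · rw [max_eq_left h, one_pow]; linarith [pow_nonneg hk m]
  have h2 : (1 : ℝ) ≤ 2 ^ m := one_le_pow₀ (by norm_num)
  have h4 : (4 : ℝ) ^ (m + 1) = 4 * (2 ^ m * 2 ^ m) := by rw [pow_succ, ← mul_pow]; norm_num; ring
  simp only [pow_zero, mul_one, one_mul] at hz
  calc ‖coef φ k‖ * (1 + ‖k‖) ^ m ≤ ‖coef φ k‖ * (2 ^ m * (1 + ‖k‖ ^ m)) := by gcongr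
    _ = 2 ^ m * (‖coef φ k‖ + ‖coef φ k‖ * ‖k‖ ^ m) := by ring
    _ ≤ 2 ^ m * ((φ.seminorm 0 + φ.seminorm 0) + 2 ^ m * (φ.seminorm 0 + φ.seminorm m)) := by
        gcongr
    _ ≤ 2 ^ m * (2 ^ m * (φ.seminorm 0 + φ.seminorm 0) +
          2 ^ m * (φ.seminorm 0 + φ.seminorm m)) := by
        gcongr
        exact le_mul_of_one_le_left (by positivity) h2
    _ ≤ _ := by
        rw [h4]
        have : (0 : ℝ) < 2 ^ m * 2 ^ m := by positivity
        nlinarith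

end Fourier

end

section

section Fourier

variable {ι : Type} [Fintype ι]

/-! ### Fourier series of test functions -/

theorem summable_inv_one_add_norm_pow {d : Type} [Fintype d] {n : ℕ} (hn : Fintype.card d < n) :
    Summable fun k : d → ℤ => (1 + ‖k‖)⁻¹ ^ n := by
  set L : Submodule ℤ (d → ℝ) := Submodule.span ℤ (Set.range (Pi.basisFun ℝ d)) with hL
  have hrank : Module.finrank ℤ L = Fintype.card d := by
    rw [Module.finrank_eq_card_basis ((Pi.basisFun ℝ d).restrictScalars ℤ)]
  have hsum : Summable fun z : L => ‖z‖⁻¹ ^ n :=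
    ZLattice.summable_norm_pow_inv L n (by rw [hrank]; exact hn)
  have hmem : ∀ k : d → ℤ, (fun i => (k i : ℝ)) ∈ L := by
    intro k
    rw [hL, Module.Basis.mem_span_iff_repr_mem]
    intro i
    exact ⟨k i, by simp⟩
  let e : (d → ℤ) → L := fun k => ⟨fun i => (k i : ℝ), hmem k⟩
  have he : Function.Injective e := by
    intro k l h
    funext i
    have h : (k i : ℝ) = l i := congrFun (congrArg Subtype.val h) i
    exact_mod_cast h
  have hnorm : ∀ k, ‖e k‖ = ‖k‖ := fun k => rfl
  -- The comparison fails at `k = 0`, where the inverse norm is `0` by convention; finitely many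
  -- terms do not matter.
  refine Summable.of_norm_bounded_eventually (hsum.comp_injective he) ?_
  have hfin : ({0} : Set (d → ℤ)).Finite := Set.finite_singleton 0
  filter_upwards [hfin.compl_mem_cofinite] with k hk
  have hk0 : 0 < ‖k‖ := norm_pos_iff.2 hk
  rw [Real.norm_of_nonneg (by positivity), Function.comp_apply, hnorm]
  gcongr
  linarith

/-- A term of the Fourier series. -/
def fourierTerm (φ : TestFun ι) (k : Freq ι) : TestFun ι :=
  (coef φ k).re • cosFun k - (coef φ k).im • sinFun k

theorem norm_iteratedFDeriv_fourierTerm_le (φ : TestFun ι) (k : Freq ι) (m : ℕ)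
    (v : ι → Fin 4 → ℝ) : ‖iteratedFDeriv ℝ m (lift (fourierTerm φ k)) v‖ ≤
      2 * ‖coef φ k‖ * (Fintype.card (ι × Fin 4) * ‖k‖) ^ m := by
  have h1 : iteratedFDeriv ℝ m (lift (fourierTerm φ k)) v =
      (coef φ k).re • iteratedFDeriv ℝ m (lift (cosFun k)) v -
        (coef φ k).im • iteratedFDeriv ℝ m (lift (sinFun k)) v := by
    have h := congrArg (fun f => f v)
      (TestFun.derivMap_sub m ((coef φ k).re • cosFun k) ((coef φ k).im • sinFun k))
    rw [TestFun.derivMap_smul, TestFun.derivMap_smul] at h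
    exact h
  rw [h1, lift_cosFun, lift_sinFun]
  refine (norm_sub_le _ _).trans ?_
  rw [norm_smul, norm_smul, Real.norm_eq_abs, Real.norm_eq_abs]
  have hc := norm_iteratedFDeriv_comp_phase_le Real.contDiff_cos
    (fun m x => Real.abs_iteratedDeriv_cos_le_one m x) k m v
  have hs := norm_iteratedFDeriv_comp_phase_le Real.contDiff_sin
    (fun m x => Real.abs_iteratedDeriv_sin_le_one m x) k m v
  calc _ ≤ ‖coef φ k‖ * (Fintype.card (ι × Fin 4) * ‖k‖) ^ m +
        ‖coef φ k‖ * (Fintype.card (ι × Fin 4) * ‖k‖) ^ m := by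
        gcongr
        · exact Complex.abs_re_le_norm _
        · exact Complex.abs_im_le_norm _
    _ = _ := by ring

/-- The order of the seminorm that controls distributions. -/
def order (ι : Type) [Fintype ι] : ℕ := Fintype.card (ι × Fin 4) + 1

theorem summable_weight (ι : Type) [Fintype ι] :
    Summable fun k : Freq ι => (1 + ‖k‖)⁻¹ ^ order ι :=
  summable_inv_one_add_norm_pow (Nat.lt_succ_self _)

/-- The `m` factors `‖k‖` produced by differentiating a mode are paid for by `m` additional orders
of decay of the coefficients. -/
theorem exists_summable_bound (φ : TestFun ι) (m : ℕ) : ∃ u : Freq ι → ℝ, Summable u ∧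
    ∀ k v, ‖iteratedFDeriv ℝ m (lift (fourierTerm φ k)) v‖ ≤ u k := by
  refine ⟨_, (summable_weight ι).mul_left (2 * (4 ^ (order ι + m + 1) *
    (φ.seminorm 0 + φ.seminorm (order ι + m))) * (Fintype.card (ι × Fin 4) : ℝ) ^ m), fun k v => ?_⟩
  refine (norm_iteratedFDeriv_fourierTerm_le φ k m v).trans ?_
  have h := norm_coef_le_inv_pow (order ι + m) φ k
  have hk := norm_nonneg k
  have h0 := φ.seminorm_nonneg 0
  have hm := φ.seminorm_nonneg (order ι + m)
  calc 2 * ‖coef φ k‖ * (Fintype.card (ι × Fin 4) * ‖k‖) ^ m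
      ≤ 2 * (4 ^ (order ι + m + 1) * (φ.seminorm 0 + φ.seminorm (order ι + m)) *
          (1 + ‖k‖)⁻¹ ^ (order ι + m)) * (Fintype.card (ι × Fin 4) * (1 + ‖k‖)) ^ m := by
        gcongr
        linarith
    _ = _ := by
        rw [mul_pow, pow_add (1 + ‖k‖)⁻¹, inv_pow (1 + ‖k‖) m]
        have : (1 + ‖k‖) ^ m ≠ 0 := by positivity
        field_simp

theorem summable_coef (φ : TestFun ι) : Summable (coef φ) := by
  refine Summable.of_norm_bounded ((summable_weight ι).mul_left (4 ^ (order ι + 1) *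
    (φ.seminorm 0 + φ.seminorm (order ι)))) fun k => norm_coef_le_inv_pow _ φ k

theorem hasSum_fourierTerm_apply (φ : TestFun ι) (x : ι → T4) :
    HasSum (fun k => fourierTerm φ k x) (φ x) := by
  let f : C(UnitAddTorus (ι × Fin 4), ℂ) := ⟨fun θ => (φ (ofUnit θ) : ℂ),
    Complex.continuous_ofReal.comp
      ((continuous_of_contDiff_lift φ.contDiff_lift).comp continuous_ofUnit)⟩
  have h := UnitAddTorus.hasSum_mFourier_series_apply_of_summable (f := f) (summable_coef φ)
    (toUnit x)
  have h' := Complex.hasSum_re h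
  have hfx : (f (toUnit x)).re = φ x := by
    show (φ (ofUnit (toUnit x)) : ℂ).re = φ x
    rw [ofUnit_toUnit, Complex.ofReal_re]
  rw [hfx] at h'
  refine h'.congr_fun fun k => ?_
  rfl

/-- All derivatives converge uniformly by the majorants above, and the series may be differentiated
term by term. So the series converges in the topology of test functions and distributions can be
applied to it. -/
theorem hasSum_fourierTerm (φ : TestFun ι) : HasSum (fourierTerm φ) φ := by
  have key : ∀ m : ℕ, Tendsto (fun s : Finset (Freq ι) =>
      TestFun.derivMap m (∑ k ∈ s, fourierTerm φ k)) atTop (𝓝 (TestFun.derivMap m φ)) := by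
    intro m
    rw [ContinuousMap.tendsto_iff_tendstoLocallyUniformly]
    apply TendstoUniformly.tendstoLocallyUniformly
    obtain ⟨u, hu, hle⟩ := exists_summable_bound φ m
    have h := tendstoUniformly_tsum hu hle
    have hlim : (fun v => ∑' k, iteratedFDeriv ℝ m (lift (fourierTerm φ k)) v) =
        iteratedFDeriv ℝ m (lift φ) := by
      choose w hw hwle using exists_summable_bound φ
      have h1 := iteratedFDeriv_tsum (𝕜 := ℝ) (N := (⊤ : ℕ∞)) (f := fun k => lift (fourierTerm φ k))
        (v := w) (fun k => (fourierTerm φ k).contDiff_lift) (fun m _ => hw m)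
        (fun m k v _ => hwle m k v) (k := m) le_top
      rw [← h1]
      congr 1
      funext v
      exact (hasSum_fourierTerm_apply φ (toTorus v)).tsum_eq
    rw [hlim] at h
    have heq : (fun (s : Finset (Freq ι)) v =>
        TestFun.derivMap m (∑ k ∈ s, fourierTerm φ k) v) =
        fun s v => ∑ k ∈ s, iteratedFDeriv ℝ m (lift (fourierTerm φ k)) v := by
      funext s v
      have h2 : TestFun.derivMap m (∑ k ∈ s, fourierTerm φ k) =
          ∑ k ∈ s, TestFun.derivMap m (fourierTerm φ k) :=
        map_sum (AddMonoidHom.ofMapSub (TestFun.derivMap (ι := ι) m)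
          (TestFun.derivMap_sub m)) (fourierTerm φ) s
      rw [h2, ContinuousMap.sum_apply]
      rfl
    rw [← heq] at h
    exact h
  show Tendsto _ _ _
  rw [nhds_iInf, tendsto_iInf]
  intro m
  rw [nhds_induced, tendsto_comap_iff]
  exact key m

/-! ### Bounds on distributions -/

/-- The size of a distribution on the Fourier modes. -/
def fourierSize (u : Distr ι) : ENNReal :=
  ∑' k : Freq ι, ENNReal.ofReal ((1 + ‖k‖)⁻¹ ^ order ι) *
    (ENNReal.ofReal |u (cosFun k)| + ENNReal.ofReal |u (sinFun k)|)

/-- The seminorm that controls distributions. -/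
def testNorm (φ : TestFun ι) : ℝ :=
  4 ^ (order ι + 1) * (φ.seminorm 0 + φ.seminorm (order ι))

theorem testNorm_nonneg (φ : TestFun ι) : 0 ≤ testNorm φ :=
  mul_nonneg (by positivity) (add_nonneg (φ.seminorm_nonneg _) (φ.seminorm_nonneg _))

theorem continuous_testNorm_sub (ψ : TestFun ι) : Continuous fun φ => testNorm (φ - ψ) :=
  continuous_const.mul
    ((TestFun.continuous_seminorm_sub _ _).add (TestFun.continuous_seminorm_sub _ _))

theorem exists_testNorm_le {S : Set (TestFun ι)} (hS : Bornology.IsVonNBounded ℝ S) :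
    ∃ B, ∀ φ ∈ S, testNorm φ ≤ B := by
  obtain ⟨B₀, h0⟩ := TestFun.exists_seminorm_le hS 0
  obtain ⟨B₁, h1⟩ := TestFun.exists_seminorm_le hS (order ι)
  refine ⟨4 ^ (order ι + 1) * (B₀ + B₁), fun φ hφ => ?_⟩
  unfold testNorm
  gcongr
  · exact h0 φ hφ
  · exact h1 φ hφ

/-- Apply `u` to the Fourier series of `φ`: the coefficients are at most `testNorm φ` times the
weights that enter `fourierSize`. All of the dependence on `u` is thereby put into one number. -/
theorem ofReal_abs_apply_le (u : Distr ι) (φ : TestFun ι) :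
    ENNReal.ofReal |u φ| ≤ ENNReal.ofReal (testNorm φ) * fourierSize u := by
  have h := (hasSum_fourierTerm φ).mapL u
  have hle : ∀ k, ‖u (fourierTerm φ k)‖ₑ ≤ ENNReal.ofReal (testNorm φ) *
      (ENNReal.ofReal ((1 + ‖k‖)⁻¹ ^ order ι) *
        (ENNReal.ofReal |u (cosFun k)| + ENNReal.ofReal |u (sinFun k)|)) := by
    intro k
    rw [← ENNReal.ofReal_add (abs_nonneg _) (abs_nonneg _), ← ENNReal.ofReal_mul (by positivity),
      ← ENNReal.ofReal_mul (testNorm_nonneg φ), ← ofReal_norm]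
    apply ENNReal.ofReal_le_ofReal
    have hc := norm_coef_le_inv_pow (order ι) φ k
    rw [fourierTerm, map_sub, map_smul, map_smul, smul_eq_mul, smul_eq_mul]
    calc ‖(coef φ k).re * u (cosFun k) - (coef φ k).im * u (sinFun k)‖
        ≤ |(coef φ k).re| * |u (cosFun k)| + |(coef φ k).im| * |u (sinFun k)| := by
          refine (norm_sub_le _ _).trans ?_
          rw [norm_mul, norm_mul]
          rfl
      _ ≤ ‖coef φ k‖ * |u (cosFun k)| + ‖coef φ k‖ * |u (sinFun k)| := by
          gcongr
          · exact Complex.abs_re_le_norm _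
          · exact Complex.abs_im_le_norm _
      _ = ‖coef φ k‖ * (|u (cosFun k)| + |u (sinFun k)|) := by ring
      _ ≤ testNorm φ * (1 + ‖k‖)⁻¹ ^ order ι * (|u (cosFun k)| + |u (sinFun k)|) := by
          gcongr
          exact hc
      _ = _ := by ring
  calc ENNReal.ofReal |u φ| = ‖u φ‖ₑ := (Real.enorm_eq_ofReal_abs _).symm
    _ = ‖∑' k, u (fourierTerm φ k)‖ₑ := by rw [h.tsum_eq]
    _ ≤ ∑' k, ‖u (fourierTerm φ k)‖ₑ := enorm_tsum_le_tsum_enorm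
    _ ≤ ∑' k, ENNReal.ofReal (testNorm φ) * (ENNReal.ofReal ((1 + ‖k‖)⁻¹ ^ order ι) *
        (ENNReal.ofReal |u (cosFun k)| + ENNReal.ofReal |u (sinFun k)|)) :=
        ENNReal.tsum_le_tsum hle
    _ = _ := ENNReal.tsum_mul_left

end Fourier

end

section

section Series

variable {ι : Type} [Fintype ι]

/-! ### Convergence of series of distributions -/

theorem fourierSize_smul (c : ℝ) (u : Distr ι) :
    fourierSize (c • u) = ENNReal.ofReal |c| * fourierSize u := by
  unfold fourierSize
  rw [← ENNReal.tsum_mul_left]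
  refine tsum_congr fun k => ?_
  simp only [_root_.smul_apply, smul_eq_mul, abs_mul,
    ENNReal.ofReal_mul (abs_nonneg c)]
  ring

theorem abs_apply_le {u : Distr ι} (hu : fourierSize u ≠ ⊤) (φ : TestFun ι) :
    |u φ| ≤ testNorm φ * (fourierSize u).toReal := by
  have h := ofReal_abs_apply_le u φ
  rw [← ENNReal.ofReal_toReal hu, ← ENNReal.ofReal_mul (testNorm_nonneg φ)] at h
  exact (ENNReal.ofReal_le_ofReal_iff
    (mul_nonneg (testNorm_nonneg φ) ENNReal.toReal_nonneg)).1 h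

theorem summable_apply {u : ℕ → Distr ι} (hu : ∑' n, fourierSize (u n) ≠ ⊤) (φ : TestFun ι) :
    Summable fun n => u n φ :=
  Summable.of_norm_bounded ((ENNReal.summable_toReal hu).mul_left (testNorm φ)) fun n => by
    rw [Real.norm_eq_abs]
    exact abs_apply_le (ENNReal.ne_top_of_tsum_ne_top hu n) φ

theorem abs_tsum_apply_le {u : ℕ → Distr ι} (hu : ∑' n, fourierSize (u n) ≠ ⊤) (φ : TestFun ι) :
    |∑' n, u n φ| ≤ testNorm φ * ∑' n, (fourierSize (u n)).toReal := by
  rw [← tsum_mul_left]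
  rw [← Real.norm_eq_abs]
  exact tsum_of_norm_bounded ((ENNReal.summable_toReal hu).mul_left (testNorm φ)).hasSum fun n => by
    rw [Real.norm_eq_abs]
    exact abs_apply_le (ENNReal.ne_top_of_tsum_ne_top hu n) φ

/-- The sum of a series of distributions. -/
def distrSum (u : ℕ → Distr ι) (hu : ∑' n, fourierSize (u n) ≠ ⊤) : Distr ι where
  toFun φ := ∑' n, u n φ
  map_add' φ ψ := by
    simp only [map_add]
    exact (summable_apply hu φ).tsum_add (summable_apply hu ψ)
  map_smul' c φ := by
    simp only [map_smul, smul_eq_mul, RingHom.id_apply]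
    exact tsum_mul_left
  cont := by
    refine continuous_iff_continuousAt.2 fun ψ => ?_
    have h : Tendsto (fun φ : TestFun ι => testNorm (φ - ψ) * ∑' n, (fourierSize (u n)).toReal)
        (𝓝 ψ) (𝓝 0) := by
      have h1 := ((continuous_testNorm_sub ψ).mul_const
        (∑' n, (fourierSize (u n)).toReal)).tendsto ψ
      have h2 : testNorm (ψ - ψ) = 0 := by
        have := TestFun.seminorm_smul (ι := ι) 0 0 ψ
        have h' := TestFun.seminorm_smul (ι := ι) (order ι) 0 ψ
        rw [zero_smul, abs_zero, zero_mul] at this h'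
        rw [sub_self, testNorm, this, h']
        simp
      rwa [h2, zero_mul] at h1
    rw [ContinuousAt, tendsto_iff_norm_sub_tendsto_zero]
    refine squeeze_zero (fun φ => norm_nonneg _) (fun φ => ?_) h
    have h3 : (∑' n, u n φ) - ∑' n, u n ψ = ∑' n, u n (φ - ψ) := by
      simp only [map_sub]
      exact ((summable_apply hu φ).tsum_sub (summable_apply hu ψ)).symm
    show ‖(∑' n, u n φ) - ∑' n, u n ψ‖ ≤ _
    rw [h3]
    exact abs_tsum_apply_le hu _

theorem distrSum_apply (u : ℕ → Distr ι) (hu : ∑' n, fourierSize (u n) ≠ ⊤) (φ : TestFun ι) :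
    distrSum u hu φ = ∑' n, u n φ := rfl

/-- On a bounded set `testNorm` is bounded, so the tail of the sum of the sizes bounds the remainder
uniformly there, as the strong topology demands. -/
theorem tendsto_distrSum (u : ℕ → Distr ι) (hu : ∑' n, fourierSize (u n) ≠ ⊤) :
    Tendsto (fun N => ∑ n ∈ Finset.range N, u n) atTop (𝓝 (distrSum u hu)) := by
  refine (UniformConvergenceCLM.tendsto_iff_tendstoUniformlyOn (RingHom.id ℝ) (F := ℝ)
    {S : Set (TestFun ι) | Bornology.IsVonNBounded ℝ S}).2 fun S hS => ?_
  obtain ⟨B, hB⟩ := exists_testNorm_le hS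
  rw [Metric.tendstoUniformlyOn_iff]
  intro δ hδ
  have hsum := ENNReal.summable_toReal hu
  have htail := (tendsto_sum_nat_add fun n => (fourierSize (u n)).toReal).const_mul (max B 0)
  rw [mul_zero] at htail
  filter_upwards [htail.eventually_lt_const hδ] with N hN φ hφ
  have hu' : ∑' n, fourierSize (u (n + N)) ≠ ⊤ :=
    ne_top_of_le_ne_top hu (ENNReal.tsum_comp_le_tsum_of_injective (add_left_injective N)
      fun n => fourierSize (u n))
  have h1 : distrSum u hu φ - (∑ n ∈ Finset.range N, u n) φ = ∑' n, u (n + N) φ := by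
    rw [distrSum_apply, _root_.sum_apply, sub_eq_iff_eq_add']
    exact ((summable_apply hu φ).sum_add_tsum_nat_add N).symm
  show dist (distrSum u hu φ) ((∑ n ∈ Finset.range N, u n) φ) < δ
  rw [Real.dist_eq, h1]
  refine (abs_tsum_apply_le hu' φ).trans_lt (lt_of_le_of_lt ?_ hN)
  refine mul_le_mul_of_nonneg_right ((hB φ hφ).trans (le_max_left _ _))
    (tsum_nonneg fun n => ENNReal.toReal_nonneg)

/-! ### Measurability of random distributions -/

theorem measurable_apply_distr (φ : TestFun ι) : Measurable fun u : Distr ι => u φ :=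
  measurable_iff_comap_le.2 (le_iSup (fun φ : TestFun ι =>
    MeasurableSpace.comap (fun u : Distr ι => u φ) inferInstance) φ)

theorem measurable_distr_iff {Ω : Type*} [MeasurableSpace Ω] {U : Ω → Distr ι} :
    Measurable U ↔ ∀ φ, Measurable fun ω => U ω φ := by
  refine ⟨fun h φ => (measurable_apply_distr φ).comp h, fun h => ?_⟩
  rw [measurable_iff_comap_le]
  have : Distr.measurableSpace ι = ⨆ φ : TestFun ι, MeasurableSpace.comap
    (fun u : Distr ι => u φ) inferInstance := rfl
  rw [this, MeasurableSpace.comap_iSup]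
  refine iSup_le fun φ => ?_
  rw [MeasurableSpace.comap_comp]
  exact measurable_iff_comap_le.1 (h φ)

theorem measurable_fourierSize : Measurable (fourierSize : Distr ι → ENNReal) :=
  Measurable.tsum fun _ => ((measurable_apply_distr _).abs.ennreal_ofReal.add
    (measurable_apply_distr _).abs.ennreal_ofReal).const_mul _

open Classical in
/-- The sum of a series of random distributions, where it converges. -/
def randomSum {Ω : Type*} (u : ℕ → Ω → Distr ι) (ω : Ω) : Distr ι :=
  if h : ∑' n, fourierSize (u n ω) ≠ ⊤ then distrSum (fun n => u n ω) h else 0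

theorem measurable_randomSum {Ω : Type*} [MeasurableSpace Ω] {u : ℕ → Ω → Distr ι}
    (hu : ∀ n, Measurable (u n)) : Measurable (randomSum u) := by
  refine measurable_distr_iff.2 fun φ => ?_
  have hG : MeasurableSet {ω | ∑' n, fourierSize (u n ω) ≠ ⊤} := by
    have : Measurable fun ω => ∑' n, fourierSize (u n ω) :=
      Measurable.tsum fun n => measurable_fourierSize.comp (hu n)
    exact (this (measurableSet_singleton ⊤)).compl
  have hN : ∀ N : ℕ, Measurable ({ω | ∑' n, fourierSize (u n ω) ≠ ⊤}.indicator
      fun ω => ∑ n ∈ Finset.range N, u n ω φ) := fun N =>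
    (Finset.measurable_sum _ fun n _ => (measurable_apply_distr φ).comp (hu n)).indicator hG
  -- Tested against `φ`, the sum is a pointwise limit of partial sums cut off to the measurable set
  -- of convergence.
  refine measurable_of_tendsto_metrizable hN (tendsto_pi_nhds.2 fun ω => ?_)
  by_cases h : ∑' n, fourierSize (u n ω) ≠ ⊤
  · have h1 : ∀ N : ℕ, {ω | ∑' n, fourierSize (u n ω) ≠ ⊤}.indicator
        (fun ω => ∑ n ∈ Finset.range N, u n ω φ) ω = ∑ n ∈ Finset.range N, u n ω φ :=
      fun N => Set.indicator_of_mem (s := {ω | ∑' n, fourierSize (u n ω) ≠ ⊤}) h _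
    simp only [h1]
    rw [randomSum, dif_pos h, distrSum_apply]
    exact (summable_apply h φ).hasSum.tendsto_sum_nat
  · have h1 : ∀ N : ℕ, {ω | ∑' n, fourierSize (u n ω) ≠ ⊤}.indicator
        (fun ω => ∑ n ∈ Finset.range N, u n ω φ) ω = 0 :=
      fun N => Set.indicator_of_notMem (s := {ω | ∑' n, fourierSize (u n ω) ≠ ⊤}) h _
    simp only [h1]
    rw [randomSum, dif_neg h]
    exact tendsto_const_nhds

end Series

end

section

/-! ### Bounds on the fields -/

theorem integrable_green : Integrable green := by
  refine ⟨measurable_green.aestronglyMeasurable, ?_⟩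
  rw [hasFiniteIntegral_iff_ofReal (ae_of_all _ green_nonneg), lintegral_green]
  exact ENNReal.one_lt_top

theorem integral_green : ∫ x, green x = 1 := by
  rw [integral_eq_lintegral_of_nonneg_ae (ae_of_all _ green_nonneg)
    measurable_green.aestronglyMeasurable, lintegral_green, ENNReal.toReal_one]

theorem lintegral_prod_green_sub {L : Type} [Fintype L] (z : T4) :
    ∫⁻ x : L → T4, ENNReal.ofReal (∏ v, green (x v - z)) = 1 := by
  have hi : Integrable fun y : T4 => green (y - z) := integrable_green.comp_sub_right z
  have hp : Integrable fun x : L → T4 => ∏ v, green (x v - z) :=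
    Integrable.fintype_prod fun _ : L => hi
  rw [← ofReal_integral_eq_lintegral_ofReal hp
      (ae_of_all _ fun x => Finset.prod_nonneg fun v _ => green_nonneg _),
    integral_fintype_prod_volume_eq_prod fun (_ : L) (y : T4) => green (y - z)]
  simp [integral_sub_right_eq_self, integral_green]

/-- Integrate the four leaf variables first: each Green's function has total mass one, and the
volume of the torus is left for `z`. The bound is uniform over all Fourier modes. -/
theorem abs_covForm_le {φ ψ : TestFun (Fin 2)} (hφ : ∀ x, |φ x| ≤ 1) (hψ : ∀ x, |ψ x| ≤ 1) :
    |covForm φ ψ| ≤ (volume : Measure T4).real Set.univ := by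
  have hm : Measurable fun p : (Leaf → T4) × T4 => ENNReal.ofReal (∏ v, green (p.1 v - p.2)) :=
    (Finset.measurable_fun_prod _ fun v _ => measurable_green.comp
      (((measurable_pi_apply v).comp measurable_fst).sub measurable_snd)).ennreal_ofReal
  have key : ∫⁻ x : Leaf → T4, ‖φ (fun a => x (0, a)) * ψ (fun a => x (1, a)) *
      ∫ z : T4, ∏ v : Leaf, green (x v - z)‖ₑ ≤ volume (Set.univ : Set T4) := by
    calc _ ≤ ∫⁻ x : Leaf → T4, ∫⁻ z : T4, ENNReal.ofReal (∏ v, green (x v - z)) := by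
          refine lintegral_mono fun x => ?_
          rw [enorm_mul]
          have h1 : ‖φ (fun a => x (0, a)) * ψ (fun a => x (1, a))‖ₑ ≤ 1 := by
            rw [← ofReal_norm, Real.norm_eq_abs, abs_mul, ← ENNReal.ofReal_one]
            exact ENNReal.ofReal_le_ofReal (mul_le_one₀ (hφ _) (abs_nonneg _) (hψ _))
          refine (mul_le_mul' h1 (enorm_integral_le_lintegral_enorm _)).trans ?_
          rw [one_mul]
          refine lintegral_mono fun z => ?_
          rw [← ofReal_norm, Real.norm_of_nonneg
            (Finset.prod_nonneg fun v _ => green_nonneg _)]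
      _ = ∫⁻ z : T4, ∫⁻ x : Leaf → T4, ENNReal.ofReal (∏ v, green (x v - z)) :=
          lintegral_lintegral_swap hm.aemeasurable
      _ = volume (Set.univ : Set T4) := by simp only [lintegral_prod_green_sub, lintegral_one]
  rw [← Real.norm_eq_abs]
  refine (norm_integral_le_lintegral_norm _).trans ?_
  refine ENNReal.toReal_mono (measure_ne_top _ _) ?_
  simpa only [ofReal_norm] using key

variable {Ω : Type*} [MeasurableSpace Ω] {P : Measure Ω}
  {ρ : EuclideanSpace ℝ (Fin 4) → ℝ} {J : ℕ → Ω → Distr (Fin 2)}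

theorem IsFieldSequence.hasGaussianLaw (hJ : IsFieldSequence P ρ J) {n : ℕ} (hn : 1 ≤ n)
    (φ : TestFun (Fin 2)) : HasGaussianLaw (fun ω => J n ω φ) P :=
  hJ.gaussian.hasGaussianLaw_eval (⟨n, hn⟩, φ)

theorem sigma_mul_self (ρ : EuclideanSpace ℝ (Fin 4) → ℝ) (n : ℕ) :
    sigma ρ n * sigma ρ n = covCoeff ρ n n :=
  Real.mul_self_sqrt (covCoeff_nonneg ρ n n)

theorem sigma_nonneg (ρ : EuclideanSpace ℝ (Fin 4) → ℝ) (n : ℕ) : 0 ≤ sigma ρ n :=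
  Real.sqrt_nonneg _

theorem IsFieldSequence.integral_mul_self (hρ : IsMollifier ρ) (hJ : IsFieldSequence P ρ J) {n : ℕ}
    (hn : 1 ≤ n) (φ : TestFun (Fin 2)) : ∫ ω, J n ω φ * J n ω φ ∂P = covForm φ φ := by
  have h := sigma_pos hρ hn
  rw [hJ.covariance n n hn hn, ← sigma_mul_self, div_self (by positivity), one_mul]

theorem IsFieldSequence.lintegral_abs_le [IsProbabilityMeasure P] (hρ : IsMollifier ρ)
    (hJ : IsFieldSequence P ρ J)
    {n : ℕ} (hn : 1 ≤ n) {φ : TestFun (Fin 2)} (hφ : ∀ x, |φ x| ≤ 1) :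
    ∫⁻ ω, ENNReal.ofReal |J n ω φ| ∂P ≤
      ENNReal.ofReal (1 + (volume : Measure T4).real Set.univ) := by
  have h2 : Integrable (fun ω => J n ω φ * J n ω φ) P :=
    (hJ.hasGaussianLaw hn φ).memLp_two.integrable_mul (hJ.hasGaussianLaw hn φ).memLp_two
  have hi : Integrable (fun ω => 1 + J n ω φ * J n ω φ) P := (integrable_const 1).add h2
  calc _ ≤ ∫⁻ ω, ENNReal.ofReal (1 + J n ω φ * J n ω φ) ∂P := by
        refine lintegral_mono fun ω => ENNReal.ofReal_le_ofReal ?_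
        nlinarith [abs_mul_abs_self (J n ω φ), sq_nonneg (|J n ω φ| - 1)]
    _ = ENNReal.ofReal (∫ ω, (1 + J n ω φ * J n ω φ) ∂P) :=
        (ofReal_integral_eq_lintegral_ofReal hi (ae_of_all _ fun ω =>
          add_nonneg zero_le_one (mul_self_nonneg _))).symm
    _ ≤ _ := by
        refine ENNReal.ofReal_le_ofReal ?_
        rw [integral_add (integrable_const 1) h2, hJ.integral_mul_self hρ hn]
        simpa using (le_abs_self _).trans (abs_covForm_le hφ hφ)

/-- A bound on the expected size of the fields. -/
def fieldBound : ENNReal :=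
  ∑' k : Freq (Fin 2), ENNReal.ofReal ((1 + ‖k‖)⁻¹ ^ order (Fin 2)) *
    (2 * ENNReal.ofReal (1 + (volume : Measure T4).real Set.univ))

theorem fieldBound_ne_top : fieldBound ≠ ⊤ := by
  rw [fieldBound, ENNReal.tsum_mul_right]
  exact ENNReal.mul_ne_top (summable_weight (Fin 2)).tsum_ofReal_ne_top
    (ENNReal.mul_ne_top (by simp) ENNReal.ofReal_ne_top)

theorem IsFieldSequence.lintegral_fourierSize_le [IsProbabilityMeasure P] (hρ : IsMollifier ρ)
    (hJ : IsFieldSequence P ρ J) {n : ℕ} (hn : 1 ≤ n) :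
    ∫⁻ ω, fourierSize (J n ω) ∂P ≤ fieldBound := by
  have hm : ∀ φ, Measurable fun ω => ENNReal.ofReal |J n ω φ| := fun φ =>
    (measurable_distr_iff.1 (hJ.measurable n hn) φ).abs.ennreal_ofReal
  unfold fourierSize
  have hm2 : ∀ φ ψ, Measurable fun ω =>
      ENNReal.ofReal |J n ω φ| + ENNReal.ofReal |J n ω ψ| := fun φ ψ => (hm φ).add (hm ψ)
  rw [lintegral_tsum fun k => ((hm2 (cosFun k) (sinFun k)).const_mul _).aemeasurable]
  refine ENNReal.tsum_le_tsum fun k => ?_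
  rw [lintegral_const_mul _ (hm2 _ _), lintegral_add_left (hm _), two_mul]
  gcongr
  · exact hJ.lintegral_abs_le hρ hn (abs_cosFun_le k)
  · exact hJ.lintegral_abs_le hρ hn (abs_sinFun_le k)

/-- The terms of the series `𝒰`. -/
def fieldTerm (ρ : EuclideanSpace ℝ (Fin 4) → ℝ) (J : ℕ → Ω → Distr (Fin 2)) (lam : ℝ) (n : ℕ)
    (ω : Ω) : Distr (Fin 2) :=
  (sigma ρ (n + 1) * lam ^ n) • J (n + 1) ω

theorem abs_sigma_mul_pow_le (hρ : IsMollifier ρ) (lam : ℝ) (n : ℕ) :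
    |sigma ρ (n + 1) * lam ^ n| ≤ (|lam| / (Real.sqrt 2 * Real.pi)) ^ n := by
  have hpi := Real.pi_pos
  have h1 : sigma ρ (n + 1) ≤ (1 / (Real.sqrt 2 * Real.pi)) ^ n := by
    refine Real.sqrt_le_iff.2 ⟨by positivity, (covCoeff_le hρ n).trans (le_of_eq ?_)⟩
    rw [← pow_mul, mul_comm n 2, pow_mul, div_pow _ (Real.sqrt 2 * Real.pi), mul_pow,
      Real.sq_sqrt (by norm_num), one_pow]
  rw [abs_mul, abs_pow, abs_of_nonneg (sigma_nonneg ρ (n + 1)),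
    div_eq_mul_one_div, mul_pow, mul_comm]
  exact mul_le_mul_of_nonneg_left h1 (by positivity)

theorem ratio_lt_one {lam : ℝ} (hlam : |lam| < Real.sqrt 2 * Real.pi) :
    |lam| / (Real.sqrt 2 * Real.pi) < 1 :=
  (div_lt_one (by positivity)).2 hlam

theorem measurable_fieldTerm (hJ : IsFieldSequence P ρ J) (lam : ℝ) (n : ℕ) :
    Measurable (fieldTerm ρ J lam n) :=
  measurable_distr_iff.2 fun φ =>
    (measurable_distr_iff.1 (hJ.measurable (n + 1) n.succ_pos) φ).const_mul
      (sigma ρ (n + 1) * lam ^ n)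

/-- The expected sizes are dominated by a geometric series of ratio `|λ̂| / (√2 π)`. Convergence of
the expectations is enough; no independence enters. -/
theorem ae_tsum_fourierSize_ne_top [IsProbabilityMeasure P] (hρ : IsMollifier ρ)
    (hJ : IsFieldSequence P ρ J) {lam : ℝ} (hlam : |lam| < Real.sqrt 2 * Real.pi) :
    ∀ᵐ ω ∂P, ∑' n, fourierSize (fieldTerm ρ J lam n ω) ≠ ⊤ := by
  have hm : ∀ n, Measurable fun ω => fourierSize (fieldTerm ρ J lam n ω) := fun n =>
    measurable_fourierSize.comp (measurable_fieldTerm hJ lam n)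
  have hfin : ∫⁻ ω, ∑' n, fourierSize (fieldTerm ρ J lam n ω) ∂P ≠ ⊤ := by
    rw [lintegral_tsum fun n => (hm n).aemeasurable]
    have hle : ∀ n, ∫⁻ ω, fourierSize (fieldTerm ρ J lam n ω) ∂P ≤
        ENNReal.ofReal ((|lam| / (Real.sqrt 2 * Real.pi)) ^ n) * fieldBound := by
      intro n
      unfold fieldTerm
      simp only [fourierSize_smul]
      have hm' : Measurable fun ω => fourierSize (J (n + 1) ω) :=
        measurable_fourierSize.comp (hJ.measurable (n + 1) n.succ_pos)
      rw [lintegral_const_mul _ hm']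
      exact mul_le_mul' (ENNReal.ofReal_le_ofReal (abs_sigma_mul_pow_le hρ lam n))
        (hJ.lintegral_fourierSize_le hρ n.succ_pos)
    refine ne_top_of_le_ne_top ?_ (ENNReal.tsum_le_tsum hle)
    rw [ENNReal.tsum_mul_right]
    exact ENNReal.mul_ne_top (summable_geometric_of_lt_one (by positivity)
      (ratio_lt_one hlam)).tsum_ofReal_ne_top fieldBound_ne_top
  filter_upwards [ae_lt_top (Measurable.tsum hm) hfin] with ω hω using hω.ne

theorem ae_tendsto_field [IsProbabilityMeasure P] (hρ : IsMollifier ρ)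
    (hJ : IsFieldSequence P ρ J) {lam : ℝ} (hlam : |lam| < Real.sqrt 2 * Real.pi) :
    ∀ᵐ ω ∂P, Tendsto (fun N => ∑ n ∈ Finset.range N, fieldTerm ρ J lam n ω) atTop
      (𝓝 (randomSum (fieldTerm ρ J lam) ω)) := by
  filter_upwards [ae_tsum_fourierSize_ne_top hρ hJ hlam] with ω hω
  rw [randomSum, dif_pos hω]
  exact tendsto_distrSum (fun n => fieldTerm ρ J lam n ω) hω

theorem ae_tendsto_field_apply [IsProbabilityMeasure P] (hρ : IsMollifier ρ)
    (hJ : IsFieldSequence P ρ J) {lam : ℝ} (hlam : |lam| < Real.sqrt 2 * Real.pi)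
    (φ : TestFun (Fin 2)) :
    ∀ᵐ ω ∂P, Tendsto (fun N => ∑ n ∈ Finset.range N, fieldTerm ρ J lam n ω φ) atTop
      (𝓝 (randomSum (fieldTerm ρ J lam) ω φ)) := by
  filter_upwards [ae_tsum_fourierSize_ne_top hρ hJ hlam] with ω hω
  rw [randomSum, dif_pos hω, distrSum_apply]
  exact (summable_apply hω φ).hasSum.tendsto_sum_nat

theorem sum_Icc_eq_sum_fieldTerm {α : Type*} (ρ : EuclideanSpace ℝ (Fin 4) → ℝ)
    (J : ℕ → α → Distr (Fin 2)) (lam : ℝ) (N : ℕ) (ω : α) :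
    ∑ n ∈ Finset.Icc 1 N, (sigma ρ n * lam ^ (n - 1)) • J n ω =
      ∑ n ∈ Finset.range N, fieldTerm ρ J lam n ω := by
  rw [← Finset.Ico_add_one_right_eq_Icc, Finset.sum_Ico_eq_sum_range]
  refine Finset.sum_congr rfl fun n _ => ?_
  rw [fieldTerm, add_comm 1 n, Nat.add_sub_cancel]

end

section

/-! ### The limiting variance -/

variable {ρ : EuclideanSpace ℝ (Fin 4) → ℝ}

theorem ratio_sq_lt {lam : ℝ} (hlam : |lam| < Real.sqrt 2 * Real.pi) :
    lam ^ 2 < 2 * Real.pi ^ 2 := by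
  have h := pow_lt_pow_left₀ hlam (abs_nonneg _) two_ne_zero
  rwa [sq_abs, mul_pow, Real.sq_sqrt (by norm_num)] at h

theorem hasSum_geometric {lam : ℝ} (hlam : |lam| < Real.sqrt 2 * Real.pi) :
    HasSum (fun n : ℕ => (lam ^ 2 / (2 * Real.pi ^ 2)) ^ n)
      (2 * Real.pi ^ 2 / (2 * Real.pi ^ 2 - lam ^ 2)) := by
  have hpi := Real.pi_pos
  have h := ratio_sq_lt hlam
  have h1 := hasSum_geometric_of_lt_one (r := lam ^ 2 / (2 * Real.pi ^ 2)) (by positivity)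
    ((div_lt_one (by positivity)).2 h)
  convert h1 using 1
  have h2 : 2 * Real.pi ^ 2 - lam ^ 2 ≠ 0 := by linarith
  field_simp

theorem sum_antidiagonal_pow_mul_covCoeff (hρ : IsMollifier ρ) (lam : ℝ) (K : ℕ) :
    ∑ p ∈ Finset.HasAntidiagonal.antidiagonal (2 * K),
      lam ^ (p.1 + p.2) * covCoeff ρ (p.1 + 1) (p.2 + 1) = (lam ^ 2 / (2 * Real.pi ^ 2)) ^ K := by
  rw [div_eq_mul_one_div, mul_pow, ← sum_antidiagonal_covCoeff hρ K, Finset.mul_sum]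
  refine Finset.sum_congr rfl fun p hp => ?_
  rw [Finset.HasAntidiagonal.mem_antidiagonal.1 hp, pow_mul]

/-- Coefficients with `n + m` odd vanish, so every term is nonnegative even for negative `λ̂`. The
double series may therefore be summed along diagonals, where it is geometric. -/
theorem hasSum_covCoeff (hρ : IsMollifier ρ) {lam : ℝ} (hlam : |lam| < Real.sqrt 2 * Real.pi) :
    HasSum (fun p : ℕ × ℕ => lam ^ (p.1 + p.2) * covCoeff ρ (p.1 + 1) (p.2 + 1))
      (2 * Real.pi ^ 2 / (2 * Real.pi ^ 2 - lam ^ 2)) := by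
  have hodd : ∀ p : ℕ × ℕ, Odd (p.1 + p.2) → covCoeff ρ (p.1 + 1) (p.2 + 1) = 0 := fun p hp =>
    covCoeff_of_odd ρ (by
      have h : p.1 + 1 + (p.2 + 1) = p.1 + p.2 + 2 := by ring
      rw [h]
      exact hp.add_even even_two)
  have hnn : ∀ p : ℕ × ℕ, 0 ≤ lam ^ (p.1 + p.2) * covCoeff ρ (p.1 + 1) (p.2 + 1) := fun p => by
    rcases Nat.even_or_odd (p.1 + p.2) with h | h
    · exact mul_nonneg (h.pow_nonneg lam) (covCoeff_nonneg ρ _ _)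
    · rw [hodd p h, mul_zero]
  have hdiag : HasSum (fun n : ℕ => ∑ p ∈ Finset.HasAntidiagonal.antidiagonal n,
      lam ^ (p.1 + p.2) * covCoeff ρ (p.1 + 1) (p.2 + 1))
      (2 * Real.pi ^ 2 / (2 * Real.pi ^ 2 - lam ^ 2)) := by
    have hinj : Function.Injective fun K : ℕ => 2 * K := fun a b h => by
      simpa using h
    rw [← hinj.hasSum_iff]
    · simpa only [Function.comp_def, sum_antidiagonal_pow_mul_covCoeff hρ] using
        hasSum_geometric hlam
    · intro n hn
      have hn' : Odd n := by
        rw [← Nat.not_even_iff_odd]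
        rintro ⟨k, hk⟩
        exact hn ⟨k, by simp only; omega⟩
      refine Finset.sum_eq_zero fun p hp => ?_
      rw [hodd p ((Finset.HasAntidiagonal.mem_antidiagonal.1 hp).symm ▸ hn'), mul_zero]
  rw [← (Finset.HasAntidiagonal.sigmaAntidiagonalEquivProd (A := ℕ)).hasSum_iff]
  have hin : ∀ n : ℕ, HasSum (fun q : Finset.HasAntidiagonal.antidiagonal n =>
      lam ^ (q.1.1 + q.1.2) * covCoeff ρ (q.1.1 + 1) (q.1.2 + 1))
      (∑ p ∈ Finset.HasAntidiagonal.antidiagonal n,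
        lam ^ (p.1 + p.2) * covCoeff ρ (p.1 + 1) (p.2 + 1)) := fun n =>
    Finset.hasSum (Finset.HasAntidiagonal.antidiagonal n) fun p : ℕ × ℕ =>
      lam ^ (p.1 + p.2) * covCoeff ρ (p.1 + 1) (p.2 + 1)
  have hs : Summable ((fun p : ℕ × ℕ => lam ^ (p.1 + p.2) * covCoeff ρ (p.1 + 1) (p.2 + 1)) ∘
      Finset.HasAntidiagonal.sigmaAntidiagonalEquivProd (A := ℕ)) := by
    refine (summable_sigma_of_nonneg fun q => hnn _).2 ⟨fun n => (hin n).summable, ?_⟩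
    refine hdiag.summable.congr fun n => ?_
    exact (hin n).tsum_eq.symm
  have h2 := hs.hasSum.sigma hin
  exact (h2.unique hdiag) ▸ hs.hasSum

theorem tendsto_sum_covCoeff (hρ : IsMollifier ρ) {lam : ℝ}
    (hlam : |lam| < Real.sqrt 2 * Real.pi) :
    Tendsto (fun N : ℕ => ∑ n ∈ Finset.range N, ∑ m ∈ Finset.range N,
      lam ^ (n + m) * covCoeff ρ (n + 1) (m + 1)) atTop
      (𝓝 (2 * Real.pi ^ 2 / (2 * Real.pi ^ 2 - lam ^ 2))) := by
  -- The variances of the partial sums are sums over squares, which also exhaust `ℕ × ℕ`.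
  have h : Tendsto (fun N : ℕ => Finset.range N ×ˢ Finset.range N) atTop atTop := by
    refine tendsto_atTop_finset_of_monotone (fun a b hab => Finset.product_subset_product
      (Finset.range_mono hab) (Finset.range_mono hab)) fun p => ⟨p.1 + p.2 + 1, ?_⟩
    simp only [Finset.mem_product, Finset.mem_range]
    omega
  refine ((hasSum_covCoeff hρ hlam).comp h).congr fun N => ?_
  exact Finset.sum_product _ _ _

end

section

/-! ### Laws of random distributions -/

section Law

variable {ι : Type} [Fintype ι]

theorem Distr.measurableSpace_eq_comap :
    Distr.measurableSpace ι =
      MeasurableSpace.comap (fun (u : Distr ι) (φ : TestFun ι) => u φ) MeasurableSpace.pi := by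
  have h : (MeasurableSpace.pi : MeasurableSpace (TestFun ι → ℝ)) =
    ⨆ φ, MeasurableSpace.comap (fun f : TestFun ι → ℝ => f φ) inferInstance := rfl
  rw [h, MeasurableSpace.comap_iSup]
  simp only [MeasurableSpace.comap_comp]
  rfl

theorem measurable_coe_distr : Measurable fun (u : Distr ι) (φ : TestFun ι) => u φ :=
  measurable_pi_lambda _ measurable_apply_distr

/-- A linear form in finitely many evaluations is the evaluation at a linear combination of the test
functions, so the functional determines all finite-dimensional characteristic functions. -/
theorem map_restrict_eq_of_charFun {μ ν : Measure (Distr ι)} [IsFiniteMeasure μ]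
    [IsFiniteMeasure ν]
    (h : ∀ φ : TestFun ι, ∫ u, Complex.exp (u φ * Complex.I) ∂μ =
      ∫ u, Complex.exp (u φ * Complex.I) ∂ν) (S : Finset (TestFun ι)) :
    μ.map (fun u => S.restrict fun φ => u φ) = ν.map (fun u => S.restrict fun φ => u φ) := by
  classical
  have hm : Measurable fun (u : Distr ι) => S.restrict fun φ : TestFun ι => u φ :=
    (Finset.measurable_restrict S).comp measurable_coe_distr
  refine Measure.ext_of_charFunDual (funext fun L => ?_)
  have hL : ∀ u : Distr ι, L (S.restrict fun φ => u φ) =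
      u (∑ i : S, L (fun j => if i = j then 1 else 0) • i.1) := fun u => by
    rw [map_sum]
    refine (L.toLinearMap.pi_apply_eq_sum_univ _).trans ?_
    refine Finset.sum_congr rfl fun i _ => ?_
    rw [map_smul, smul_eq_mul, smul_eq_mul, mul_comm]
    rfl
  have hc : Measurable fun x : S → ℝ => Complex.exp (L x * Complex.I) := by fun_prop
  rw [charFunDual_apply, charFunDual_apply, integral_map hm.aemeasurable hc.aestronglyMeasurable,
    integral_map hm.aemeasurable hc.aestronglyMeasurable]
  simp only [hL]
  exact h _

/-- The law of a random distribution is determined by its characteristic functional. -/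
theorem Distr.ext_of_charFun {μ ν : Measure (Distr ι)} [IsFiniteMeasure μ] [IsFiniteMeasure ν]
    (h : ∀ φ : TestFun ι, ∫ u, Complex.exp (u φ * Complex.I) ∂μ =
      ∫ u, Complex.exp (u φ * Complex.I) ∂ν) : μ = ν := by
  have hμ := isProjectiveLimit_map (P := μ) (X := fun (φ : TestFun ι) (u : Distr ι) => u φ)
    measurable_coe_distr.aemeasurable
  have hν := isProjectiveLimit_map (P := ν) (X := fun (φ : TestFun ι) (u : Distr ι) => u φ)
    measurable_coe_distr.aemeasurable
  simp only [map_restrict_eq_of_charFun h] at hμ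
  have heq := hμ.unique hν
  -- The cylindrical σ-algebra is pulled back from the product, so equality of the laws there
  -- suffices.
  refine Measure.ext fun A hA => ?_
  rw [Distr.measurableSpace_eq_comap] at hA
  obtain ⟨B, hB, rfl⟩ := hA
  rw [← Measure.map_apply measurable_coe_distr hB, heq, Measure.map_apply measurable_coe_distr hB]

end Law

/-! ### The law of the limiting field -/

theorem integral_cexp_of_hasGaussianLaw {Ω : Type*} [MeasurableSpace Ω] {P : Measure Ω}
    {X : Ω → ℝ} (hX : HasGaussianLaw X P) (h0 : ∫ ω, X ω ∂P = 0) :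
    ∫ ω, Complex.exp (X ω * Complex.I) ∂P = Complex.exp (-((∫ ω, X ω * X ω ∂P : ℝ) : ℂ) / 2) := by
  have := hX.isProbabilityMeasure
  have hvar : Var[X; P] = ∫ ω, X ω * X ω ∂P := by
    rw [variance_of_integral_eq_zero hX.aemeasurable h0]
    simp only [sq]
  have hnn : 0 ≤ ∫ ω, X ω * X ω ∂P := integral_nonneg fun ω => mul_self_nonneg _
  have h := charFun_gaussianReal (μ := P[X]) (v := Var[X; P].toNNReal) 1
  rw [← hX.map_eq_gaussianReal, charFun_apply_real, integral_map hX.aemeasurable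
    (Measurable.aestronglyMeasurable (by fun_prop)), h0, hvar, Real.coe_toNNReal _ hnn] at h
  simpa [neg_div] using h

theorem IsFieldI.integral_cexp {Ω : Type*} [MeasurableSpace Ω] {Q : Measure Ω}
    {I : Ω → Distr (Fin 2)} (hI : IsFieldI Q I) (φ : TestFun (Fin 2)) :
    ∫ ω, Complex.exp (I ω φ * Complex.I) ∂Q = Complex.exp (-(covForm φ φ : ℂ) / 2) := by
  rw [integral_cexp_of_hasGaussianLaw (hI.gaussian.hasGaussianLaw_eval φ) (hI.centred φ),
    hI.covariance]

theorem covForm_smul (c : ℝ) (φ : TestFun (Fin 2)) :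
    covForm (c • φ) (c • φ) = c ^ 2 * covForm φ φ := by
  unfold covForm
  rw [← integral_const_mul]
  refine integral_congr_ae (ae_of_all _ fun x => ?_)
  show c * φ _ * (c * φ _) * _ = _
  ring

theorem fieldTerm_apply {α : Type*} (ρ : EuclideanSpace ℝ (Fin 4) → ℝ)
    (J : ℕ → α → Distr (Fin 2)) (lam : ℝ) (n : ℕ) (ω : α) (φ : TestFun (Fin 2)) :
    fieldTerm ρ J lam n ω φ = sigma ρ (n + 1) * lam ^ n * J (n + 1) ω φ := rfl

variable {Ω : Type*} [MeasurableSpace Ω] {P : Measure Ω}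
  {ρ : EuclideanSpace ℝ (Fin 4) → ℝ} {J : ℕ → Ω → Distr (Fin 2)}

theorem IsFieldSequence.hasGaussianLaw_sum (hJ : IsFieldSequence P ρ J) (lam : ℝ) (N : ℕ)
    (φ : TestFun (Fin 2)) :
    HasGaussianLaw (fun ω => ∑ n ∈ Finset.range N, fieldTerm ρ J lam n ω φ) P :=
  ((hJ.gaussian.comp_right fun n : ℕ =>
    ((⟨n + 1, n.succ_pos⟩, φ) : {n : ℕ // 1 ≤ n} × TestFun (Fin 2))).smul
    fun n => sigma ρ (n + 1) * lam ^ n).hasGaussianLaw_fun_sum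

theorem IsFieldSequence.integral_fieldTerm (hJ : IsFieldSequence P ρ J) (lam : ℝ) (n : ℕ)
    (φ : TestFun (Fin 2)) : ∫ ω, fieldTerm ρ J lam n ω φ ∂P = 0 := by
  simp only [fieldTerm_apply]
  rw [integral_const_mul, hJ.centred _ n.succ_pos, mul_zero]

theorem IsFieldSequence.integral_fieldTerm_mul (hρ : IsMollifier ρ) (hJ : IsFieldSequence P ρ J)
    (lam : ℝ) (n m : ℕ) (φ : TestFun (Fin 2)) :
    ∫ ω, fieldTerm ρ J lam n ω φ * fieldTerm ρ J lam m ω φ ∂P =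
      lam ^ (n + m) * covCoeff ρ (n + 1) (m + 1) * covForm φ φ := by
  have hn := (sigma_pos hρ n.succ_pos).ne'
  have hm := (sigma_pos hρ m.succ_pos).ne'
  have h : ∀ ω, fieldTerm ρ J lam n ω φ * fieldTerm ρ J lam m ω φ =
      sigma ρ (n + 1) * lam ^ n * (sigma ρ (m + 1) * lam ^ m) *
        (J (n + 1) ω φ * J (m + 1) ω φ) := fun ω => by
    rw [fieldTerm_apply, fieldTerm_apply]
    ring
  simp only [h]
  rw [integral_const_mul, hJ.covariance _ _ n.succ_pos m.succ_pos]
  field_simp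
  ring

theorem IsFieldSequence.memLp_fieldTerm (hJ : IsFieldSequence P ρ J) (lam : ℝ) (n : ℕ)
    (φ : TestFun (Fin 2)) : MemLp (fun ω => fieldTerm ρ J lam n ω φ) 2 P :=
  (hJ.hasGaussianLaw n.succ_pos φ).memLp_two.const_mul (sigma ρ (n + 1) * lam ^ n)

theorem IsFieldSequence.integral_sum_mul_self (hρ : IsMollifier ρ)
    (hJ : IsFieldSequence P ρ J) (lam : ℝ) (N : ℕ) (φ : TestFun (Fin 2)) :
    ∫ ω, (∑ n ∈ Finset.range N, fieldTerm ρ J lam n ω φ) *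
        ∑ n ∈ Finset.range N, fieldTerm ρ J lam n ω φ ∂P =
      (∑ n ∈ Finset.range N, ∑ m ∈ Finset.range N,
        lam ^ (n + m) * covCoeff ρ (n + 1) (m + 1)) * covForm φ φ := by
  have hi : ∀ n m, Integrable
      (fun ω => fieldTerm ρ J lam n ω φ * fieldTerm ρ J lam m ω φ) P := fun n m =>
    (hJ.memLp_fieldTerm lam n φ).integrable_mul (hJ.memLp_fieldTerm lam m φ)
  simp only [Finset.sum_mul_sum]
  rw [integral_finsetSum _ fun n _ => integrable_finsetSum _ fun m _ => hi n m, Finset.sum_mul]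
  refine Finset.sum_congr rfl fun n _ => ?_
  rw [integral_finsetSum _ fun m _ => hi n m, Finset.sum_mul]
  exact Finset.sum_congr rfl fun m _ => hJ.integral_fieldTerm_mul hρ lam n m φ

theorem IsFieldSequence.integral_cexp_sum [IsProbabilityMeasure P] (hρ : IsMollifier ρ)
    (hJ : IsFieldSequence P ρ J) (lam : ℝ) (N : ℕ) (φ : TestFun (Fin 2)) :
    ∫ ω, Complex.exp ((∑ n ∈ Finset.range N, fieldTerm ρ J lam n ω φ : ℝ) * Complex.I) ∂P =
      Complex.exp (-(((∑ n ∈ Finset.range N, ∑ m ∈ Finset.range N,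
        lam ^ (n + m) * covCoeff ρ (n + 1) (m + 1)) * covForm φ φ : ℝ) : ℂ) / 2) := by
  rw [integral_cexp_of_hasGaussianLaw (hJ.hasGaussianLaw_sum lam N φ),
    hJ.integral_sum_mul_self hρ]
  rw [integral_finsetSum _ fun n _ => (hJ.memLp_fieldTerm lam n φ).integrable one_le_two]
  exact Finset.sum_eq_zero fun n _ => hJ.integral_fieldTerm lam n φ

/-- The partial sums are Gaussian because the fields are jointly Gaussian. Dominated convergence
passes to the limit on the left, and the convergence of the variances does so on the right. -/
theorem integral_cexp_field [IsProbabilityMeasure P] (hρ : IsMollifier ρ)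
    (hJ : IsFieldSequence P ρ J) {lam : ℝ} (hlam : |lam| < Real.sqrt 2 * Real.pi)
    (φ : TestFun (Fin 2)) :
    ∫ ω, Complex.exp (randomSum (fieldTerm ρ J lam) ω φ * Complex.I) ∂P =
      Complex.exp (-((2 * Real.pi ^ 2 / (2 * Real.pi ^ 2 - lam ^ 2) * covForm φ φ : ℝ) : ℂ) / 2) := by
  have hm : ∀ n, Measurable fun ω => fieldTerm ρ J lam n ω φ := fun n =>
    measurable_distr_iff.1 (measurable_fieldTerm hJ lam n) φ
  have h1 : Tendsto (fun N : ℕ => ∫ ω, Complex.exp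
      ((∑ n ∈ Finset.range N, fieldTerm ρ J lam n ω φ : ℝ) * Complex.I) ∂P) atTop
      (𝓝 (∫ ω, Complex.exp (randomSum (fieldTerm ρ J lam) ω φ * Complex.I) ∂P)) := by
    refine tendsto_integral_of_dominated_convergence (fun _ => 1) (fun N => ?_)
      (integrable_const 1) (fun N => ae_of_all _ fun ω => ?_) ?_
    · have hs : Measurable fun ω => ∑ n ∈ Finset.range N, fieldTerm ρ J lam n ω φ :=
        Finset.measurable_sum _ fun n _ => hm n
      exact ((Complex.measurable_ofReal.comp hs).mul_const
        Complex.I).cexp.aestronglyMeasurable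
    · exact (Complex.norm_exp_ofReal_mul_I _).le
    · filter_upwards [ae_tendsto_field_apply hρ hJ hlam φ] with ω hω
      exact ((Complex.continuous_exp.comp
        (Complex.continuous_ofReal.mul continuous_const)).tendsto _).comp hω
  simp only [hJ.integral_cexp_sum hρ] at h1
  refine tendsto_nhds_unique h1 ?_
  have hc : Continuous fun v : ℝ => Complex.exp (-((v * covForm φ φ : ℝ) : ℂ) / 2) := by
    fun_prop
  exact (hc.tendsto _).comp (tendsto_sum_covCoeff hρ hlam)

theorem map_field_eq [IsProbabilityMeasure P] (hρ : IsMollifier ρ)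
    (hJ : IsFieldSequence P ρ J) {lam : ℝ} (hlam : |lam| < Real.sqrt 2 * Real.pi)
    {Ω' : Type*} [MeasurableSpace Ω'] {Q : Measure Ω'} [IsProbabilityMeasure Q]
    {I : Ω' → Distr (Fin 2)} (hI : IsFieldI Q I) :
    P.map (randomSum (fieldTerm ρ J lam)) = Q.map fun ω => sigmaEff lam • I ω := by
  have hU : Measurable (randomSum (fieldTerm ρ J lam)) :=
    measurable_randomSum (measurable_fieldTerm hJ lam)
  have hV : Measurable fun ω => sigmaEff lam • I ω := measurable_distr_iff.2 fun φ =>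
    (measurable_distr_iff.1 hI.measurable φ).const_mul (sigmaEff lam)
  refine Distr.ext_of_charFun fun φ => ?_
  have hc : Measurable fun u : Distr (Fin 2) => Complex.exp (u φ * Complex.I) :=
    ((Complex.measurable_ofReal.comp (measurable_apply_distr φ)).mul_const Complex.I).cexp
  rw [integral_map hU.aemeasurable hc.aestronglyMeasurable,
    integral_map hV.aemeasurable hc.aestronglyMeasurable, integral_cexp_field hρ hJ hlam]
  -- Testing `σ_eff I` against `φ` is testing `I` against `σ_eff φ`, which multiplies the variance
  -- by `σ_eff²`.
  have h := hI.integral_cexp (sigmaEff lam • φ)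
  rw [covForm_smul, sigmaEff, Real.sq_sqrt
    (div_nonneg (by positivity) (sub_nonneg.2 (ratio_sq_lt hlam).le))] at h
  rw [← h]
  refine integral_congr_ae (ae_of_all _ fun ω => ?_)
  simp only [map_smul]
  rfl

end

end Anderson

end

theorem theorem1p2 {Ω : Type*} [MeasurableSpace Ω] (P : Measure Ω) [IsProbabilityMeasure P]
    (ρ : EuclideanSpace ℝ (Fin 4) → ℝ) (hρ : Anderson.IsMollifier ρ)
    (J : ℕ → Ω → Anderson.Distr (Fin 2)) (hJ : Anderson.IsFieldSequence P ρ J)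
    (lam : ℝ) (hlam : |lam| < Real.sqrt 2 * Real.pi) :
    (∃ U : Ω → Anderson.Distr (Fin 2), Measurable U ∧
      (∀ᵐ ω ∂P, Tendsto
        (fun N : ℕ => ∑ n ∈ Finset.Icc 1 N, (Anderson.sigma ρ n * lam ^ (n - 1)) • J n ω)
        atTop (𝓝 (U ω))) ∧
      ∀ (Ω' : Type*) [MeasurableSpace Ω'] (Q : Measure Ω') [IsProbabilityMeasure Q]
        (I : Ω' → Anderson.Distr (Fin 2)), Anderson.IsFieldI Q I →
        P.map U = Q.map (fun ω => Anderson.sigmaEff lam • I ω)) ∧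
    HasSum (fun n : ℕ => (lam ^ 2 / (2 * Real.pi ^ 2)) ^ n)
      (2 * Real.pi ^ 2 / (2 * Real.pi ^ 2 - lam ^ 2)) := by
  refine ⟨⟨Anderson.randomSum (Anderson.fieldTerm ρ J lam),
    Anderson.measurable_randomSum (Anderson.measurable_fieldTerm hJ lam), ?_, ?_⟩,
    Anderson.hasSum_geometric hlam⟩
  · filter_upwards [Anderson.ae_tendsto_field hρ hJ hlam] with ω hω
    simpa only [Anderson.sum_Icc_eq_sum_fieldTerm] using hω
  · intro Ω' _ Q _ I hI
    exact Anderson.map_field_eq hρ hJ hlam hI
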